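/- Let $d\ge 1$ be a fixed physical dimension. There are a constant $C$ and an exponent $p$, depending only on $d$, such that the following holds for all $N\ge 1$. Let $A_1,\dots,A_N$ be tensors, possibly different from site to site, with entries $(A_k)^{ij}_{mn}$, where $i,j=1,\dots,d$ are the physical output and input indices, $m=1,\dots,D_{k-1}$, $n=1,\dots,D_k$, and $D_0=D_N=1$. Let $D=\max_k D_k$, and suppose that the matrix-product operator $U$ on $(\mathbb C^d)^{\otimes N}$ with matrix elements $\langle i_1\dots i_N|U|j_1\dots j_N\rangle=A_1^{i_1j_1}\cdots A_N^{i_Nj_N}$ is unitary (that is, $A_1,\dots,A_N$ define a matrix-product unitary, MPU). Let $q$ be the MPU conditioning number of $U$, defined below. Then $q<\infty$, and $U$ can be implemented exactly by a quantum circuit of arbitrary one- and two-qudit gates with at most $C\,N\log D$ auxiliary qudits (of dimension $d$, initialized in $|0\rangle$ and returned to $|0\rangle$) and of depth at most $C\,N^{1+\log_2 q}\,D^{p}$. Definition of $q$. For a tensor representation of $U$ with bond dimensions $D_k$ and a cut $1\le k<N$, let $X_m$ ($m=1,\dots,D_k$) be the operator on sites $1,\dots,k$ obtained by contracting $A_1,\dots,A_k$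 with the right bond index fixed to $m$, and let $Y_m$ be the operator on sites $k+1,\dots,N$ obtained by contracting $A_{k+1},\dots,A_N$ with the left bond index fixed to $m$, so that $U=\sum_m X_m\otimes Y_m$. Let $\mathcal L_{k+1}$ be the set of those $D_k\times D_k$ matrices $\big(\operatorname{Tr}[\sigma X_{m'}^\dagger X_m]\big)_{m'm}$ that are positive definite, where $\sigma$ ranges over the density operators on sites $1,\dots,k$. Let $\mathcal R_k$ be the set of those matrices $\big(\operatorname{Tr}[\tau Y_{m'}^\dagger Y_m]\big)_{m'm}$ that are positive definite, where $\tau$ ranges over the density operators on sites $k+1,\dots,N$. (Attaching the positive square roots $L_j$ of an element of $\mathcal L_j$ and $R_k$ of an element of $\mathcal R_k$ to the open bonds of the segment $A_j,\dots,A_k$ gives a local isometry.) Put $$q_k=\inf_{R_k^2\in\mathcal R_k,\;L_{k+1}^2\in\mathcal L_{k+1}}\sqrt{\operatorname{tr}\!\big[R_k^{-2}\,(L_{k+1}^{-2})^{T}\big]},$$ with $q_k=\infty$ if one of the two sets is empty. The number $\max_k q_k$ is invariant under gauge transformations of the tensors. It is finite exactly for the representations of $U$ with minimal bond dimensions, such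 as the canonical form, and takes the same value for all of them; $q$ is this value, that is, the infimum of $\max_{1\le k<N}q_k$ over all tensor representations of $U$. (For $N=1$ there is no cut, and the factor $N^{1+\log_2 q}$ is $1$.) -/

import Mathlib

open scoped ENNReal Matrix ComplexOrder

noncomputable section

namespace MPU

/-- Basis configurations of a register of `d`-level systems (qudits) labelled by `ι`. -/
abbrev Config (ι : Type) (d : ℕ) : Type := ι → Fin d

/-- Operators on a register of qudits, as matrices `(output, input)` in the product basis. -/
abbrev Op (ι : Type) (d : ℕ) : Type := Matrix (Config ι d) (Config ι d) ℂ

/-- A density operator: positive semidefinite with trace one. -/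
def IsDensity {n : Type} [Fintype n] (ρ : Matrix n n ℂ) : Prop :=
  ρ.PosSemidef ∧ ρ.trace = 1

/-- The site-dependent tensors of a matrix-product operator with open boundary on `N` sites of
physical dimension `d`. The sites are `0, …, N - 1`. The bond between site `k - 1` and site `k`
has dimension `bond k`, and the two outer bonds `bond 0`, `bond N` are trivial.
`tensor k i j` is the matrix on the bond space with output index `i` and input index `j`.
(Only the tensors of the sites `k < N` and the bonds `k ≤ N` matter.) -/
structure Tensors (d N : ℕ) where
  bond : ℕ → ℕ
  tensor : (k : ℕ) → Fin d → Fin d → Matrix (Fin (bond k)) (Fin (bond (k + 1))) ℂ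
  bond_zero : bond 0 = 1
  bond_last : bond N = 1

namespace Tensors

variable {d N : ℕ}

/-- The bond dimension `D`: the maximum of the local bond dimensions. -/
def maxBond (A : Tensors d N) : ℕ := (Finset.range (N + 1)).sup A.bond

/-- The matrix product of the tensors of the first `k` sites,
with outputs `s` and inputs `t`. -/
def leftProd (A : Tensors d N) : (k : ℕ) → Config (Fin k) d → Config (Fin k) d →
    Matrix (Fin (A.bond 0)) (Fin (A.bond k)) ℂ
  | 0, _, _ => 1
  | k + 1, s, t =>
      A.leftProd k (fun i => s i.castSucc) (fun i => t i.castSucc) *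
        A.tensor k (s (Fin.last k)) (t (Fin.last k))

/-- The matrix product of the tensors of the `n` sites `k, …, k + n - 1`. -/
def segProd (A : Tensors d N) (k : ℕ) : (n : ℕ) → Config (Fin n) d → Config (Fin n) d →
    Matrix (Fin (A.bond k)) (Fin (A.bond (k + n))) ℂ
  | 0, _, _ => 1
  | n + 1, s, t =>
      A.segProd k n (fun i => s i.castSucc) (fun i => t i.castSucc) *
        A.tensor (k + n) (s (Fin.last n)) (t (Fin.last n))

/-- The matrix-product operator on `N` sites. Both outer bonds are one-dimensional, so that
the sum has a single term. -/
def toOp (A : Tensors d N) : Op (Fin N) d :=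
  Matrix.of fun s t => ∑ a, ∑ b, A.leftProd N s t a b

/-- The tensors define a matrix-product unitary (MPU). -/
def IsMPU (A : Tensors d N) : Prop := A.toOp ∈ Matrix.unitaryGroup (Config (Fin N) d) ℂ

/-- The operator on the first `k` sites obtained by contracting their tensors,
the bond `k` to the right of them being left open with index `m`. -/
def leftOp (A : Tensors d N) (k : ℕ) (m : Fin (A.bond k)) : Op (Fin k) d :=
  Matrix.of fun s t => ∑ a, A.leftProd k s t a m

/-- The operator on the last `N - k` sites obtained by contracting their tensors,
the bond `k` to the left of them being left open with index `m`. -/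
def rightOp (A : Tensors d N) (k : ℕ) (m : Fin (A.bond k)) : Op (Fin (N - k)) d :=
  Matrix.of fun s t => ∑ b, A.segProd k (N - k) s t m b

/-- The matrix on the bond `k` obtained by contracting the first `k` tensors and their adjoints
with a density operator `σ` on the first `k` sites. -/
def leftGram (A : Tensors d N) (k : ℕ) (σ : Op (Fin k) d) :
    Matrix (Fin (A.bond k)) (Fin (A.bond k)) ℂ :=
  Matrix.of fun m' m => (σ * ((A.leftOp k m')ᴴ * A.leftOp k m)).trace

/-- The matrix on the bond `k` obtained by contracting the last `N - k` tensors and their adjoints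
with a density operator `τ` on the last `N - k` sites. -/
def rightGram (A : Tensors d N) (k : ℕ) (τ : Op (Fin (N - k)) d) :
    Matrix (Fin (A.bond k)) (Fin (A.bond k)) ℂ :=
  Matrix.of fun m' m => (τ * ((A.rightOp k m')ᴴ * A.rightOp k m)).trace

/-- The admissible operators `L²` on the bond `k`, `L` being the operator that is attached on the
left of site `k` to turn a segment of tensors starting there into a local isometry. -/
def leftSet (A : Tensors d N) (k : ℕ) : Set (Matrix (Fin (A.bond k)) (Fin (A.bond k)) ℂ) :=
  {Q | Q.PosDef ∧ ∃ σ : Op (Fin k) d, IsDensity σ ∧ Q = A.leftGram k σ}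

/-- The admissible operators `R²` on the bond `k`, `R` being the operator that is attached on the
right of site `k - 1` to turn a segment of tensors ending there into a local isometry. -/
def rightSet (A : Tensors d N) (k : ℕ) : Set (Matrix (Fin (A.bond k)) (Fin (A.bond k)) ℂ) :=
  {P | P.PosDef ∧ ∃ τ : Op (Fin (N - k)) d, IsDensity τ ∧ P = A.rightGram k τ}

/-- The infimum of `√ tr (R⁻² (L⁻²)ᵀ)` over the admissible `P = R²` and `Q = L²` on the bond `k`;
it is `∞` if there are none. -/
def cutConditioning (A : Tensors d N) (k : ℕ) : ℝ≥0∞ :=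
  ⨅ P ∈ A.rightSet k, ⨅ Q ∈ A.leftSet k,
    ENNReal.ofReal (Real.sqrt (Matrix.trace (P⁻¹ * (Q⁻¹)ᵀ)).re)

/-- The maximum of `cutConditioning` over the bonds `1, …, N - 1` between two sites. -/
def conditioning (A : Tensors d N) : ℝ≥0∞ :=
  ⨆ k ∈ Finset.Ico 1 N, A.cutConditioning k

end Tensors

/-- The MPU conditioning number of an operator `U`. `Tensors.conditioning` is invariant under gauge
transformations of the tensors, and admissible pairs `R²`, `L²` exist at every bond exactly when all
bond dimensions are minimal (as they are in the canonical form); the infimum over the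
tensor representations of `U` selects this common value. -/
def conditioningNumber {d N : ℕ} (U : Op (Fin N) d) : ℝ≥0∞ :=
  ⨅ (B : Tensors d N) (_ : B.toOp = U), B.conditioning

/-! ### Quantum circuits of two-qudit gates -/

/-- A gate: a unitary on one or two qudits of the register. -/
structure Gate (ι : Type) [DecidableEq ι] (d : ℕ) where
  support : Finset ι
  support_nonempty : support.Nonempty
  card_support_le : support.card ≤ 2
  matrix : Op support d
  unitary : matrix ∈ Matrix.unitaryGroup (Config support d) ℂ

open Classical in
/-- The action of a gate on the whole register: identity outside of its support. -/
def Gate.toOp {ι : Type} [DecidableEq ι] {d : ℕ} (g : Gate ι d) : Op ι d :=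
  Matrix.of fun x y =>
    if ∀ w, w ∉ g.support → x w = y w then
      g.matrix (fun w => x w) (fun w => y w)
    else 0

/-- A layer: gates with pairwise disjoint supports, executed in parallel. -/
structure Layer (ι : Type) [DecidableEq ι] (d : ℕ) where
  gates : List (Gate ι d)
  disjoint : gates.Pairwise fun g h => Disjoint g.support h.support

/-- The operator of a layer (the gates of a layer commute). -/
def Layer.toOp {ι : Type} [Fintype ι] [DecidableEq ι] {d : ℕ} (l : Layer ι d) : Op ι d :=
  (l.gates.map Gate.toOp).prod

/-- A quantum circuit: a sequence of layers, the head of the list being executed last. -/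
abbrev Circuit (ι : Type) [DecidableEq ι] (d : ℕ) : Type := List (Layer ι d)

/-- The depth of a circuit: its number of layers. -/
def Circuit.depth {ι : Type} [DecidableEq ι] {d : ℕ} (c : Circuit ι d) : ℕ := List.length c

/-- The operator of a circuit. -/
def Circuit.toOp {ι : Type} [Fintype ι] [DecidableEq ι] {d : ℕ} (c : Circuit ι d) : Op ι d :=
  (List.map Layer.toOp c).prod

/-- A circuit on `N` system qudits and `m` auxiliary qudits implements the operator `U` on the system
if it maps `|y⟩ ⊗ |0…0⟩` to `U |y⟩ ⊗ |0…0⟩` for every `y`. -/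
def Circuit.Implements {N m d : ℕ} [NeZero d] (c : Circuit (Fin N ⊕ Fin m) d)
    (U : Op (Fin N) d) : Prop :=
  ∀ (y x : Config (Fin N) d) (a : Config (Fin m) d),
    c.toOp (Sum.elim x a) (Sum.elim y fun _ => 0) = if a = (fun _ => 0) then U x y else 0

end MPU

end

/-! Fix densities σ and τ on the sites to the left and to the right of a segment, and attach to its
open bonds factors `L`, `R` of the two Gram matrices (`Lᴴ L`, `Rᴴ R`). Unitarity of the whole
operator makes `W = L A⋯A Rᵀ` an isometry from the sites of the segment to these sites and two bond
registers (`isometry_of_unitary`). Neighbouring isometries are glued by contracting the two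
registers at their cut with `Φ = (Rᵀ)⁻¹ L⁻¹`, because `Rᵀ Φ L = 1`. As a vector on the two
registers, Φ has squared norm tr[R⁻²(L⁻²)ᵀ], the quantity minimized in q_k² (`sum_norm_sq_inv`).
Hence, for ν ≤ 1/q, the vector νΦ can be completed to a unit vector by means of an unused level, and
a unitary having this vector as its row 0 glues the segments with amplitude ν, success being
signalled by the registers at the cut being 0 (`IsoData.Encodes.merge`).

The failure branch is removed coherently. Since the encoded operator is an isometry, the success
probability is the same for all inputs, and 2t+1 uses of the circuit or its inverse turn the
amplitude sin θ into sin((2t+1)θ) on every input at once (`amplification`). Blocks are merged in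
parallel along a binary tree. Two levels of the tree are treated together: they need at most 4q²
uses and end with amplitude exactly one (`exists_rounds`). So the block length is multiplied by 4
while the depth is multiplied by at most 4q², and (4q²)^K ≤ N^(1 + log₂ q) when 4^K ≤ N
(`pow_rounds_le`). The additive costs of merges and reflections scale with the block length, by 4
per step, and are absorbed because the number of uses is at least 8 (`IsoData.exists_built`). For
the full chain the encoded isometry is U itself, and a norm count shows that all bond registers
return to 0 (`IsoData.apply_of_encodes`).

The unitaries on bond registers and on short blocks are compiled into one- and two-qudit gates by
Householder reflections and multiply controlled gates, with a clean workspace that doubles the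
register (`reach_emb`). The cost is polynomial in d^b, where b is the size of a bond register and
d^b ≤ d D.

It remains to choose the representation. Where both admissible sets are nonempty, the bond dimension
is minimal (`bond_le_of_toOp_eq`), so a representation nearly attaining q has bonds bounded by those
of the given one; a representation of minimal total dimension, with maximally mixed densities, shows
q < ∞. By Cauchy–Schwarz q_k is at least the bond dimension (`sq_bond_le`). Thus either some bond is
at least 2 and q ≥ 2, as the amplification schedule requires, or all bonds are trivial and U is a
product of one-site unitaries. Attainment of the infimum is avoided by working with q·2^(1/N), which
costs a factor 2 in depth. -/

set_option linter.unusedSectionVars false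

open scoped ENNReal Matrix ComplexOrder

noncomputable section

namespace MPU

/-! ### Operators acting on one qudit, controlled by the others -/

section Blk
variable {ι : Type} [Fintype ι] [DecidableEq ι] {d : ℕ}

/-- The operator applying to the qudit `t` the matrix `F y`, which may depend on the other qudits. -/
def blk (t : ι) (F : Config ι d → Matrix (Fin d) (Fin d) ℂ) : Op ι d :=
  Matrix.of fun x y => if ∀ w, w ≠ t → x w = y w then F y (x t) (y t) else 0

/-- `F` does not depend on the qudit `t`. -/
def Indep (t : ι) (F : Config ι d → Matrix (Fin d) (Fin d) ℂ) : Prop :=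
  ∀ y u, F (Function.update y t u) = F y

lemma eq_update_of_agree {t : ι} {x y : Config ι d} (h : ∀ w, w ≠ t → x w = y w) :
    y = Function.update x t (y t) := by
  funext w
  by_cases hw : w = t
  · subst hw; simp
  · simp [hw, h w hw]

lemma Indep.eq_of_agree {t : ι} {F : Config ι d → Matrix (Fin d) (Fin d) ℂ} (hF : Indep t F)
    {x y : Config ι d} (h : ∀ w, w ≠ t → x w = y w) : F y = F x := by
  rw [eq_update_of_agree h, hF]

lemma sum_eq_sum_update (t : ι) (x : Config ι d) (f : Config ι d → ℂ)
    (h : ∀ y, ¬ (∀ w, w ≠ t → x w = y w) → f y = 0) :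
    ∑ y, f y = ∑ u, f (Function.update x t u) := by
  symm
  refine Fintype.sum_of_injective (fun u => Function.update x t u)
    (Function.update_injective x t) _ _ ?_ (fun _ => rfl)
  intro y hy
  apply h
  intro hxy
  exact hy ⟨y t, (eq_update_of_agree hxy).symm⟩

lemma blk_apply_of_agree {t : ι} {F : Config ι d → Matrix (Fin d) (Fin d) ℂ} {x y : Config ι d}
    (h : ∀ w, w ≠ t → x w = y w) : blk t F x y = F y (x t) (y t) := if_pos h

lemma blk_apply_of_not {t : ι} {F : Config ι d → Matrix (Fin d) (Fin d) ℂ} {x y : Config ι d}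
    (h : ¬ ∀ w, w ≠ t → x w = y w) : blk t F x y = 0 := if_neg h

lemma blk_mulVec {t : ι} {F : Config ι d → Matrix (Fin d) (Fin d) ℂ} (hF : Indep t F)
    (v : Config ι d → ℂ) (x : Config ι d) :
    (blk t F *ᵥ v) x = ∑ u, F x (x t) u * v (Function.update x t u) := by
  rw [Matrix.mulVec, dotProduct, sum_eq_sum_update t x]
  · refine Finset.sum_congr rfl fun u _ => ?_
    have : ∀ w, w ≠ t → x w = Function.update x t u w := fun w hw => by simp [hw]
    simp only [blk, Matrix.of_apply, if_pos this, Function.update_self, hF x u]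
  · intro y hy
    simp only [blk, Matrix.of_apply, if_neg hy, zero_mul]

/-- Only the left factor has to be independent of the target: it is evaluated at the intermediate
configuration, which can differ from the input at `t` only. -/
lemma blk_mul {t : ι} {F G : Config ι d → Matrix (Fin d) (Fin d) ℂ} (hF : Indep t F) :
    blk t F * blk t G = blk t (fun y => F y * G y) := by
  ext x y
  have := blk_mulVec hF (fun z => blk t G z y) x
  rw [Matrix.mulVec, dotProduct] at this
  rw [Matrix.mul_apply, this]
  by_cases h : ∀ w, w ≠ t → x w = y w
  · have h2 : ∀ u, ∀ w, w ≠ t → Function.update x t u w = y w := fun u w hw => by simp [hw, h w hw]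
    rw [blk_apply_of_agree h, Matrix.mul_apply]
    refine Finset.sum_congr rfl fun u _ => ?_
    rw [blk_apply_of_agree (h2 u), hF.eq_of_agree h, Function.update_self]
  · rw [blk_apply_of_not h]
    refine Finset.sum_eq_zero fun u _ => ?_
    rw [blk_apply_of_not, mul_zero]
    intro h2
    exact h fun w hw => by simpa [hw] using h2 w hw

lemma blk_one (t : ι) : blk t (fun _ => (1 : Matrix (Fin d) (Fin d) ℂ)) = 1 := by
  ext x y
  by_cases h : ∀ w, w ≠ t → x w = y w
  · rw [blk_apply_of_agree h, Matrix.one_apply, Matrix.one_apply]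
    congr 1
    refine propext ⟨fun h2 => ?_, fun h2 => h2 ▸ rfl⟩
    funext w
    by_cases hw : w = t
    · rw [hw, h2]
    · exact h w hw
  · rw [blk_apply_of_not h, Matrix.one_apply_ne]
    rintro rfl
    exact h fun _ _ => rfl

lemma blk_conjTranspose {t : ι} {F : Config ι d → Matrix (Fin d) (Fin d) ℂ} (hF : Indep t F) :
    (blk t F)ᴴ = blk t (fun y => (F y)ᴴ) := by
  ext x y
  simp only [blk, Matrix.conjTranspose_apply, Matrix.of_apply]
  by_cases h : ∀ w, w ≠ t → x w = y w
  · have h' : ∀ w, w ≠ t → y w = x w := fun w hw => (h w hw).symm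
    rw [if_pos h, if_pos h', hF.eq_of_agree h]
  · have h' : ¬ ∀ w, w ≠ t → y w = x w := fun h2 => h fun w hw => (h2 w hw).symm
    rw [if_neg h, if_neg h', star_zero]

lemma Indep.conjTranspose {t : ι} {F : Config ι d → Matrix (Fin d) (Fin d) ℂ} (hF : Indep t F) :
    Indep t (fun y => (F y)ᴴ) := fun y u => congrArg _ (hF y u)

lemma blk_mem_unitaryGroup {t : ι} {F : Config ι d → Matrix (Fin d) (Fin d) ℂ} (hF : Indep t F)
    (hU : ∀ y, F y ∈ Matrix.unitaryGroup (Fin d) ℂ) :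
    blk t F ∈ Matrix.unitaryGroup (Config ι d) ℂ := by
  rw [Matrix.mem_unitaryGroup_iff, Matrix.star_eq_conjTranspose, blk_conjTranspose hF, blk_mul hF,
    ← blk_one t]
  congr 1
  funext y
  exact Matrix.mem_unitaryGroup_iff.1 (hU y)

/-- A unitary acting on one qudit, controlled by the others. -/
def IsBlk (E : Op ι d) : Prop :=
  ∃ t F, Indep t F ∧ (∀ y, F y ∈ Matrix.unitaryGroup (Fin d) ℂ) ∧ E = blk t F

/-- A product of at most `k` controlled one-qudit unitaries. -/
def IsBlkProd (k : ℕ) (M : Op ι d) : Prop :=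
  ∃ l : List (Op ι d), l.length ≤ k ∧ (∀ E ∈ l, IsBlk E) ∧ l.prod = M

lemma IsBlk.mem_unitaryGroup {E : Op ι d} (h : IsBlk E) :
    E ∈ Matrix.unitaryGroup (Config ι d) ℂ := by
  obtain ⟨t, F, hF, hU, rfl⟩ := h
  exact blk_mem_unitaryGroup hF hU

lemma IsBlk.conjTranspose {E : Op ι d} (h : IsBlk E) : IsBlk Eᴴ := by
  obtain ⟨t, F, hF, hU, rfl⟩ := h
  exact ⟨t, _, hF.conjTranspose, fun y => Unitary.star_mem (hU y), blk_conjTranspose hF⟩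

lemma isBlkProd_one : IsBlkProd 0 (1 : Op ι d) := ⟨[], by simp⟩

lemma IsBlk.isBlkProd {E : Op ι d} (h : IsBlk E) : IsBlkProd 1 E := ⟨[E], by simpa using h⟩

lemma IsBlkProd.mono {k k' : ℕ} {M : Op ι d} (h : IsBlkProd k M) (hk : k ≤ k') :
    IsBlkProd k' M := by
  obtain ⟨l, h1, h2, h3⟩ := h
  exact ⟨l, h1.trans hk, h2, h3⟩

lemma IsBlkProd.mul {k k' : ℕ} {M M' : Op ι d} (h : IsBlkProd k M) (h' : IsBlkProd k' M') :
    IsBlkProd (k + k') (M * M') := by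
  obtain ⟨l, h1, h2, h3⟩ := h
  obtain ⟨l', h1', h2', h3'⟩ := h'
  refine ⟨l ++ l', by simp; omega, ?_, by simp [h3, h3']⟩
  intro E hE
  rcases List.mem_append.1 hE with hE | hE
  exacts [h2 E hE, h2' E hE]

lemma IsBlkProd.conjTranspose {k : ℕ} {M : Op ι d} (h : IsBlkProd k M) : IsBlkProd k Mᴴ := by
  obtain ⟨l, h1, h2, rfl⟩ := h
  refine ⟨(l.map Matrix.conjTranspose).reverse, by simpa using h1, ?_,
    (Matrix.conjTranspose_list_prod l).symm⟩
  intro E hE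
  simp only [List.mem_reverse, List.mem_map] at hE
  obtain ⟨E', hE', rfl⟩ := hE
  exact (h2 E' hE').conjTranspose

lemma IsBlkProd.mem_unitaryGroup {k : ℕ} {M : Op ι d} (h : IsBlkProd k M) :
    M ∈ Matrix.unitaryGroup (Config ι d) ℂ := by
  obtain ⟨l, h1, h2, rfl⟩ := h
  exact Submonoid.list_prod_mem _ fun E hE => (h2 E hE).mem_unitaryGroup

end Blk

/-! ### Reflections -/

section Reflection
variable {n : Type} [Fintype n] [DecidableEq n]

/-- A rank-one perturbation of the identity. -/
def rankOne (γ : ℂ) (a : n → ℂ) : Matrix n n ℂ := 1 - γ • Matrix.vecMulVec a (star a)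

lemma rankOne_mulVec (γ : ℂ) (a x : n → ℂ) :
    rankOne γ a *ᵥ x = x - (γ * (star a ⬝ᵥ x)) • a := by
  rw [rankOne, Matrix.sub_mulVec, Matrix.one_mulVec, Matrix.smul_mulVec, Matrix.vecMulVec_mulVec]
  ext i
  simp; ring

/-- Complex Householder reflection along `v - w`. The inner product of `w` and `v` need not be real,
so the coefficient is `β⁻¹` with `β = 1 - ⟨w, v⟩`; unitarity is equivalent to `‖v - w‖² = β + β̄`.
Vectors orthogonal to `v` and `w` are orthogonal to the axis and hence fixed. -/
lemma exists_reflection {v w : n → ℂ} (hv : star v ⬝ᵥ v = 1) (hw : star w ⬝ᵥ w = 1) :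
    ∃ γ a, rankOne γ a ∈ Matrix.unitaryGroup n ℂ ∧ rankOne γ a *ᵥ v = w ∧
      ∀ x, star v ⬝ᵥ x = 0 → star w ⬝ᵥ x = 0 → rankOne γ a *ᵥ x = x := by
  by_cases hvw : v = w
  · subst hvw
    refine ⟨0, 0, ?_, ?_, ?_⟩
    · simp [rankOne]
    · simp [rankOne]
    · simp [rankOne]
  set β : ℂ := 1 - star w ⬝ᵥ v with hβ
  have hvw' : star (v - w) ⬝ᵥ (v - w) = β + star β := by
    have : star v ⬝ᵥ w = star (star w ⬝ᵥ v) := by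
      rw [Matrix.star_dotProduct]
    rw [star_sub, sub_dotProduct, dotProduct_sub, dotProduct_sub, hv, hw, this, hβ]
    simp; ring
  have hβ0 : β ≠ 0 := by
    intro h0
    rw [h0] at hvw'
    simp only [star_zero, add_zero] at hvw'
    rw [dotProduct_star_self_eq_zero] at hvw'
    exact hvw (sub_eq_zero.1 hvw')
  have hβ0' : star β ≠ 0 := by simpa using hβ0
  refine ⟨β⁻¹, v - w, ?_, ?_, ?_⟩
  · rw [Matrix.mem_unitaryGroup_iff', Matrix.star_eq_conjTranspose]
    simp only [rankOne, Matrix.conjTranspose_sub, Matrix.conjTranspose_one,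
      Matrix.conjTranspose_smul, Matrix.conjTranspose_vecMulVec, star_star]
    rw [sub_mul, mul_sub, mul_sub, mul_one, one_mul, mul_one, Matrix.smul_mul, Matrix.mul_smul,
      Matrix.vecMulVec_mul_vecMulVec, hvw', Matrix.vecMulVec_smul, smul_smul, smul_smul]
    rw [sub_sub, sub_eq_self, ← sub_eq_zero]
    rw [add_sub, ← add_smul, ← sub_smul]
    rw [star_inv₀, show (β⁻¹ + (star β)⁻¹ - (star β)⁻¹ * β⁻¹ * (β + star β)) = 0 by
      field_simp; ring, zero_smul, sub_zero]
  · rw [rankOne_mulVec, star_sub, sub_dotProduct, hv, ← hβ, inv_mul_cancel₀ hβ0, one_smul]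
    abel
  · intro x h1 h2
    rw [rankOne_mulVec, star_sub, sub_dotProduct, h1, h2]
    simp

lemma mem_unitaryGroup_dotProduct {U : Matrix n n ℂ} (hU : U ∈ Matrix.unitaryGroup n ℂ)
    (v w : n → ℂ) : star (U *ᵥ v) ⬝ᵥ (U *ᵥ w) = star v ⬝ᵥ w := by
  rw [Matrix.star_mulVec, ← Matrix.dotProduct_mulVec, Matrix.mulVec_mulVec,
    ← Matrix.star_eq_conjTranspose, Matrix.mem_unitaryGroup_iff'.1 hU, Matrix.one_mulVec]

/-- Every unitary is a product of reflections. -/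
lemma exists_reflections_mul (U : Matrix n n ℂ) (hU : U ∈ Matrix.unitaryGroup n ℂ)
    (s : Finset n) :
    ∃ l : List (Matrix n n ℂ), l.length ≤ s.card ∧
      (∀ R ∈ l, R ∈ Matrix.unitaryGroup n ℂ ∧ ∃ γ a, R = rankOne γ a) ∧
      ∀ i ∈ s, (l.prod * U) *ᵥ Pi.single i 1 = Pi.single i 1 := by
  induction s using Finset.induction_on with
  | empty => exact ⟨[], by simp⟩
  | insert i s his ih =>
    obtain ⟨l, h1, h2, h3⟩ := ih
    have hlU : l.prod * U ∈ Matrix.unitaryGroup n ℂ :=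
      mul_mem (Submonoid.list_prod_mem _ fun R hR => (h2 R hR).1) hU
    have he : ∀ j, star (Pi.single j 1 : n → ℂ) ⬝ᵥ Pi.single j 1 = 1 := by simp
    -- The reflection brings the current image of the basis vector `i` back to `i`. The basis
    -- vectors treated earlier are already fixed by `l.prod * U`, so by unitarity they are
    -- orthogonal to that image as well as to `i`, and stay fixed.
    obtain ⟨γ, a, hR, hRv, hRx⟩ := exists_reflection
      (v := (l.prod * U) *ᵥ Pi.single i 1) (w := Pi.single i 1)
      (by rw [mem_unitaryGroup_dotProduct hlU, he]) (he i)
    refine ⟨rankOne γ a :: l, by simp [his]; omega, ?_, ?_⟩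
    · intro R hR'
      rcases List.mem_cons.1 hR' with rfl | hR'
      · exact ⟨hR, _, _, rfl⟩
      · exact h2 R hR'
    · intro j hj
      rw [List.prod_cons, mul_assoc, ← Matrix.mulVec_mulVec]
      rcases Finset.mem_insert.1 hj with rfl | hj
      · exact hRv
      · have hij : i ≠ j := fun h => his (h ▸ hj)
        rw [h3 j hj]
        apply hRx
        · rw [← h3 j hj, mem_unitaryGroup_dotProduct hlU]
          simp [hij]
        · simp [hij]

end Reflection

/-! ### Decomposition of unitaries into controlled one-qudit unitaries -/

section Synthesis
variable {ι : Type} [Fintype ι] [DecidableEq ι] {d : ℕ} [NeZero d]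

lemma exists_unitary_mulVec_single (w : Fin d → ℂ) :
    ∃ U ∈ Matrix.unitaryGroup (Fin d) ℂ, ∀ i, i ≠ 0 → (U *ᵥ w) i = 0 := by
  by_cases hw : w = 0
  · exact ⟨1, one_mem _, by simp [hw]⟩
  set r : ℝ := Real.sqrt (star w ⬝ᵥ w).re
  have hpos : 0 < star w ⬝ᵥ w := Matrix.dotProduct_star_self_pos_iff.2 hw
  have hr : (r : ℂ) * r = star w ⬝ᵥ w := by
    rw [← Complex.ofReal_mul, Real.mul_self_sqrt (Complex.pos_iff.1 hpos).1.le]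
    exact Complex.ext rfl (Complex.pos_iff.1 hpos).2
  have hr0 : (r : ℂ) ≠ 0 := by
    intro h
    rw [h, zero_mul] at hr
    exact hpos.ne hr
  obtain ⟨γ, a, hU, hv, -⟩ := exists_reflection (v := (r : ℂ)⁻¹ • w) (w := Pi.single (0 : Fin d) 1)
    (by
      rw [star_smul, smul_dotProduct, dotProduct_smul, ← hr]
      simp [hr0]) (by simp)
  refine ⟨_, hU, fun i hi => ?_⟩
  have : w = (r : ℂ) • ((r : ℂ)⁻¹ • w) := by rw [smul_smul, mul_inv_cancel₀ hr0, one_smul]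
  rw [this, Matrix.mulVec_smul, hv]
  simp [hi]

/-- The qudits are cleared one at a time. For each configuration of the others, the slice of the
vector along `t` is rotated onto level 0 by a unitary depending on that configuration. This mixes
only configurations differing at `t`, so zeros obtained from other qudits survive. -/
lemma exists_blkProd_mulVec (v : Config ι d → ℂ) (s : Finset ι) :
    ∃ S : Op ι d, IsBlkProd s.card S ∧ ∀ x, (∃ t ∈ s, x t ≠ 0) → (S *ᵥ v) x = 0 := by
  induction s using Finset.induction_on with
  | empty => exact ⟨1, isBlkProd_one, by simp⟩
  | insert t s hts ih =>
    obtain ⟨S, hS, hSv⟩ := ih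
    choose U hU hU0 using exists_unitary_mulVec_single (d := d)
    set F : Config ι d → Matrix (Fin d) (Fin d) ℂ :=
      fun y => U fun a => (S *ᵥ v) (Function.update y t a) with hFdef
    have hF : Indep t F := fun y u => by simp [hFdef]
    refine ⟨blk t F * S, ?_, ?_⟩
    · rw [Finset.card_insert_of_notMem hts, add_comm]
      exact IsBlkProd.mul (IsBlk.isBlkProd ⟨t, F, hF, fun y => hU _, rfl⟩) hS
    · intro x hx
      rw [← Matrix.mulVec_mulVec, blk_mulVec hF]
      by_cases hxt : x t = 0
      · obtain ⟨t', ht', hxt'⟩ := hx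
        have htt : t' ≠ t := fun h => hxt' (h ▸ hxt)
        have ht's : t' ∈ s := (Finset.mem_insert.1 ht').resolve_left htt
        refine Finset.sum_eq_zero fun u _ => ?_
        rw [hSv _ ⟨t', ht's, by simpa [htt] using hxt'⟩, mul_zero]
      · exact hU0 (fun a => (S *ᵥ v) (Function.update x t a)) (x t) hxt

lemma rankOne_conj {n : Type} [Fintype n] [DecidableEq n] {S : Matrix n n ℂ}
    (hS : S ∈ Matrix.unitaryGroup n ℂ) (γ : ℂ) (a : n → ℂ) :
    S * rankOne γ a * Sᴴ = rankOne γ (S *ᵥ a) := by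
  rw [rankOne, mul_sub, sub_mul, mul_one, ← Matrix.star_eq_conjTranspose,
    Matrix.mem_unitaryGroup_iff.1 hS, Matrix.star_eq_conjTranspose, Matrix.mul_smul,
    Matrix.smul_mul, Matrix.mul_vecMulVec, Matrix.vecMulVec_mul, rankOne, Matrix.star_mulVec]

/-- Conjugation with a product `S` that concentrates `a` on the all-zero configuration leaves a
diagonal unitary with one nontrivial phase δ. This is a phase on a single qudit, controlled by the
others being 0. The count is `S`, its adjoint, and the phase. -/
lemma isBlkProd_rankOne [Nonempty ι] {γ : ℂ} {a : Config ι d → ℂ}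
    (hR : rankOne γ a ∈ Matrix.unitaryGroup (Config ι d) ℂ) :
    IsBlkProd (2 * Fintype.card ι + 1) (rankOne γ a) := by
  obtain ⟨S, hS, hSa⟩ := exists_blkProd_mulVec a (Finset.univ : Finset ι)
  have hSu := hS.mem_unitaryGroup
  have hSSu : Sᴴ * S = 1 := Matrix.mem_unitaryGroup_iff'.1 hSu
  have key : rankOne γ a = Sᴴ * rankOne γ (S *ᵥ a) * S := by
    rw [← rankOne_conj hSu]
    calc rankOne γ a = (Sᴴ * S) * rankOne γ a * (Sᴴ * S) := by rw [hSSu]; simp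
      _ = _ := by simp only [mul_assoc]
  have hSR : rankOne γ (S *ᵥ a) ∈ Matrix.unitaryGroup (Config ι d) ℂ := by
    rw [← rankOne_conj hSu]
    exact mul_mem (mul_mem hSu hR) (Unitary.star_mem hSu)
  set κ : ℂ := (S *ᵥ a) 0 with hκ
  have hSa' : S *ᵥ a = Pi.single 0 κ := by
    funext x
    by_cases hx : x = 0
    · subst hx; simp [hκ]
    · rw [Pi.single_eq_of_ne hx]
      obtain ⟨t, ht⟩ := Function.ne_iff.1 hx
      exact hSa x ⟨t, Finset.mem_univ t, ht⟩
  set δ : ℂ := 1 - γ * (κ * star κ) with hδ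
  have hdiag : rankOne γ (S *ᵥ a) = Matrix.diagonal (fun x => if x = 0 then δ else 1) := by
    rw [hSa']
    ext x y
    rw [rankOne, Matrix.sub_apply, Matrix.smul_apply, Matrix.vecMulVec_apply, Matrix.diagonal_apply,
      Matrix.one_apply, Pi.star_apply]
    by_cases hx : x = 0
    · by_cases hy : y = 0
      · subst hx hy; simp [hδ]
      · have : x ≠ y := fun h => hy (h ▸ hx)
        simp [hy, this]
    · by_cases hxy : x = y
      · subst hxy; simp [hx]
      · simp [hx, hxy]
  have hδ1 : δ * star δ = 1 := by
    have := Matrix.mem_unitaryGroup_iff.1 hSR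
    rw [hdiag, Matrix.star_eq_conjTranspose, Matrix.diagonal_conjTranspose,
      Matrix.diagonal_mul_diagonal] at this
    have h0 := congrFun (congrFun this 0) 0
    simpa using h0
  have t : ι := Classical.arbitrary ι
  have hblk : IsBlk (rankOne γ (S *ᵥ a)) := by
    refine ⟨t, fun y => if ∀ w, w ≠ t → y w = 0 then
      Matrix.diagonal (fun i => if i = 0 then δ else 1) else 1, ?_, ?_, ?_⟩
    · intro y u
      have : (∀ w, w ≠ t → Function.update y t u w = 0) ↔ (∀ w, w ≠ t → y w = 0) := by
        refine forall_congr' fun w => ?_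
        by_cases hw : w = t <;> simp [hw]
      simp only [this]
    · intro y
      dsimp only
      split_ifs
      · rw [Matrix.mem_unitaryGroup_iff, Matrix.star_eq_conjTranspose,
          Matrix.diagonal_conjTranspose, Matrix.diagonal_mul_diagonal, ← Matrix.diagonal_one]
        congr 1
        funext i
        by_cases hi : i = 0 <;> simp [hi]
        simpa using hδ1
      · exact one_mem _
    · rw [hdiag]
      ext x y
      rw [blk, Matrix.of_apply, Matrix.diagonal_apply]
      by_cases h : ∀ w, w ≠ t → x w = y w
      · rw [if_pos h]
        have hxy : x = y ↔ x t = y t := by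
          refine ⟨fun h2 => h2 ▸ rfl, fun h2 => ?_⟩
          funext w
          by_cases hw : w = t
          · rw [hw, h2]
          · exact h w hw
        have hx0 : x = 0 ↔ (∀ w, w ≠ t → y w = 0) ∧ x t = 0 := by
          refine ⟨fun h2 => ⟨fun w hw => by rw [← h w hw, h2]; rfl, by rw [h2]; rfl⟩, fun h2 => ?_⟩
          funext w
          by_cases hw : w = t
          · rw [hw, h2.2]; rfl
          · rw [h w hw, h2.1 w hw]; rfl
        by_cases h2 : ∀ w, w ≠ t → y w = 0
        · have hx0' : x = 0 ↔ x t = 0 := by rw [hx0]; exact and_iff_right h2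
          rw [if_pos h2, Matrix.diagonal_apply]
          simp [hxy, hx0']
        · have hx0' : ¬ x = 0 := fun h3 => h2 (hx0.1 h3).1
          rw [if_neg h2, Matrix.one_apply]
          simp [hxy, hx0']
      · rw [if_neg h, if_neg]
        rintro rfl
        exact h fun _ _ => rfl
  rw [key]
  refine ((hS.conjTranspose.mul hblk.isBlkProd).mul hS).mono ?_
  rw [Finset.card_univ]; omega

/-- Every unitary on a register is a product of few controlled one-qudit unitaries. -/
theorem isBlkProd_of_mem_unitaryGroup [Nonempty ι] {U : Op ι d}
    (hU : U ∈ Matrix.unitaryGroup (Config ι d) ℂ) :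
    IsBlkProd (d ^ Fintype.card ι * (2 * Fintype.card ι + 1)) U := by
  obtain ⟨l, h1, h2, h3⟩ := exists_reflections_mul U hU Finset.univ
  have hl : IsBlkProd (d ^ Fintype.card ι * (2 * Fintype.card ι + 1)) l.prod := by
    have : ∀ l : List (Op ι d), (∀ R ∈ l, R ∈ Matrix.unitaryGroup _ ℂ ∧ ∃ γ a, R = rankOne γ a) →
        IsBlkProd (l.length * (2 * Fintype.card ι + 1)) l.prod := by
      intro l
      induction l with
      | nil => intro _; simpa using isBlkProd_one
      | cons R l ih =>
        intro h
        obtain ⟨hR, γ, a, rfl⟩ := h R (by simp)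
        rw [List.prod_cons, List.length_cons]
        refine ((isBlkProd_rankOne hR).mul (ih fun R hR => h R (by simp [hR]))).mono ?_
        ring_nf; rfl
    refine (this l h2).mono (Nat.mul_le_mul_right _ ?_)
    simpa using h1
  have hlU : l.prod * U = 1 := by
    ext x y
    have := congrFun (h3 y (Finset.mem_univ y)) x
    rw [Matrix.mulVec_single_one] at this
    simpa [Matrix.one_apply, Pi.single_apply] using this
  have hlu := hl.mem_unitaryGroup
  have : U = l.prodᴴ := by
    calc U = (l.prodᴴ * l.prod) * U := by
          rw [← Matrix.star_eq_conjTranspose, Matrix.mem_unitaryGroup_iff'.1 hlu, one_mul]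
      _ = _ := by rw [mul_assoc, hlU, mul_one]
  rw [this]
  exact hl.conjTranspose

end Synthesis

/-! ### Operators embedded into a larger register -/

section Emb
variable {ι : Type} [Fintype ι] [DecidableEq ι] {d : ℕ}

/-- The operator acting as `M` on the qudits in `S` and as the identity on the others. -/
def emb (S : Finset ι) (M : Op S d) : Op ι d :=
  Matrix.of fun x y => if ∀ w, w ∉ S → x w = y w then M (fun w => x w) (fun w => y w) else 0

/-- The configuration `u` on `S`, extended by `x`. -/
def glue (S : Finset ι) (u : Config S d) (x : Config ι d) : Config ι d :=
  fun w => if h : w ∈ S then u ⟨w, h⟩ else x w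

lemma glue_mem {S : Finset ι} (u : Config S d) (x : Config ι d) (w : S) : glue S u x w = u w := by
  simp [glue]

lemma glue_notMem {S : Finset ι} (u : Config S d) (x : Config ι d) {w : ι} (h : w ∉ S) :
    glue S u x w = x w := by
  simp [glue, h]

lemma glue_injective (S : Finset ι) (x : Config ι d) :
    Function.Injective fun u => glue S u x := by
  intro u u' h
  funext w
  rw [← glue_mem u x w, ← glue_mem u' x w]
  exact congrFun h w

lemma emb_apply_of_agree {S : Finset ι} {M : Op S d} {x y : Config ι d}
    (h : ∀ w, w ∉ S → x w = y w) : emb S M x y = M (fun w => x w) (fun w => y w) := if_pos h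

lemma emb_apply_of_not {S : Finset ι} {M : Op S d} {x y : Config ι d}
    (h : ¬ ∀ w, w ∉ S → x w = y w) : emb S M x y = 0 := if_neg h

lemma sum_eq_sum_glue (S : Finset ι) (x : Config ι d) (f : Config ι d → ℂ)
    (h : ∀ y, ¬ (∀ w, w ∉ S → x w = y w) → f y = 0) :
    ∑ y, f y = ∑ u, f (glue S u x) := by
  symm
  refine Fintype.sum_of_injective _ (glue_injective S x) _ _ ?_ (fun _ => rfl)
  intro y hy
  apply h
  intro hxy
  refine hy ⟨fun w => y w, ?_⟩
  funext w
  by_cases hw : w ∈ S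
  · simp [glue, hw]
  · simp [glue, hw, hxy w hw]

lemma emb_mul (S : Finset ι) (M M' : Op S d) : emb S (M * M') = emb S M * emb S M' := by
  ext x y
  rw [Matrix.mul_apply, sum_eq_sum_glue S x]
  · by_cases h : ∀ w, w ∉ S → x w = y w
    · rw [emb_apply_of_agree h, Matrix.mul_apply]
      refine Finset.sum_congr rfl fun u _ => ?_
      rw [emb_apply_of_agree fun w hw => (glue_notMem u x hw).symm,
        emb_apply_of_agree fun w hw => (glue_notMem u x hw).trans (h w hw)]
      simp only [glue_mem]
    · rw [emb_apply_of_not h]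
      refine (Finset.sum_eq_zero fun u _ => ?_).symm
      rw [emb_apply_of_not (M := M'), mul_zero]
      exact fun h2 => h fun w hw => (glue_notMem u x hw).symm.trans (h2 w hw)
  · intro z hz
    rw [emb_apply_of_not hz, zero_mul]

lemma emb_one (S : Finset ι) : emb S (1 : Op S d) = 1 := by
  ext x y
  by_cases h : ∀ w, w ∉ S → x w = y w
  · rw [emb_apply_of_agree h, Matrix.one_apply, Matrix.one_apply]
    congr 1
    refine propext ⟨fun h2 => ?_, fun h2 => h2 ▸ rfl⟩
    funext w
    by_cases hw : w ∈ S
    · exact congrFun h2 ⟨w, hw⟩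
    · exact h w hw
  · rw [emb_apply_of_not h, Matrix.one_apply_ne]
    rintro rfl
    exact h fun _ _ => rfl

lemma emb_conjTranspose (S : Finset ι) (M : Op S d) : emb S Mᴴ = (emb S M)ᴴ := by
  ext x y
  rw [Matrix.conjTranspose_apply]
  by_cases h : ∀ w, w ∉ S → x w = y w
  · rw [emb_apply_of_agree h, emb_apply_of_agree fun w hw => (h w hw).symm,
      Matrix.conjTranspose_apply]
  · rw [emb_apply_of_not h, emb_apply_of_not fun h2 => h fun w hw => (h2 w hw).symm, star_zero]

lemma emb_mem_unitaryGroup {S : Finset ι} {M : Op S d}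
    (hM : M ∈ Matrix.unitaryGroup (Config S d) ℂ) :
    emb S M ∈ Matrix.unitaryGroup (Config ι d) ℂ := by
  rw [Matrix.mem_unitaryGroup_iff, Matrix.star_eq_conjTranspose, ← emb_conjTranspose, ← emb_mul,
    ← emb_one S]
  congr 1
  exact Matrix.mem_unitaryGroup_iff.1 hM

lemma emb_blk {S : Finset ι} (t : S) (F : Config S d → Matrix (Fin d) (Fin d) ℂ) :
    emb S (blk t F) = blk t.1 (fun y => F fun w => y w) := by
  ext x y
  by_cases h : ∀ w, w ≠ t.1 → x w = y w
  · rw [blk_apply_of_agree h, emb_apply_of_agree fun w hw => h w fun h2 => hw (h2 ▸ t.2)]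
    exact blk_apply_of_agree (t := t) fun w hw => h w fun h2 => hw (Subtype.ext h2)
  · rw [blk_apply_of_not h]
    by_cases h' : ∀ w, w ∉ S → x w = y w
    · rw [emb_apply_of_agree h', blk_apply_of_not]
      refine fun h2 => h fun w hw => ?_
      by_cases hwS : w ∈ S
      · exact h2 ⟨w, hwS⟩ fun h3 => hw (congrArg Subtype.val h3)
      · exact h' w hwS
    · rw [emb_apply_of_not h']

lemma emb_mul_emb_apply {S T : Finset ι} (hST : Disjoint S T) (M : Op S d) (M' : Op T d)
    (x y : Config ι d) :
    (emb S M * emb T M') x y = if ∀ w, w ∉ S → w ∉ T → x w = y w then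
      M (fun w => x w) (fun w => y w) * M' (fun w => x w) (fun w => y w) else 0 := by
  rw [Matrix.mul_apply, Fintype.sum_eq_single (fun w => if w ∈ S then y w else x w)]
  · have h1 : ∀ w, w ∉ S → x w = if w ∈ S then y w else x w := fun w hw => by simp [hw]
    have hT : ∀ w : T, w.1 ∉ S := fun w => Finset.disjoint_right.1 hST w.2
    rw [emb_apply_of_agree h1]
    by_cases h : ∀ w, w ∉ S → w ∉ T → x w = y w
    · rw [if_pos h, emb_apply_of_agree]
      · simp [hT]
      · intro w hw
        by_cases hS : w ∈ S
        · simp [hS]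
        · simp [hS, h w hS hw]
    · rw [if_neg h, emb_apply_of_not, mul_zero]
      intro h2
      exact h fun w hS hT => by simpa [hS] using h2 w hT
  · intro z hz
    by_cases h1 : ∀ w, w ∉ S → x w = z w
    · by_cases h2 : ∀ w, w ∉ T → z w = y w
      · refine absurd ?_ hz
        funext w
        by_cases hS : w ∈ S
        · simp [hS, h2 w (Finset.disjoint_left.1 hST hS)]
        · simp [hS, h1 w hS]
      · rw [emb_apply_of_not h2, mul_zero]
    · rw [emb_apply_of_not h1, zero_mul]

lemma emb_commute {S T : Finset ι} (hST : Disjoint S T) (M : Op S d) (M' : Op T d) :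
    Commute (emb S M) (emb T M') := by
  change emb S M * emb T M' = emb T M' * emb S M
  ext x y
  rw [emb_mul_emb_apply hST, emb_mul_emb_apply hST.symm]
  have : (∀ w, w ∉ S → w ∉ T → x w = y w) ↔ (∀ w, w ∉ T → w ∉ S → x w = y w) :=
    ⟨fun h w h1 h2 => h w h2 h1, fun h w h1 h2 => h w h2 h1⟩
  simp only [this, mul_comm]

/-- `E` acts as the identity outside of `S`. -/
def Loc (S : Finset ι) (E : Op ι d) : Prop :=
  ∀ x y, (¬ ∀ w, w ∉ S → x w = y w) → E x y = 0

lemma loc_emb (S : Finset ι) (M : Op S d) : Loc S (emb S M) := fun _ _ h => emb_apply_of_not h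

lemma Loc.mono {S T : Finset ι} {E : Op ι d} (h : Loc S E) (hST : S ⊆ T) : Loc T E :=
  fun x y h2 => h x y fun h3 => h2 fun w hw => h3 w fun hS => hw (hST hS)

lemma loc_one (S : Finset ι) : Loc S (1 : Op ι d) := by
  rw [← emb_one S]; exact loc_emb S 1

lemma Loc.mul {S : Finset ι} {E F : Op ι d} (hE : Loc S E) (hF : Loc S F) : Loc S (E * F) := by
  intro x y h
  rw [Matrix.mul_apply]
  refine Finset.sum_eq_zero fun z _ => ?_
  by_cases h1 : ∀ w, w ∉ S → x w = z w
  · rw [hF z y, mul_zero]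
    exact fun h2 => h fun w hw => (h1 w hw).trans (h2 w hw)
  · rw [hE x z h1, zero_mul]

lemma loc_list_prod {S : Finset ι} {l : List (Op ι d)} (h : ∀ E ∈ l, Loc S E) :
    Loc S l.prod := by
  induction l with
  | nil => exact loc_one S
  | cons E l ih =>
    rw [List.prod_cons]
    exact (h E (by simp)).mul (ih fun F hF => h F (by simp [hF]))

end Emb

/-! ### Circuits -/

section Circ
variable {ι : Type} [Fintype ι] [DecidableEq ι] {d : ℕ}

lemma Gate.toOp_eq_emb (g : Gate ι d) : g.toOp = emb g.support g.matrix := by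
  ext x y
  simp only [Gate.toOp, emb, Matrix.of_apply]
  congr

/-- The inverse gate. -/
def Gate.adj (g : Gate ι d) : Gate ι d where
  support := g.support
  support_nonempty := g.support_nonempty
  card_support_le := g.card_support_le
  matrix := g.matrixᴴ
  unitary := Unitary.star_mem g.unitary

lemma Gate.adj_toOp (g : Gate ι d) : g.adj.toOp = g.toOpᴴ := by
  rw [Gate.toOp_eq_emb, Gate.toOp_eq_emb, ← emb_conjTranspose]; rfl

/-- The inverse layer. -/
def Layer.adj (l : Layer ι d) : Layer ι d where
  gates := (l.gates.map Gate.adj).reverse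
  disjoint := by
    rw [List.pairwise_reverse, List.pairwise_map]
    exact l.disjoint.imp fun h => h.symm

lemma Layer.adj_toOp (l : Layer ι d) : l.adj.toOp = l.toOpᴴ := by
  simp only [Layer.toOp, Layer.adj]
  rw [Matrix.conjTranspose_list_prod, List.map_reverse, List.map_map, List.map_map]
  congr 2
  refine List.map_congr_left fun g _ => g.adj_toOp

/-- All gates of the circuit act inside of `S`. -/
def Within (S : Finset ι) (c : Circuit ι d) : Prop := ∀ l ∈ c, ∀ g ∈ l.gates, g.support ⊆ S

/-- `E` is the operator of a circuit of depth at most `t` acting inside of `S`. -/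
def CircOp (S : Finset ι) (t : ℕ) (E : Op ι d) : Prop :=
  ∃ c : Circuit ι d, c.length ≤ t ∧ Within S c ∧ c.toOp = E

lemma CircOp.mono {S S' : Finset ι} {t t' : ℕ} {E : Op ι d} (h : CircOp S t E) (hS : S ⊆ S')
    (ht : t ≤ t') : CircOp S' t' E := by
  obtain ⟨c, h1, h2, h3⟩ := h
  exact ⟨c, h1.trans ht, fun l hl g hg => (h2 l hl g hg).trans hS, h3⟩

lemma circOp_one (S : Finset ι) : CircOp S 0 (1 : Op ι d) :=
  ⟨[], by simp, by simp [Within], by simp [Circuit.toOp]⟩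

lemma CircOp.mul {S : Finset ι} {t t' : ℕ} {E E' : Op ι d} (h : CircOp S t E)
    (h' : CircOp S t' E') : CircOp S (t + t') (E * E') := by
  obtain ⟨c, h1, h2, rfl⟩ := h
  obtain ⟨c', h1', h2', rfl⟩ := h'
  refine ⟨c ++ c', by rw [List.length_append]; omega, ?_, by simp [Circuit.toOp]⟩
  intro l hl
  rcases List.mem_append.1 hl with hl | hl
  exacts [h2 l hl, h2' l hl]

lemma CircOp.conjTranspose {S : Finset ι} {t : ℕ} {E : Op ι d} (h : CircOp S t E) :
    CircOp S t Eᴴ := by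
  obtain ⟨c, h1, h2, rfl⟩ := h
  refine ⟨(c.map Layer.adj).reverse, by simpa using h1, ?_, ?_⟩
  · intro l hl g hg
    simp only [List.mem_reverse, List.mem_map] at hl
    obtain ⟨l, hl, rfl⟩ := hl
    simp only [Layer.adj, List.mem_reverse, List.mem_map] at hg
    obtain ⟨g, hg, rfl⟩ := hg
    exact h2 l hl g hg
  · simp only [Circuit.toOp]
    rw [Matrix.conjTranspose_list_prod, List.map_reverse, List.map_map, List.map_map]
    congr 2
    exact List.map_congr_left fun l _ => l.adj_toOp

lemma CircOp.mem_unitaryGroup {S : Finset ι} {t : ℕ} {E : Op ι d} (h : CircOp S t E) :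
    E ∈ Matrix.unitaryGroup (Config ι d) ℂ := by
  obtain ⟨c, -, -, rfl⟩ := h
  refine Submonoid.list_prod_mem _ fun E hE => ?_
  obtain ⟨l, -, rfl⟩ := List.mem_map.1 hE
  refine Submonoid.list_prod_mem _ fun E hE => ?_
  obtain ⟨g, -, rfl⟩ := List.mem_map.1 hE
  rw [Gate.toOp_eq_emb]
  exact emb_mem_unitaryGroup g.unitary

lemma CircOp.loc {S : Finset ι} {t : ℕ} {E : Op ι d} (h : CircOp S t E) : Loc S E := by
  obtain ⟨c, -, h2, rfl⟩ := h
  refine loc_list_prod fun E hE => ?_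
  obtain ⟨l, hl, rfl⟩ := List.mem_map.1 hE
  refine loc_list_prod fun E hE => ?_
  obtain ⟨g, hg, rfl⟩ := List.mem_map.1 hE
  rw [Gate.toOp_eq_emb]
  exact (loc_emb _ _).mono (h2 l hl g hg)

/-- The layer without gates. -/
def Layer.idle : Layer ι d := ⟨[], List.Pairwise.nil⟩

/-- Padding with idle layers lets circuits on disjoint registers be run side by side, layer by
layer. -/
lemma CircOp.exists_length_eq {S : Finset ι} {t : ℕ} {E : Op ι d} (h : CircOp S t E) :
    ∃ c : Circuit ι d, c.length = t ∧ Within S c ∧ c.toOp = E := by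
  obtain ⟨c, h1, h2, rfl⟩ := h
  refine ⟨c ++ List.replicate (t - c.length) Layer.idle, ?_, ?_, ?_⟩
  · rw [List.length_append, List.length_replicate]; omega
  · intro l hl
    rcases List.mem_append.1 hl with hl | hl
    · exact h2 l hl
    · rw [List.eq_of_mem_replicate hl]
      simp [Layer.idle]
  · simp [Circuit.toOp, Layer.toOp, Layer.idle]

lemma Layer.commute_of_disjoint {S T : Finset ι} (hST : Disjoint S T) {l l' : Layer ι d}
    (h : ∀ g ∈ l.gates, g.support ⊆ S) (h' : ∀ g ∈ l'.gates, g.support ⊆ T) :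
    Commute l.toOp l'.toOp := by
  refine Commute.list_prod_right _ _ fun E hE => Commute.list_prod_left _ _ fun E' hE' => ?_
  obtain ⟨g, hg, rfl⟩ := List.mem_map.1 hE
  obtain ⟨g', hg', rfl⟩ := List.mem_map.1 hE'
  rw [Gate.toOp_eq_emb, Gate.toOp_eq_emb]
  exact emb_commute (hST.mono (h g' hg') (h' g hg)) _ _

lemma Circuit.exists_parallel {S T : Finset ι} (hST : Disjoint S T) (c c' : Circuit ι d)
    (hl : c.length = c'.length) (h : Within S c) (h' : Within T c') :
    ∃ e : Circuit ι d, e.length = c.length ∧ Within (S ∪ T) e ∧ e.toOp = c.toOp * c'.toOp := by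
  induction c generalizing c' with
  | nil =>
    obtain rfl : c' = [] := by simpa using hl.symm
    exact ⟨[], rfl, by simp [Within], by simp [Circuit.toOp]⟩
  | cons l c ih =>
    cases c' with
    | nil => simp at hl
    | cons l' c' =>
      obtain ⟨e, h1, h2, h3⟩ := ih c' (by simpa using hl) (fun m hm => h m (by simp [hm]))
        (fun m hm => h' m (by simp [hm]))
      have hlS := h l (by simp)
      have hlT := h' l' (by simp)
      refine ⟨⟨l.gates ++ l'.gates, ?_⟩ :: e, by simp [h1], ?_, ?_⟩
      · rw [List.pairwise_append]
        exact ⟨l.disjoint, l'.disjoint, fun g hg g' hg' => hST.mono (hlS g hg) (hlT g' hg')⟩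
      · intro m hm g hg
        rcases List.mem_cons.1 hm with rfl | hm
        · rcases List.mem_append.1 hg with hg | hg
          · exact (hlS g hg).trans Finset.subset_union_left
          · exact (hlT g hg).trans Finset.subset_union_right
        · exact h2 m hm g hg
      · have hc : Commute (Circuit.toOp c) l'.toOp := by
          refine Commute.list_prod_left _ _ fun E hE => ?_
          obtain ⟨m, hm, rfl⟩ := List.mem_map.1 hE
          exact Layer.commute_of_disjoint hST (h m (by simp [hm])) hlT
        have : ∀ (m : Layer ι d) (f : Circuit ι d),
            Circuit.toOp (m :: f) = m.toOp * Circuit.toOp f :=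
          fun m f => by simp [Circuit.toOp]
        have h4 : Layer.toOp (⟨l.gates ++ l'.gates, by
            rw [List.pairwise_append]
            exact ⟨l.disjoint, l'.disjoint, fun g hg g' hg' => hST.mono (hlS g hg) (hlT g' hg')⟩⟩
            : Layer ι d) = l.toOp * l'.toOp := by simp [Layer.toOp]
        rw [this, this, this, h3, h4]
        rw [mul_assoc, ← mul_assoc l'.toOp, ← hc.eq]
        simp only [mul_assoc]

lemma CircOp.parallel {S T : Finset ι} {t : ℕ} {E E' : Op ι d} (h : CircOp S t E)
    (h' : CircOp T t E') (hST : Disjoint S T) : CircOp (S ∪ T) t (E * E') := by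
  obtain ⟨c, h1, h2, rfl⟩ := h.exists_length_eq
  obtain ⟨c', h1', h2', rfl⟩ := h'.exists_length_eq
  obtain ⟨e, he, he2, he3⟩ := Circuit.exists_parallel hST c c' (h1.trans h1'.symm) h2 h2'
  exact ⟨e, by omega, he2, he3⟩

lemma Gate.circOp (g : Gate ι d) : CircOp g.support 1 g.toOp := by
  refine ⟨[⟨[g], List.pairwise_singleton _ _⟩], by simp, ?_, by simp [Circuit.toOp, Layer.toOp]⟩
  intro l hl g' hg'
  obtain rfl := List.mem_singleton.1 hl
  obtain rfl := List.mem_singleton.1 hg'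
  exact subset_rfl

/-- Control and target may coincide if `f` is constant, which covers uncontrolled one-qudit gates.
-/
lemma circOp_ctrl {i t : ι} {f : Fin d → Matrix (Fin d) (Fin d) ℂ}
    (hU : ∀ a, f a ∈ Matrix.unitaryGroup (Fin d) ℂ) (hf : i = t → ∀ a b, f a = f b) :
    CircOp {i, t} 1 (blk t fun y => f (y i)) := by
  have hi : i ∈ ({i, t} : Finset ι) := by simp
  have ht : t ∈ ({i, t} : Finset ι) := by simp
  set F : Config ({i, t} : Finset ι) d → Matrix (Fin d) (Fin d) ℂ := fun y => f (y ⟨i, hi⟩)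
  have hF : Indep (⟨t, ht⟩ : ({i, t} : Finset ι)) F := by
    intro y u
    by_cases hit : i = t
    · exact hf hit _ _
    · have : (⟨i, hi⟩ : ({i, t} : Finset ι)) ≠ ⟨t, ht⟩ := fun h => hit (congrArg Subtype.val h)
      simp [F, this]
  let g : Gate ι d := ⟨{i, t}, ⟨i, hi⟩, Finset.card_le_two, blk ⟨t, ht⟩ F,
    blk_mem_unitaryGroup hF fun y => hU _⟩
  have hg : g.toOp = blk t fun y => f (y i) := by
    rw [Gate.toOp_eq_emb]
    exact emb_blk _ _
  rw [← hg]
  exact g.circOp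

end Circ

/-! ### Multiply controlled gates -/

section Ladder
variable {ι : Type} [Fintype ι] [DecidableEq ι] {d : ℕ} [NeZero d]

/-- A unitary moving the level `0` to the level `1` that is a group commutator. -/
lemma exists_commutator_swap (hd : 1 < d) :
    ∃ A ∈ Matrix.unitaryGroup (Fin d) ℂ, ∃ B ∈ Matrix.unitaryGroup (Fin d) ℂ,
      ∀ u, (A * B * Aᴴ * Bᴴ) u 0 = if u = 1 then 1 else 0 := by
  obtain ⟨n, rfl⟩ : ∃ n, d = 2 + n := ⟨d - 2, by omega⟩
  set r : ℂ := ((Real.sqrt 2 / 2 : ℝ) : ℂ)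
  have hr : r * r = 1 / 2 := by
    rw [← Complex.ofReal_mul, div_mul_div_comm, Real.mul_self_sqrt (by norm_num)]
    norm_num
  have hrs : star r = r := Complex.conj_ofReal _
  -- On the first two levels, `A2` is the reflection of the second axis and `B2` a rotation by π/4
  -- in absolute value. Conjugation by `A2` inverts `B2`, so the commutator is `B2⁻²`, a quarter
  -- turn carrying level 0 to level 1.
  let A2 : Matrix (Fin 2) (Fin 2) ℂ := !![1, 0; 0, -1]
  let B2 : Matrix (Fin 2) (Fin 2) ℂ := !![r, r; -r, r]
  have hA2 : A2ᴴ = !![1, 0; 0, -1] := by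
    ext i j; fin_cases i <;> fin_cases j <;> simp [A2]
  have hB2 : B2ᴴ = !![r, -r; r, r] := by
    ext i j; fin_cases i <;> fin_cases j <;> simpa [B2] using hrs
  let e : Fin (2 + n) ≃ Fin 2 ⊕ Fin n := finSumFinEquiv.symm
  let ext : Matrix (Fin 2) (Fin 2) ℂ → Matrix (Fin (2 + n)) (Fin (2 + n)) ℂ :=
    fun M => (Matrix.fromBlocks M 0 0 1).submatrix e e
  have hmul : ∀ M M', ext M * ext M' = ext (M * M') := fun M M' => by
    simp only [ext, Matrix.submatrix_mul_equiv, Matrix.fromBlocks_multiply]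
    simp
  have hct : ∀ M, (ext M)ᴴ = ext Mᴴ := fun M => by
    simp only [ext, Matrix.conjTranspose_submatrix, Matrix.fromBlocks_conjTranspose]
    simp
  have hone : ext 1 = 1 := by
    simp only [ext, Matrix.fromBlocks_one, Matrix.submatrix_one_equiv]
  refine ⟨ext A2, ?_, ext B2, ?_, ?_⟩
  · rw [Matrix.mem_unitaryGroup_iff, Matrix.star_eq_conjTranspose, hct, hmul, ← hone, hA2]
    congr 1
    ext i j; fin_cases i <;> fin_cases j <;> simp [A2]
  · rw [Matrix.mem_unitaryGroup_iff, Matrix.star_eq_conjTranspose, hct, hmul, ← hone, hB2]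
    congr 1
    ext i j; fin_cases i <;> fin_cases j <;> simp [B2, hr] <;> norm_num
  · have hcomm : A2 * B2 * A2ᴴ * B2ᴴ = !![0, -1; 1, 0] := by
      rw [hA2, hB2]
      ext i j; fin_cases i <;> fin_cases j <;>
        simp [A2, B2, Matrix.mul_apply, Fin.sum_univ_two, hr] <;> norm_num
    intro u
    rw [hct, hct, hmul, hmul, hmul, hcomm]
    have h0 : (0 : Fin (2 + n)) = finSumFinEquiv (Sum.inl 0) := by
      ext; simp
    have h1 : (1 : Fin (2 + n)) = finSumFinEquiv (Sum.inl 1) := by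
      refine Fin.ext ?_
      rw [Fin.val_one', Nat.mod_eq_of_lt (by omega), finSumFinEquiv_apply_left, Fin.val_castAdd]
      rfl
    obtain ⟨v, rfl⟩ := (finSumFinEquiv (m := 2) (n := n)).surjective u
    rw [h0, h1]
    simp only [ext, e, Matrix.submatrix_apply, Equiv.symm_apply_apply, EmbeddingLike.apply_eq_iff_eq]
    rcases v with v | v
    · fin_cases v <;> simp
    · simp

/-- `A` and its adjoint are controlled by `g`, `B` and its adjoint by `i`. If at most one control
fires, the factors cancel; if both fire, the commutator remains. Each of the four gates touches two
qudits. -/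
lemma circOp_toffoli {A B : Matrix (Fin d) (Fin d) ℂ} (hA : A ∈ Matrix.unitaryGroup (Fin d) ℂ)
    (hB : B ∈ Matrix.unitaryGroup (Fin d) ℂ) {g i w : ι} (hg : g ≠ w) (hi : i ≠ w) (v a : Fin d) :
    CircOp {g, i, w} 4
      (blk w fun y => if y g = v ∧ y i = a then A * B * Aᴴ * Bᴴ else 1) := by
  have hctrl : ∀ (j : ι) (hj : j ≠ w) (b : Fin d) (M : Matrix (Fin d) (Fin d) ℂ),
      M ∈ Matrix.unitaryGroup (Fin d) ℂ →
      CircOp {j, w} 1 (blk w fun y => if y j = b then M else 1) := by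
    intro j hj b M hM
    refine circOp_ctrl (f := fun x => if x = b then M else 1) (fun x => ?_) fun h => absurd h hj
    split_ifs
    exacts [hM, one_mem _]
  have hind : ∀ (j : ι) (hj : j ≠ w) (b : Fin d) (M : Matrix (Fin d) (Fin d) ℂ),
      Indep w fun y : Config ι d => if y j = b then M else 1 := by
    intro j hj b M y u
    simp [hj]
  have s1 : ({g, w} : Finset ι) ⊆ {g, i, w} := by
    intro x; simp only [Finset.mem_insert, Finset.mem_singleton]; tauto
  have s2 : ({i, w} : Finset ι) ⊆ {g, i, w} := by
    intro x; simp only [Finset.mem_insert, Finset.mem_singleton]; tauto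
  have h := ((((hctrl g hg v A hA).mono s1 le_rfl).mul ((hctrl i hi a B hB).mono s2 le_rfl)).mul
    ((hctrl g hg v _ (Unitary.star_mem hA)).mono s1 le_rfl)).mul
    ((hctrl i hi a _ (Unitary.star_mem hB)).mono s2 le_rfl)
  rw [blk_mul (hind g hg v A), blk_mul, blk_mul] at h
  · convert h using 1
    congr 1
    funext y
    have hAA : A * Aᴴ = 1 := Matrix.mem_unitaryGroup_iff.1 hA
    have hBB : B * Bᴴ = 1 := Matrix.mem_unitaryGroup_iff.1 hB
    simp only [Matrix.star_eq_conjTranspose]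
    by_cases h1 : y g = v <;> by_cases h2 : y i = a <;> simp [h1, h2, hAA, hBB]
  · intro y u
    simp [hg, hi]
  · intro y u
    simp [hg, hi]

lemma blk_mulVec_single (t : ι) (F : Config ι d → Matrix (Fin d) (Fin d) ℂ) (z : Config ι d) :
    blk t F *ᵥ Pi.single z 1 = ∑ u, F z u (z t) • Pi.single (Function.update z t u) (1 : ℂ) := by
  rw [Matrix.mulVec_single_one]
  ext x
  simp only [Matrix.col_apply, Finset.sum_apply, Pi.smul_apply, smul_eq_mul]
  by_cases h : ∀ w, w ≠ t → x w = z w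
  · have hz := eq_update_of_agree fun w hw => (h w hw).symm
    rw [blk_apply_of_agree h, Finset.sum_eq_single (x t)]
    · rw [← hz]; simp
    · intro u _ hu
      rw [Pi.single_eq_of_ne, mul_zero]
      intro h2
      exact hu (by rw [h2]; simp)
    · simp
  · rw [blk_apply_of_not h]
    refine (Finset.sum_eq_zero fun u _ => ?_).symm
    rw [Pi.single_eq_of_ne, mul_zero]
    intro h2
    exact h fun w hw => by rw [h2]; simp [hw]

lemma blk_mulVec_single_of_col {t : ι} {F : Config ι d → Matrix (Fin d) (Fin d) ℂ} {z : Config ι d}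
    {b : Fin d} (h : ∀ u, F z u (z t) = if u = b then 1 else 0) :
    blk t F *ᵥ Pi.single z 1 = Pi.single (Function.update z t b) 1 := by
  rw [blk_mulVec_single, Finset.sum_eq_single b]
  · simp [h]
  · intro u _ hu
    simp [h, hu]
  · simp

variable {κ : Type} [Fintype κ] [DecidableEq κ]

/-- The conjunction of the controls is accumulated in the workspace. The qudit `inr i` is raised
from 0 to 1 if the flag `g` has value `v` and the control `i` is satisfied; it serves as the flag
for the remaining controls and is reset afterwards. Generality in the flag `(g, v)` makes the
induction possible. Each control costs four gates to compute and four to uncompute. -/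
lemma exists_ladder (hd : 1 < d) {U : Matrix (Fin d) (Fin d) ℂ}
    (hU : U ∈ Matrix.unitaryGroup (Fin d) ℂ) (p : Config κ d) (t : κ) (S : Finset (κ ⊕ κ))
    (htS : Sum.inl t ∈ S) (L : List κ) :
    ∀ (g : κ ⊕ κ) (v : Fin d), L.Nodup → t ∉ L → g ≠ Sum.inl t → g ∈ S →
      (∀ i ∈ L, g ≠ Sum.inl i ∧ g ≠ Sum.inr i) → (∀ i ∈ L, Sum.inl i ∈ S ∧ Sum.inr i ∈ S) →
      ∃ E : Op (κ ⊕ κ) d, CircOp S (8 * L.length + 1) E ∧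
        ∀ z : Config (κ ⊕ κ) d, (∀ i ∈ L, z (Sum.inr i) = 0) →
          E *ᵥ Pi.single z 1 = blk (Sum.inl t) (fun y =>
            if y g = v ∧ ∀ i ∈ L, y (Sum.inl i) = p i then U else 1) *ᵥ Pi.single z 1 := by
  obtain ⟨A, hA, B, hB, hAB⟩ := exists_commutator_swap hd
  have h10 : (1 : Fin d) ≠ 0 := by
    intro h
    have := congrArg Fin.val h
    rw [Fin.val_one', Fin.val_zero, Nat.mod_eq_of_lt hd] at this
    exact one_ne_zero this
  induction L with
  | nil =>
    intro g v _ _ hgt hgS _ _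
    refine ⟨_, (circOp_ctrl (i := g) (t := Sum.inl t) (f := fun x => if x = v then U else 1)
      (fun x => ?_) fun h => absurd h hgt).mono ?_ (by simp), fun z _ => by simp⟩
    · split_ifs
      exacts [hU, one_mem _]
    · intro x hx
      rcases Finset.mem_insert.1 hx with rfl | hx
      · exact hgS
      · exact Finset.mem_singleton.1 hx ▸ htS
  | cons i L ih =>
    intro g v hnd htL hgt hgS hg hLS
    have hiL : i ∉ L := (List.nodup_cons.1 hnd).1
    have hti : t ≠ i := fun h => htL (by simp [h])
    obtain ⟨E, hE, hEz⟩ := ih (Sum.inr i) 1 (List.nodup_cons.1 hnd).2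
      (fun h => htL (by simp [h])) (by simp) (hLS i (by simp)).2
      (fun j hj => ⟨by simp, fun h => hiL (by rw [Sum.inr.inj h]; exact hj)⟩)
      (fun j hj => hLS j (by simp [hj]))
    have hgi := hg i (by simp)
    set T : Op (κ ⊕ κ) d := blk (Sum.inr i) fun y =>
      if y g = v ∧ y (Sum.inl i) = p i then A * B * Aᴴ * Bᴴ else 1 with hT
    have hTc : CircOp S 4 T := by
      refine (circOp_toffoli hA hB (i := Sum.inl i) hgi.2 (by simp) v (p i)).mono ?_ le_rfl
      intro x hx
      simp only [Finset.mem_insert, Finset.mem_singleton] at hx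
      rcases hx with rfl | rfl | rfl
      exacts [hgS, (hLS i (by simp)).1, (hLS i (by simp)).2]
    have hTT : Tᴴ * T = 1 := Matrix.mem_unitaryGroup_iff'.1 hTc.mem_unitaryGroup
    have hTz : ∀ z : Config (κ ⊕ κ) d, z (Sum.inr i) = 0 → T *ᵥ Pi.single z 1 =
        Pi.single (Function.update z (Sum.inr i)
          (if z g = v ∧ z (Sum.inl i) = p i then 1 else 0)) 1 := by
      intro z hz
      apply blk_mulVec_single_of_col
      intro u
      rw [hz]
      by_cases hc : z g = v ∧ z (Sum.inl i) = p i
      · simp only [if_pos hc, hAB]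
      · simp only [if_neg hc, Matrix.one_apply]
    refine ⟨Tᴴ * E * T, ((hTc.conjTranspose.mul hE).mul hTc).mono subset_rfl
      (by simp only [List.length_cons]; omega), ?_⟩
    intro z hz
    have hzi := hz i (by simp)
    rw [← Matrix.mulVec_mulVec, hTz z hzi, ← Matrix.mulVec_mulVec]
    set f : Fin d := if z g = v ∧ z (Sum.inl i) = p i then 1 else 0 with hf
    rw [hEz, blk_mulVec_single, blk_mulVec_single, Matrix.mulVec_sum]
    · refine Finset.sum_congr rfl fun u _ => ?_
      have hne : (Sum.inl t : κ ⊕ κ) ≠ Sum.inr i := by simp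
      rw [Matrix.mulVec_smul, Function.update_comm hne.symm]
      -- The target is neither flag nor control of `T`, so for each new value `u` of the target the
      -- workspace qudit holds exactly what `T` would have written, and `Tᴴ` erases it.
      have h2 : T *ᵥ Pi.single (Function.update z (Sum.inl t) u) 1 =
          Pi.single (Function.update (Function.update z (Sum.inl t) u) (Sum.inr i) f) 1 := by
        rw [hTz _ (by simp [hzi])]
        have : (Sum.inl i : κ ⊕ κ) ≠ Sum.inl t := fun h => hti (Sum.inl.inj h).symm
        simp [hgt, this, hf]
      rw [← h2, Matrix.mulVec_mulVec, hTT, Matrix.one_mulVec]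
      congr 2
      · have hfc : f = 1 ↔ z g = v ∧ z (Sum.inl i) = p i := by
          rw [hf]; split_ifs with h <;> simp [h, h10.symm]
        have hiff : (Function.update z (Sum.inr i) f (Sum.inr i) = 1 ∧
            ∀ j ∈ L, Function.update z (Sum.inr i) f (Sum.inl j) = p j) ↔
            (z g = v ∧ ∀ j ∈ i :: L, z (Sum.inl j) = p j) := by
          simp [hfc, and_assoc]
        simp only [hiff]
        rw [Function.update_of_ne hne]
    · intro j hj
      have : j ≠ i := fun h => hiL (h ▸ hj)
      simp [this, hz j (by simp [hj])]

end Ladder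

/-! ### Circuits with a clean workspace -/

section Reach
variable {κ : Type} [Fintype κ] [DecidableEq κ] {d : ℕ} [NeZero d]

/-- The isometry adding a workspace in the state `|0…0⟩`. -/
def clean (κ : Type) [Fintype κ] [DecidableEq κ] (d : ℕ) [NeZero d] :
    Matrix (Config (κ ⊕ κ) d) (Config κ d) ℂ :=
  Matrix.of fun z x => if z = Sum.elim x (fun _ => 0) then 1 else 0

lemma clean_mulVec_single (x : Config κ d) :
    clean κ d *ᵥ Pi.single x 1 = Pi.single (Sum.elim x fun _ => 0) 1 := by
  rw [Matrix.mulVec_single_one]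
  ext z
  simp [clean, Pi.single_apply]

lemma sumElim_zero_injective :
    Function.Injective fun x : Config κ d => (Sum.elim x (fun _ => 0) : Config (κ ⊕ κ) d) := by
  intro x y h
  funext w
  simpa using congrFun h (Sum.inl w)

lemma clean_conjTranspose_mul : (clean κ d)ᴴ * clean κ d = 1 := by
  ext x y
  have : ∀ z, (clean κ d)ᴴ x z * clean κ d z y =
      if z = Sum.elim x (fun _ => 0) then (if x = y then 1 else 0) else 0 := by
    intro z
    simp only [clean, Matrix.conjTranspose_apply, Matrix.of_apply]
    by_cases h : z = Sum.elim x (fun _ => 0)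
    · have h2 : (z = Sum.elim y fun _ => 0) ↔ x = y := by
        rw [h]; exact sumElim_zero_injective.eq_iff
      rw [if_pos h, if_pos h]
      simp [h2]
    · simp [h]
  rw [Matrix.mul_apply, Finset.sum_congr rfl fun z _ => this z, Matrix.one_apply]
  simp

lemma mul_clean_apply (M : Matrix (Config (κ ⊕ κ) d) (Config (κ ⊕ κ) d) ℂ) (z : Config (κ ⊕ κ) d) (y : Config κ d) :
    (M * clean κ d) z y = M z (Sum.elim y fun _ => 0) := by
  simp [Matrix.mul_apply, clean]

lemma clean_mul_apply (E : Matrix (Config κ d) (Config κ d) ℂ) (x a y : Config κ d) :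
    (clean κ d * E) (Sum.elim x a) y = if a = (fun _ => 0) then E x y else 0 := by
  rw [Matrix.mul_apply]
  by_cases h : a = fun _ => 0
  · subst h
    rw [if_pos rfl, Finset.sum_eq_single x]
    · simp [clean]
    · intro x' _ hx'
      have : (Sum.elim x (fun _ => 0) : Config (κ ⊕ κ) d) ≠ Sum.elim x' (fun _ => 0) :=
        fun h => hx' (sumElim_zero_injective h).symm
      simp [clean, this]
    · simp
  · rw [if_neg h]
    refine Finset.sum_eq_zero fun x' _ => ?_
    have : (Sum.elim x a : Config (κ ⊕ κ) d) ≠ Sum.elim x' (fun _ => 0) := by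
      intro h2
      apply h
      funext w
      simpa using congrFun h2 (Sum.inr w)
    simp [clean, this]

/-- The qudits in `S` together with their workspace. -/
def dbl (S : Finset κ) : Finset (κ ⊕ κ) := S.disjSum S

lemma dbl_mono {S S' : Finset κ} (h : S ⊆ S') : dbl S ⊆ dbl S' := Finset.disjSum_mono h h

lemma dbl_disjoint {S S' : Finset κ} (h : Disjoint S S') : Disjoint (dbl S) (dbl S') := by
  rw [Finset.disjoint_left] at h ⊢
  intro x hx hx'
  rcases x with x | x
  · exact h (Finset.inl_mem_disjSum.1 hx) (Finset.inl_mem_disjSum.1 hx')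
  · exact h (Finset.inr_mem_disjSum.1 hx) (Finset.inr_mem_disjSum.1 hx')

lemma dbl_union (S S' : Finset κ) : dbl (S ∪ S') = dbl S ∪ dbl S' := by
  ext x
  rcases x with x | x <;> simp [dbl]

/-- A circuit of depth at most `t` inside of `S` and its workspace acts as `E` as long as the
workspace is clean, and leaves it clean. -/
def Reach (S : Finset κ) (t : ℕ) (E : Matrix (Config κ d) (Config κ d) ℂ) : Prop :=
  ∃ M : Matrix (Config (κ ⊕ κ) d) (Config (κ ⊕ κ) d) ℂ, CircOp (dbl S) t M ∧ M * clean κ d = clean κ d * E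

lemma Reach.mono {S S' : Finset κ} {t t' : ℕ} {E : Matrix (Config κ d) (Config κ d) ℂ} (h : Reach S t E) (hS : S ⊆ S')
    (ht : t ≤ t') : Reach S' t' E := by
  obtain ⟨M, h1, h2⟩ := h
  exact ⟨M, h1.mono (dbl_mono hS) ht, h2⟩

lemma reach_one (S : Finset κ) : Reach S 0 (1 : Matrix (Config κ d) (Config κ d) ℂ) := ⟨1, circOp_one _, by simp⟩

lemma Reach.mul {S : Finset κ} {t t' : ℕ} {E E' : Matrix (Config κ d) (Config κ d) ℂ} (h : Reach S t E)
    (h' : Reach S t' E') : Reach S (t + t') (E * E') := by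
  obtain ⟨M, h1, h2⟩ := h
  obtain ⟨M', h1', h2'⟩ := h'
  refine ⟨M * M', h1.mul h1', ?_⟩
  rw [Matrix.mul_assoc, h2', ← Matrix.mul_assoc, h2, Matrix.mul_assoc]

lemma Reach.parallel {S S' : Finset κ} {t : ℕ} {E E' : Matrix (Config κ d) (Config κ d) ℂ} (h : Reach S t E)
    (h' : Reach S' t E') (hS : Disjoint S S') : Reach (S ∪ S') t (E * E') := by
  obtain ⟨M, h1, h2⟩ := h
  obtain ⟨M', h1', h2'⟩ := h'
  refine ⟨M * M', dbl_union S S' ▸ h1.parallel h1' (dbl_disjoint hS), ?_⟩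
  rw [Matrix.mul_assoc, h2', ← Matrix.mul_assoc, h2, Matrix.mul_assoc]

/-- Unitarity of `E` is inherited from the circuit because `clean` is an isometry. It is what allows
the intertwining relation to be inverted for the adjoint circuit. -/
lemma Reach.mem_unitaryGroup {S : Finset κ} {t : ℕ} {E : Matrix (Config κ d) (Config κ d) ℂ} (h : Reach S t E) :
    E ∈ Matrix.unitaryGroup (Config κ d) ℂ := by
  obtain ⟨M, h1, h2⟩ := h
  rw [Matrix.mem_unitaryGroup_iff', Matrix.star_eq_conjTranspose]
  have hM : Mᴴ * M = 1 := Matrix.mem_unitaryGroup_iff'.1 h1.mem_unitaryGroup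
  calc Eᴴ * E = Eᴴ * ((clean κ d)ᴴ * clean κ d) * E := by rw [clean_conjTranspose_mul, Matrix.mul_one]
    _ = (clean κ d * E)ᴴ * (clean κ d * E) := by
        rw [Matrix.conjTranspose_mul]; simp only [Matrix.mul_assoc]
    _ = (clean κ d)ᴴ * (Mᴴ * M) * clean κ d := by
        rw [← h2, Matrix.conjTranspose_mul]; simp only [Matrix.mul_assoc]
    _ = 1 := by rw [hM, Matrix.mul_one, clean_conjTranspose_mul]

lemma Reach.conjTranspose {S : Finset κ} {t : ℕ} {E : Matrix (Config κ d) (Config κ d) ℂ} (h : Reach S t E) :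
    Reach S t Eᴴ := by
  have hE : E * Eᴴ = 1 := Matrix.mem_unitaryGroup_iff.1 h.mem_unitaryGroup
  obtain ⟨M, h1, h2⟩ := h
  have hM : Mᴴ * M = 1 := Matrix.mem_unitaryGroup_iff'.1 h1.mem_unitaryGroup
  refine ⟨Mᴴ, h1.conjTranspose, ?_⟩
  calc Mᴴ * clean κ d = Mᴴ * (clean κ d * E) * Eᴴ := by
        rw [Matrix.mul_assoc, Matrix.mul_assoc, hE, Matrix.mul_one]
    _ = Mᴴ * M * clean κ d * Eᴴ := by rw [← h2]; simp only [Matrix.mul_assoc]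
    _ = clean κ d * Eᴴ := by rw [hM, Matrix.one_mul]

lemma Reach.loc {S : Finset κ} {t : ℕ} {E : Matrix (Config κ d) (Config κ d) ℂ} (h : Reach S t E) : Loc S E := by
  obtain ⟨M, h1, h2⟩ := h
  intro x y hxy
  have h3 := congrFun (congrFun h2 (Sum.elim x fun _ => 0)) y
  rw [mul_clean_apply, clean_mul_apply, if_pos rfl] at h3
  rw [← h3]
  apply h1.loc
  intro h4
  refine hxy fun w hw => ?_
  simpa using h4 (Sum.inl w) fun h5 => hw (Finset.inl_mem_disjSum.1 h5)

lemma mul_clean_eq_of_forall {M : Matrix (Config (κ ⊕ κ) d) (Config (κ ⊕ κ) d) ℂ} {E : Matrix (Config κ d) (Config κ d) ℂ}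
    (h : ∀ y, M *ᵥ Pi.single (Sum.elim y fun _ => 0) 1 = clean κ d *ᵥ (E *ᵥ Pi.single y 1)) :
    M * clean κ d = clean κ d * E := by
  ext z y
  have := congrFun (h y) z
  rwa [Matrix.mulVec_mulVec, ← clean_mulVec_single, Matrix.mulVec_mulVec, Matrix.mulVec_single_one,
    Matrix.mulVec_single_one] at this

lemma blk_inl_clean (t : κ) (F : Config (κ ⊕ κ) d → Matrix (Fin d) (Fin d) ℂ) (y : Config κ d) :
    blk (Sum.inl t) F *ᵥ Pi.single (Sum.elim y fun _ => 0) 1 =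
      clean κ d *ᵥ (blk t (fun x => F (Sum.elim x fun _ => 0)) *ᵥ Pi.single y 1) := by
  rw [blk_mulVec_single, blk_mulVec_single, Matrix.mulVec_sum]
  refine Finset.sum_congr rfl fun u _ => ?_
  rw [Matrix.mulVec_smul, clean_mulVec_single, Sum.elim_inl]
  congr 2
  exact Sum.update_elim_inl

lemma reach_gate {S : Finset κ} {t : κ} (htS : t ∈ S) {U : Matrix (Fin d) (Fin d) ℂ}
    (hU : U ∈ Matrix.unitaryGroup (Fin d) ℂ) : Reach S 1 (blk t fun _ => U) := by
  refine ⟨blk (Sum.inl t) fun _ => U, ?_, mul_clean_eq_of_forall fun y => blk_inl_clean _ _ _⟩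
  refine (circOp_ctrl (i := Sum.inl t) (t := Sum.inl t) (f := fun _ => U) (fun _ => hU)
    fun _ _ _ => rfl).mono ?_ le_rfl
  simpa [dbl] using htS

/-- A one-qudit unitary controlled by the qudits in `L` being in the state `p`. -/
lemma reach_ctrl (hd : 1 < d) {U : Matrix (Fin d) (Fin d) ℂ}
    (hU : U ∈ Matrix.unitaryGroup (Fin d) ℂ) (p : Config κ d) {t : κ} {S L : Finset κ}
    (htS : t ∈ S) (hLS : L ⊆ S) (htL : t ∉ L) :
    Reach S (8 * L.card + 1) (blk t fun y => if ∀ i ∈ L, y i = p i then U else 1) := by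
  rcases L.eq_empty_or_nonempty with rfl | ⟨i, hi⟩
  · simpa using reach_gate htS hU
  obtain ⟨M, hM, hMz⟩ := exists_ladder hd hU p t (dbl S) (by simpa [dbl] using htS)
    (L.erase i).toList (Sum.inl i) (p i) (Finset.nodup_toList _) (by simp [htL])
    (fun h => htL (Sum.inl.inj h ▸ hi)) (by simpa [dbl] using hLS hi)
    (fun j hj => by simp at hj ⊢; exact fun h => hj.1 h.symm)
    (fun j hj => by
      have : j ∈ L := by simp at hj; exact hj.2
      simpa [dbl] using hLS this)
  refine ⟨M, hM.mono subset_rfl ?_, mul_clean_eq_of_forall fun y => ?_⟩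
  · rw [Finset.length_toList, Finset.card_erase_of_mem hi]; omega
  · rw [hMz _ (by simp), blk_inl_clean]
    congr 3
    funext x
    have : (x i = p i ∧ ∀ j ∈ (L.erase i).toList, x j = p j) ↔ ∀ j ∈ L, x j = p j := by
      simp only [Finset.mem_toList, Finset.mem_erase]
      constructor
      · rintro ⟨h1, h2⟩ j hj
        by_cases hji : j = i
        · rw [hji, h1]
        · exact h2 j ⟨hji, hj⟩
      · exact fun h => ⟨h i hi, fun j hj => h j hj.2⟩
    simp only [Sum.elim_inl, this]

/-- A one-qudit unitary depending on the other qudits of `S`. -/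
lemma reach_blk (hd : 1 < d) {S : Finset κ} {t : κ} (htS : t ∈ S)
    {F : Config κ d → Matrix (Fin d) (Fin d) ℂ} (hU : ∀ y, F y ∈ Matrix.unitaryGroup (Fin d) ℂ)
    (hF : ∀ x y, (∀ w ∈ S, w ≠ t → x w = y w) → F x = F y) :
    Reach S (d ^ S.card * (8 * S.card + 1)) (blk t F) := by
  set S' := S.erase t with hS'
  have hS'S : S' ⊆ S := Finset.erase_subset _ _
  have htS' : t ∉ S' := Finset.notMem_erase _ _
  -- The dependence on the other qudits is resolved pattern by pattern: each value `q` of the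
  -- controls contributes one multiply controlled gate, and at most one of these gates acts
  -- nontrivially on a given configuration.
  have key : ∀ Q : Finset (Config S' d), Reach S (Q.card * (8 * S.card + 1))
      (blk t fun y => if (fun w : S' => y w) ∈ Q then F y else 1) := by
    intro Q
    induction Q using Finset.induction_on with
    | empty => simpa [blk_one] using reach_one S
    | insert q Q hq ih =>
      have h1 : Reach S (8 * S.card + 1) (blk t fun y =>
          if ∀ i ∈ S', y i = glue S' q 0 i then F (glue S' q 0) else 1) :=
        (reach_ctrl hd (hU _) _ htS hS'S htS').mono subset_rfl
          (by have := Finset.card_le_card hS'S; omega)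
      have h2 := h1.mul ih
      rw [blk_mul] at h2
      · rw [Finset.card_insert_of_notMem hq]
        convert h2 using 1
        · ring
        congr 1
        funext y
        have hiff : (∀ i ∈ S', y i = glue S' q 0 i) ↔ (fun w : S' => y w) = q := by
          constructor
          · intro h
            funext w
            rw [h w w.2, glue_mem]
          · rintro rfl i hi
            simp [glue, hi]
        by_cases hy : (fun w : S' => y w) = q
        · have hyQ : (fun w : S' => y w) ∉ Q := hy ▸ hq
          rw [if_pos (hiff.2 hy), if_neg hyQ, if_pos (by simp [hy]), mul_one]
          refine hF _ _ fun w hw hwt => hiff.2 hy w (Finset.mem_erase.2 ⟨hwt, hw⟩)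
        · rw [if_neg (fun h => hy (hiff.1 h)), one_mul]
          simp [hy]
      · intro y u
        have : (∀ i ∈ S', Function.update y t u i = glue S' q 0 i) ↔
            ∀ i ∈ S', y i = glue S' q 0 i := by
          refine forall₂_congr fun i hi => ?_
          have : i ≠ t := fun h => htS' (h ▸ hi)
          simp [this]
        simp only [this]
  have h := key Finset.univ
  simp only [Finset.mem_univ, if_true] at h
  refine h.mono subset_rfl (Nat.mul_le_mul_right _ ?_)
  rw [Finset.card_univ, Fintype.card_fun, Fintype.card_fin, Fintype.card_coe]
  exact Nat.pow_le_pow_right (by omega) (Finset.card_le_card hS'S)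

/-- The depth bound for the synthesis of an arbitrary unitary on `ℓ` qudits. -/
def synthDepth (d ℓ : ℕ) : ℕ := d ^ ℓ * (2 * ℓ + 1) * (d ^ ℓ * (8 * ℓ + 1))

/-- Every unitary on the qudits in `S` is implemented by a circuit. -/
theorem reach_emb (hd : 1 < d) {S : Finset κ} (hS : S.Nonempty) {M : Op S d}
    (hM : M ∈ Matrix.unitaryGroup (Config S d) ℂ) : Reach S (synthDepth d S.card) (emb S M) := by
  have : Nonempty S := hS.to_subtype
  obtain ⟨l, h1, h2, rfl⟩ := isBlkProd_of_mem_unitaryGroup hM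
  rw [Fintype.card_coe] at h1
  have key : ∀ l : List (Op S d), (∀ E ∈ l, IsBlk E) →
      Reach S (l.length * (d ^ S.card * (8 * S.card + 1))) (emb S l.prod) := by
    intro l
    induction l with
    | nil => intro _; simpa [emb_one] using reach_one S
    | cons E l ih =>
      intro h
      obtain ⟨t, F, hF, hFU, rfl⟩ := h E (by simp)
      rw [List.prod_cons, emb_mul, emb_blk, List.length_cons]
      refine ((reach_blk hd t.2 (fun y => hFU _) ?_).mul
        (ih fun E' hE' => h E' (by simp [hE']))).mono subset_rfl (le_of_eq (by ring))
      intro x y hxy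
      refine (hF.eq_of_agree fun w hw => (hxy w w.2 fun h => hw (Subtype.ext h)).symm)
  exact (key l h2).mono subset_rfl (Nat.mul_le_mul_right _ h1)

/-- The reflection `1 - 2 Π`, with `Π` the projection onto the qudits in `L` being `0`. -/
lemma reach_reflection (hd : 1 < d) {t : κ} {S L : Finset κ} (htS : t ∈ S) (hLS : L ⊆ S)
    (htL : t ∉ L) :
    Reach S (8 * L.card + 1) (1 - 2 * Matrix.diagonal fun x : Config κ d =>
      if ∀ i ∈ L, x i = 0 then (1 : ℂ) else 0) := by
  have hU : (-1 : Matrix (Fin d) (Fin d) ℂ) ∈ Matrix.unitaryGroup (Fin d) ℂ := by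
    rw [Matrix.mem_unitaryGroup_iff]; simp
  -- The scalar -1 on any qudit `t` outside `L`, controlled by `L` being 0, is a sign that depends
  -- on `L` alone.
  convert reach_ctrl hd hU 0 htS hLS htL using 1
  ext x y
  by_cases h : ∀ w, w ≠ t → x w = y w
  · rw [blk_apply_of_agree h]
    have hxy : x = y ↔ x t = y t := by
      refine ⟨fun h2 => h2 ▸ rfl, fun h2 => ?_⟩
      funext w
      by_cases hw : w = t
      · rw [hw, h2]
      · exact h w hw
    have hL : (∀ i ∈ L, x i = 0) ↔ (∀ i ∈ L, y i = 0) :=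
      forall₂_congr fun i hi => by rw [h i fun h2 => htL (h2 ▸ hi)]
    by_cases h0 : ∀ i ∈ L, y i = 0
    · by_cases hx : x t = y t
      · have := hxy.2 hx
        subst this
        rw [Matrix.sub_apply, ← Matrix.diagonal_ofNat', Matrix.diagonal_mul_diagonal]
        simp only [Pi.zero_apply]
        rw [if_pos h0]
        simp
        rw [if_pos h0]
        norm_num
      · have hne : x ≠ y := fun h2 => hx (hxy.1 h2)
        rw [Matrix.sub_apply, ← Matrix.diagonal_ofNat', Matrix.diagonal_mul_diagonal]
        simp only [Pi.zero_apply]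
        rw [if_pos h0]
        simp [hne, hx]
    · have hx0 := fun h2 => h0 (hL.1 h2)
      rw [Matrix.sub_apply, ← Matrix.diagonal_ofNat', Matrix.diagonal_mul_diagonal]
      simp only [Pi.zero_apply]
      rw [if_neg h0]
      by_cases hx : x = y
      · have hx0 := h0
        subst hx; simp [hx0]
      · have : x t ≠ y t := fun h2 => hx (hxy.2 h2)
        simp [hx, this]
  · have hne : x ≠ y := fun h2 => h (by simp [h2])
    rw [blk_apply_of_not h, Matrix.sub_apply, ← Matrix.diagonal_ofNat',
      Matrix.diagonal_mul_diagonal]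
    simp [hne]

lemma reach_neg_one {t : κ} {S : Finset κ} (htS : t ∈ S) : Reach S 1 (-1 : Matrix (Config κ d) (Config κ d) ℂ) := by
  have hU : (-1 : Matrix (Fin d) (Fin d) ℂ) ∈ Matrix.unitaryGroup (Fin d) ℂ := by
    rw [Matrix.mem_unitaryGroup_iff]; simp
  convert reach_gate htS hU using 1
  rw [← blk_one t]
  ext x y
  by_cases h : ∀ w, w ≠ t → x w = y w
  · rw [Matrix.neg_apply, blk_apply_of_agree h, blk_apply_of_agree h, Matrix.neg_apply]
  · rw [Matrix.neg_apply, blk_apply_of_not h, blk_apply_of_not h, neg_zero]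

end Reach

/-! ### Amplitude amplification -/

section Amplification
variable {n : Type} [Fintype n] [DecidableEq n]

/-- One round of amplitude amplification. -/
def ampRound (V P0 P1 : Matrix n n ℂ) : Matrix n n ℂ := V * (1 - 2 * P0) * Vᴴ * (2 * P1 - 1)

/-- The successful part `P1 V P0` and the failing part `V P0 - P1 V P0` span a space invariant under
a round, on which the round acts as a rotation by 2θ. This uses that `P0 Vᴴ P1 V P0` is a multiple
of `P0`, that is, equal success probability for all inputs. The coefficients are characterized after
multiplication by sin θ and cos θ, so that these may vanish. -/
lemma ampRound_pow_mul {V P0 P1 : Matrix n n ℂ} (hV : V ∈ Matrix.unitaryGroup n ℂ)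
    (h0 : P0 * P0 = P0) (h1 : P1 * P1 = P1) {θ : ℝ}
    (hα : P0 * Vᴴ * P1 * V * P0 = ((Real.sin θ ^ 2 : ℝ) : ℂ) • P0) (t : ℕ) :
    ∃ a b : ℝ, a * Real.sin θ = Real.sin ((2 * t + 1) * θ) ∧
      b * Real.cos θ = Real.cos ((2 * t + 1) * θ) ∧
      ampRound V P0 P1 ^ t * (V * P0) =
        (a : ℂ) • (P1 * V * P0) + (b : ℂ) • (V * P0 - P1 * V * P0) := by
  have hVV : Vᴴ * V = 1 := Matrix.mem_unitaryGroup_iff'.1 hV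
  have hVV' : V * Vᴴ = 1 := Matrix.mem_unitaryGroup_iff.1 hV
  set G := P1 * V * P0 with hG
  set H := V * P0 - G with hH
  have eG : ampRound V P0 P1 * G = G - (2 * (Real.sin θ ^ 2 : ℝ) : ℂ) • (G + H) := by
    have e1 : (2 * P1 - 1) * G = G := by
      rw [hG, sub_mul, one_mul, mul_assoc 2, ← mul_assoc P1, ← mul_assoc P1, h1, two_mul,
        add_sub_cancel_right]
    have e2 : V * P0 * Vᴴ * G = ((Real.sin θ ^ 2 : ℝ) : ℂ) • (V * P0) := by
      rw [← Matrix.mul_smul, ← hα, hG]; simp only [mul_assoc]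
    rw [ampRound, mul_assoc, e1]
    have : V * (1 - 2 * P0) * Vᴴ = 1 - 2 * (V * P0 * Vᴴ) := by
      rw [mul_sub, mul_one, sub_mul, hVV']; noncomm_ring
    rw [this, sub_mul, one_mul, mul_assoc 2, e2, hH, add_sub_cancel, two_mul, ← add_smul, two_mul]
  have eH : ampRound V P0 P1 * H = -H + (2 * (Real.cos θ ^ 2 : ℝ) : ℂ) • (G + H) := by
    have e1 : (2 * P1 - 1) * H = -H := by
      have : P1 * H = 0 := by
        rw [hH, hG, mul_sub, ← mul_assoc, ← mul_assoc, ← mul_assoc, h1, sub_self]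
      rw [sub_mul, mul_assoc, this, one_mul, mul_zero, zero_sub]
    have e2 : V * P0 * Vᴴ * H = ((Real.cos θ ^ 2 : ℝ) : ℂ) • (V * P0) := by
      have e3 : V * P0 * Vᴴ * G = ((Real.sin θ ^ 2 : ℝ) : ℂ) • (V * P0) := by
        rw [← Matrix.mul_smul, ← hα, hG]; simp only [mul_assoc]
      rw [hH, mul_sub, e3]
      have e4 : V * P0 * Vᴴ * (V * P0) = V * P0 := by
        calc V * P0 * Vᴴ * (V * P0) = V * P0 * (Vᴴ * V) * P0 := by simp only [mul_assoc]
          _ = V * P0 := by rw [hVV, mul_one, mul_assoc, h0]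
      rw [e4, Real.cos_sq']
      push_cast
      rw [sub_smul, one_smul]
    rw [ampRound, mul_assoc, e1]
    have : V * (1 - 2 * P0) * Vᴴ = 1 - 2 * (V * P0 * Vᴴ) := by
      rw [mul_sub, mul_one, sub_mul, hVV']; noncomm_ring
    rw [this, sub_mul, one_mul, mul_assoc 2, mul_neg, e2, hH, add_sub_cancel, mul_neg, sub_neg_eq_add,
      two_mul, ← add_smul, two_mul]
  induction t with
  | zero =>
    refine ⟨1, 1, by simp, by simp, ?_⟩
    rw [pow_zero, one_mul, hH]
    simp
  | succ t ih =>
    obtain ⟨a, b, ha, hb, hab⟩ := ih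
    have harg : (2 * ((t + 1 : ℕ) : ℝ) + 1) * θ = (2 * t + 1) * θ + 2 * θ := by push_cast; ring
    refine ⟨a - 2 * a * Real.sin θ ^ 2 + 2 * b * Real.cos θ ^ 2,
      -b - 2 * a * Real.sin θ ^ 2 + 2 * b * Real.cos θ ^ 2, ?_, ?_, ?_⟩
    · rw [harg, Real.sin_add, ← ha, ← hb, Real.sin_two_mul, Real.cos_two_mul]
      linear_combination (-2 * a * Real.sin θ) * Real.sin_sq_add_cos_sq θ
    · rw [harg, Real.cos_add, ← ha, ← hb, Real.sin_two_mul, Real.cos_two_mul]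
      ring
    · rw [pow_succ', mul_assoc, hab, mul_add, Matrix.mul_smul, Matrix.mul_smul, eG, eH]
      push_cast
      module

/-- Amplitude amplification: if the component of `V` in the range of `P1` is `sin θ` times an
isometry on the range of `P0`, then `t` rounds turn the amplitude into `sin ((2 t + 1) θ)`. -/
theorem amplification {V P0 P1 W : Matrix n n ℂ} (hV : V ∈ Matrix.unitaryGroup n ℂ)
    (h0 : P0 * P0 = P0) (h0' : P0ᴴ = P0) (h1 : P1 * P1 = P1) (h1' : P1ᴴ = P1) {θ : ℝ}
    (hW : P0 * Wᴴ * W * P0 = P0)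
    (hVW : P1 * V * P0 = (Real.sin θ : ℂ) • (W * P0)) (t : ℕ) :
    P1 * (ampRound V P0 P1 ^ t * V) * P0 = (Real.sin ((2 * t + 1) * θ) : ℂ) • (W * P0) := by
  -- `W` is isometric on the range of `P0`, hence the success probability there is the constant sin²
  -- θ.
  have hα : P0 * Vᴴ * P1 * V * P0 = ((Real.sin θ ^ 2 : ℝ) : ℂ) • P0 := by
    calc P0 * Vᴴ * P1 * V * P0 = (P1 * V * P0)ᴴ * (P1 * V * P0) := by
          rw [Matrix.conjTranspose_mul, Matrix.conjTranspose_mul, h0', h1']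
          calc P0 * Vᴴ * P1 * V * P0 = P0 * Vᴴ * (P1 * P1) * V * P0 := by rw [h1]
            _ = _ := by simp only [mul_assoc]
      _ = _ := by
          rw [hVW, Matrix.conjTranspose_smul, Matrix.conjTranspose_mul, h0', Matrix.smul_mul,
            Matrix.mul_smul, smul_smul, ← mul_assoc, hW]
          congr 1
          rw [Complex.ofReal_pow, sq]
          congr 1
          exact Complex.conj_ofReal _
  obtain ⟨a, b, ha, -, hab⟩ := ampRound_pow_mul hV h0 h1 hα t
  rw [mul_assoc, mul_assoc, hab, mul_add, Matrix.mul_smul, Matrix.mul_smul, mul_sub, ← mul_assoc,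
    ← mul_assoc, ← mul_assoc, h1, sub_self, smul_zero, add_zero, hVW, smul_smul, ← ha]
  push_cast
  rfl

/-- Reaching amplitude exactly 1 with an odd number `n` of uses calls for the angle π/(2n), whose
sine must not exceed 1/q. An odd `n ≤ 2q` of this kind need not exist, so two levels are balanced
against each other. If `⌊2q⌋ = n` is odd, both levels use `n`. If it is even, they use `n - 1` and
`n + 1`, with product `n² - 1`: the first level may stop at an amplitude `s < 1`, and the second is
tuned by `ν = sin θ2 / s²`, which is admissible because `s² ≥ π/4`. -/
lemma exists_rounds {q : ℝ} (hq : 2 ≤ q) :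
    ∃ (t1 t2 : ℕ) (θ1 θ2 ν : ℝ), 0 ≤ Real.sin θ1 ∧ Real.sin θ1 ≤ 1 / q ∧ 0 ≤ ν ∧ ν ≤ 1 / q ∧
      Real.sin ((2 * t1 + 1) * θ1) ^ 2 * ν = Real.sin θ2 ∧ Real.sin ((2 * t2 + 1) * θ2) = 1 ∧
      8 ≤ (2 * t1 + 1) * (2 * t2 + 1) ∧
      (((2 * t1 + 1) * (2 * t2 + 1) : ℕ) : ℝ) ≤ 4 * q ^ 2 := by
  have hq0 : 0 < q := by linarith
  set n := ⌊2 * q⌋₊ with hn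
  have hn1 : (n : ℝ) ≤ 2 * q := Nat.floor_le (by linarith)
  have hn2 : 2 * q < n + 1 := Nat.lt_floor_add_one _
  have hn4 : 4 ≤ n := Nat.le_floor (by push_cast; linarith)
  have hn4' : (4 : ℝ) ≤ n := by exact_mod_cast hn4
  have hqn : 2 / ((n : ℝ) + 1) ≤ 1 / q := by
    rw [div_le_div_iff₀ (by linarith) hq0]; linarith
  have hπ := Real.pi_lt_d2
  have hπ3 := Real.pi_gt_three
  have hsq : (n : ℝ) ^ 2 ≤ 4 * q ^ 2 := by nlinarith
  rcases Nat.even_or_odd' n with ⟨u, hu | hu⟩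
  · obtain ⟨v, rfl⟩ : ∃ v, u = v + 1 := ⟨u - 1, by omega⟩
    have hnv : (n : ℝ) = 2 * v + 2 := by rw [hu]; push_cast; ring
    have hv1 : (1 : ℝ) ≤ v := by linarith
    -- The initial amplitude is limited to 1/q; the second bound prevents rotation beyond π/2.
    set θ1 : ℝ := min (Real.arcsin (1 / q)) (Real.pi / (2 * (2 * v + 1))) with hθ1
    set θ2 : ℝ := Real.pi / (2 * (n + 1)) with hθ2
    have hq1 : 1 / q ≤ 1 := by rw [div_le_one hq0]; linarith
    have hasin : 1 / q ≤ Real.arcsin (1 / q) := by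
      have h1 : 0 ≤ Real.arcsin (1 / q) := Real.arcsin_nonneg.2 (by positivity)
      have := Real.sin_le h1
      rwa [Real.sin_arcsin (by linarith [div_pos one_pos hq0]) hq1] at this
    have hθ1pos : 0 < θ1 := lt_min (lt_of_lt_of_le (by positivity) hasin) (by positivity)
    have hup : (2 * (v : ℝ) + 1) * θ1 ≤ Real.pi / 2 := by
      have := min_le_right (Real.arcsin (1 / q)) (Real.pi / (2 * (2 * v + 1)))
      calc (2 * (v : ℝ) + 1) * θ1 ≤ (2 * v + 1) * (Real.pi / (2 * (2 * v + 1))) := by gcongr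
        _ = _ := by field_simp
    -- The first alternative gives at least 2(2v+1)/(2v+3), which equals 6/5 at `v = 1` and
    -- increases with `v`.
    have hlow : (6 / 5 : ℝ) ≤ (2 * (v : ℝ) + 1) * θ1 := by
      rcases min_choice (Real.arcsin (1 / q)) (Real.pi / (2 * (2 * v + 1))) with h | h
      · calc (6 / 5 : ℝ) ≤ (2 * v + 1) * (2 / (n + 1)) := by
              rw [hnv, mul_div_assoc', div_le_div_iff₀ (by norm_num) (by positivity)]
              nlinarith
          _ ≤ (2 * v + 1) * Real.arcsin (1 / q) := by gcongr; exact hqn.trans hasin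
          _ = _ := by rw [hθ1, h]
      · calc (6 / 5 : ℝ) ≤ Real.pi / 2 := by linarith
          _ = (2 * v + 1) * (Real.pi / (2 * (2 * v + 1))) := by field_simp
          _ = _ := by rw [hθ1, h]
    set s := Real.sin ((2 * v + 1) * θ1) with hs
    -- The value 0.895 is below 2·0.546·0.82 ≤ sin(6/5), and its square still exceeds π/4.
    have hs1 : (0.895 : ℝ) ≤ s := by
      have h1 : Real.sin (6 / 5) ≤ s :=
        Real.sin_le_sin_of_le_of_le_pi_div_two (by linarith) hup hlow
      have h2 : (0.546 : ℝ) ≤ Real.sin (3 / 5) := by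
        have := Real.sin_gt_sub_cube (x := 3 / 5) (by norm_num)
        norm_num at this ⊢
        linarith
      have h3 : (0.82 : ℝ) ≤ Real.cos (3 / 5) := by
        have := Real.one_sub_sq_div_two_le_cos (x := 3 / 5)
        norm_num at this ⊢
        linarith
      have h4 : Real.sin (6 / 5) = 2 * Real.sin (3 / 5) * Real.cos (3 / 5) := by
        rw [← Real.sin_two_mul]; norm_num
      rw [h4] at h1
      nlinarith
    have hs2 : Real.pi / 4 ≤ s ^ 2 := by nlinarith
    have hspos : 0 < s ^ 2 := by positivity
    have hθ2pos : 0 < θ2 := by positivity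
    have hsinθ2 : 0 ≤ Real.sin θ2 := Real.sin_nonneg_of_nonneg_of_le_pi hθ2pos.le (by
      rw [hθ2, div_le_iff₀ (by positivity)]
      nlinarith)
    refine ⟨v, v + 1, θ1, θ2, Real.sin θ2 / s ^ 2, ?_, ?_, by positivity, ?_, ?_, ?_, ?_, ?_⟩
    · exact Real.sin_nonneg_of_nonneg_of_le_pi hθ1pos.le (by nlinarith)
    · rw [← Real.sin_arcsin (x := 1 / q) (by linarith [div_pos one_pos hq0]) hq1]
      exact Real.sin_le_sin_of_le_of_le_pi_div_two (by linarith) (Real.arcsin_le_pi_div_two _)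
        (min_le_left _ _)
    · refine le_trans ?_ hqn
      rw [div_le_iff₀ hspos]
      calc Real.sin θ2 ≤ θ2 := Real.sin_le hθ2pos.le
        _ = 2 / (n + 1) * (Real.pi / 4) := by rw [hθ2]; field_simp; norm_num
        _ ≤ _ := by gcongr
    · rw [← hs]; field_simp
    · have : (2 * ((v + 1 : ℕ) : ℝ) + 1) * θ2 = Real.pi / 2 := by
        rw [hθ2, hnv]; push_cast; field_simp
      rw [this, Real.sin_pi_div_two]
    · have : 1 ≤ v := by exact_mod_cast hv1
      nlinarith
    · push_cast
      nlinarith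
  · have hnu : (n : ℝ) = 2 * u + 1 := by rw [hu]; push_cast; ring
    have hn5 : (5 : ℝ) ≤ n := by
      have : 5 ≤ n := by omega
      exact_mod_cast this
    set θ : ℝ := Real.pi / (2 * n) with hθ
    have hθpos : 0 < θ := by positivity
    have hθπ : (2 * (u : ℝ) + 1) * θ = Real.pi / 2 := by
      rw [← hnu, hθ]; field_simp
    have hsin0 : 0 ≤ Real.sin θ := Real.sin_nonneg_of_nonneg_of_le_pi hθpos.le (by
      rw [hθ, div_le_iff₀ (by positivity)]
      nlinarith)
    have hsin1 : Real.sin θ ≤ 1 / q := by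
      refine le_trans (Real.sin_le hθpos.le) (le_trans ?_ hqn)
      rw [hθ, div_le_div_iff₀ (by positivity) (by positivity)]
      nlinarith
    refine ⟨u, u, θ, θ, Real.sin θ, hsin0, hsin1, hsin0, hsin1, ?_, ?_, ?_, ?_⟩
    · rw [hθπ, Real.sin_pi_div_two]; ring
    · rw [hθπ, Real.sin_pi_div_two]
    · have : 2 ≤ u := by omega
      nlinarith
    · push_cast
      rw [← hnu]
      nlinarith

end Amplification

/-! ### The register: sites and bond registers -/

section Register
variable {N b d : ℕ} [NeZero d]

/-- The qudits: the `N` sites and, at every cut `k`, two bond registers of `b` qudits, namely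
`(k, true)` for the right bond of a block ending at `k` and `(k, false)` for the left bond of a
block starting at `k`. -/
abbrev Reg (N b : ℕ) : Type := Fin N ⊕ (Fin (N + 1) × Bool × Fin b)

/-- The qudit `w` belongs to the block of the sites `j, …, j + m - 1`. -/
def InBlock (j m : ℕ) : Reg N b → Prop
  | Sum.inl i => j ≤ i ∧ (i : ℕ) < j + m
  | Sum.inr (k, true, _) => j < k ∧ (k : ℕ) ≤ j + m
  | Sum.inr (k, false, _) => j ≤ k ∧ (k : ℕ) < j + m

/-- The qudit `w` belongs to a bond register strictly inside of the block. -/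
def IsInner (j m : ℕ) : Reg N b → Prop
  | Sum.inl _ => False
  | Sum.inr (k, _, _) => j < k ∧ (k : ℕ) < j + m

open Classical in
/-- The qudits of the block of the sites `j, …, j + m - 1`. -/
def block (N b j m : ℕ) : Finset (Reg N b) := Finset.univ.filter (InBlock j m)

open Classical in
/-- The bond qudits of the block. -/
def anc (N b j m : ℕ) : Finset (Reg N b) :=
  Finset.univ.filter fun w => InBlock j m w ∧ ∃ c, w = Sum.inr c

open Classical in
/-- The bond qudits strictly inside of the block. -/
def innerReg (N b j m : ℕ) : Finset (Reg N b) := Finset.univ.filter (IsInner j m)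

open Classical in
/-- The bond qudits at the cut `k`. -/
def cutReg (N b k : ℕ) : Finset (Reg N b) :=
  Finset.univ.filter fun w => ∃ c : Fin (N + 1) × Bool × Fin b, w = Sum.inr c ∧ (c.1 : ℕ) = k

lemma mem_block {j m : ℕ} {w : Reg N b} : w ∈ block N b j m ↔ InBlock j m w := by simp [block]

lemma mem_anc {j m : ℕ} {w : Reg N b} :
    w ∈ anc N b j m ↔ InBlock j m w ∧ ∃ c, w = Sum.inr c := by simp [anc]

lemma mem_inner {j m : ℕ} {w : Reg N b} : w ∈ innerReg N b j m ↔ IsInner j m w := by simp [innerReg]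

lemma mem_cutReg {k : ℕ} {w : Reg N b} : w ∈ cutReg N b k ↔
    ∃ c : Fin (N + 1) × Bool × Fin b, w = Sum.inr c ∧ (c.1 : ℕ) = k := by simp [cutReg]

lemma inner_subset_anc (j m : ℕ) : innerReg N b j m ⊆ anc N b j m := by
  intro w hw
  rw [mem_inner] at hw
  rw [mem_anc]
  rcases w with i | ⟨k, s, c⟩
  · exact hw.elim
  · refine ⟨?_, _, rfl⟩
    cases s
    · exact ⟨hw.1.le, hw.2⟩
    · exact ⟨hw.1, hw.2.le⟩

lemma anc_subset_block (j m : ℕ) : anc N b j m ⊆ block N b j m := by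
  intro w hw
  exact mem_block.2 (mem_anc.1 hw).1

/-- The half-open conventions of `InBlock` are made for this: at a cut, the register `true` goes
with the block ending there and `false` with the block starting there. Adjacent blocks can therefore
be processed in parallel. -/
lemma block_disjoint (j m m' : ℕ) : Disjoint (block N b j m) (block N b (j + m) m') := by
  rw [Finset.disjoint_left]
  intro w h1 h2
  rw [mem_block] at h1 h2
  rcases w with i | ⟨k, s, c⟩
  · simp only [InBlock] at h1 h2; omega
  · cases s <;> simp only [InBlock] at h1 h2 <;> omega

lemma block_union (j m m' : ℕ) :
    block N b j m ∪ block N b (j + m) m' = block N b j (m + m') := by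
  ext w
  rw [Finset.mem_union, mem_block, mem_block, mem_block]
  rcases w with i | ⟨k, s, c⟩
  · simp only [InBlock]; omega
  · cases s <;> simp only [InBlock] <;> omega

lemma cutReg_subset_inner {j m k : ℕ} (h1 : j < k) (h2 : k < j + m) :
    cutReg N b k ⊆ innerReg N b j m := by
  intro w hw
  obtain ⟨⟨k', s, c⟩, rfl, hk⟩ := mem_cutReg.1 hw
  rw [mem_inner]
  simp only [IsInner]
  simp only at hk
  omega

/-- Each site accounts for the `false` register on its left and the `true` register on its right, of
`b` qudits each. -/
lemma card_anc_le (j m : ℕ) : (anc N b j m).card ≤ 2 * b * m := by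
  classical
  have : anc N b j m ⊆ (Finset.univ : Finset (Fin m × Bool × Fin b)).image fun p =>
      if h : j + p.1 + (if p.2.1 then 1 else 0) < N + 1 then
        Sum.inr (⟨_, h⟩, p.2.1, p.2.2) else Sum.inr (0, p.2.1, p.2.2) := by
    intro w hw
    obtain ⟨hw, ⟨k, s, c⟩, rfl⟩ := mem_anc.1 hw
    rw [Finset.mem_image]
    have hk := k.2
    cases s
    · simp only [InBlock] at hw
      refine ⟨(⟨k - j, by omega⟩, false, c), Finset.mem_univ _, ?_⟩
      have e : j + ((k : ℕ) - j) = k := by omega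
      simp [e, Nat.lt_succ_iff.1 hk]
    · simp only [InBlock] at hw
      refine ⟨(⟨k - j - 1, by omega⟩, true, c), Finset.mem_univ _, ?_⟩
      have e : j + ((k : ℕ) - j - 1) + 1 = k := by omega
      simp [e, Nat.lt_succ_iff.1 hk]
  refine (Finset.card_le_card this).trans (Finset.card_image_le.trans ?_)
  simp [Finset.card_univ]
  ring_nf; rfl

lemma card_block_le (j m : ℕ) : (block N b j m).card ≤ (2 * b + 1) * m := by
  classical
  have h : (block N b j m \ anc N b j m).card ≤ (Finset.range m).card := by
    refine Finset.card_le_card_of_injOn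
      (fun w => Sum.elim (fun i : Fin N => (i : ℕ) - j) (fun _ => 0) w) ?_ ?_
    · intro w hw
      rw [Finset.mem_coe, Finset.mem_sdiff, mem_block, mem_anc] at hw
      rcases w with i | c
      · have h1 := hw.1
        simp only [InBlock] at h1
        simp only [Sum.elim_inl, Finset.coe_range, Set.mem_Iio]
        omega
      · exact absurd ⟨hw.1, c, rfl⟩ hw.2
    · intro w hw w' hw' he
      rw [Finset.mem_coe, Finset.mem_sdiff, mem_block, mem_anc] at hw hw'
      rcases w with i | c
      · rcases w' with i' | c'
        · have h1 := hw.1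
          have h2 := hw'.1
          simp only [InBlock] at h1 h2
          simp only [Sum.elim_inl] at he
          exact congrArg Sum.inl (Fin.ext (by omega))
        · exact absurd ⟨hw'.1, c', rfl⟩ hw'.2
      · exact absurd ⟨hw.1, c, rfl⟩ hw.2
  rw [Finset.card_range] at h
  have h2 := Finset.card_sdiff_add_card_eq_card (anc_subset_block (N := N) (b := b) j m)
  have h3 := card_anc_le (N := N) (b := b) j m
  have : (2 * b + 1) * m = 2 * b * m + m := by ring
  omega

lemma card_cutReg_le (k : ℕ) : (cutReg N b k).card ≤ 2 * b := by
  classical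
  have : cutReg N b k ⊆ (Finset.univ : Finset (Bool × Fin b)).image fun p =>
      if h : k < N + 1 then Sum.inr (⟨_, h⟩, p.1, p.2) else Sum.inr (0, p.1, p.2) := by
    intro w hw
    obtain ⟨⟨k', s, c⟩, rfl, rfl⟩ := mem_cutReg.1 hw
    rw [Finset.mem_image]
    exact ⟨(s, c), Finset.mem_univ _, by simp [Nat.lt_succ_iff.1 k'.2]⟩
  refine (Finset.card_le_card this).trans (Finset.card_image_le.trans ?_)
  simp [Finset.card_univ]

/-- The physical configuration. -/
def ph (x : Config (Reg N b) d) (l : ℕ) : Fin d := if h : l < N then x (Sum.inl ⟨l, h⟩) else 0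

/-- The content of a bond register, as a number. -/
def rd (x : Config (Reg N b) d) (k : ℕ) (s : Bool) : Fin (d ^ b) :=
  finFunctionFinEquiv fun c => if h : k < N + 1 then x (Sum.inr (⟨k, h⟩, s, c)) else 0

lemma rd_congr {x y : Config (Reg N b) d} {k : ℕ} {s : Bool}
    (h : ∀ (k' : Fin (N + 1)) c, (k' : ℕ) = k → x (Sum.inr (k', s, c)) = y (Sum.inr (k', s, c))) :
    rd x k s = rd y k s := by
  rw [rd, rd]
  congr 1
  funext c
  split_ifs with hk
  · exact h _ _ rfl
  · rfl

lemma eq_of_rd_eq {x y : Config (Reg N b) d} {k : ℕ} {s : Bool} (h : rd x k s = rd y k s)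
    (k' : Fin (N + 1)) (hk : (k' : ℕ) = k) (c : Fin b) :
    x (Sum.inr (k', s, c)) = y (Sum.inr (k', s, c)) := by
  subst hk
  have := congrFun (finFunctionFinEquiv.injective h) c
  simpa [Nat.lt_succ_iff.1 k'.2] using this

lemma rd_eq_symm {x : Config (Reg N b) d} {k : ℕ} {s : Bool} {a : Fin (d ^ b)} (hk : k < N + 1)
    (h : ∀ (k' : Fin (N + 1)) c, (k' : ℕ) = k →
      x (Sum.inr (k', s, c)) = finFunctionFinEquiv.symm a c) : rd x k s = a := by
  rw [rd, ← Equiv.apply_symm_apply finFunctionFinEquiv a]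
  congr 1
  funext c
  rw [dif_pos hk]
  exact h _ _ rfl

end Register

/-! ### Segments -/

section Segment
variable {d n : ℕ}

/-- The product of the tensors of the `m` sites `j, …, j + m - 1`. -/
def seg (T : ℕ → Fin d → Fin d → Matrix (Fin n) (Fin n) ℂ) (j : ℕ) :
    ℕ → (ℕ → Fin d) → (ℕ → Fin d) → Matrix (Fin n) (Fin n) ℂ
  | 0, _, _ => 1
  | m + 1, s, t => seg T j m s t * T (j + m) (s (j + m)) (t (j + m))

variable {T : ℕ → Fin d → Fin d → Matrix (Fin n) (Fin n) ℂ}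

lemma seg_add (j m m' : ℕ) (s t : ℕ → Fin d) :
    seg T j (m + m') s t = seg T j m s t * seg T (j + m) m' s t := by
  induction m' with
  | zero => simp [seg]
  | succ m' ih => rw [← add_assoc, seg, ih, seg, mul_assoc, add_assoc j m m']

lemma seg_congr {j m : ℕ} {s s' t t' : ℕ → Fin d} (hs : ∀ l, j ≤ l → l < j + m → s l = s' l)
    (ht : ∀ l, j ≤ l → l < j + m → t l = t' l) : seg T j m s t = seg T j m s' t' := by
  induction m with
  | zero => rfl
  | succ m ih =>
    rw [seg, seg, ih (fun l h1 h2 => hs l h1 (by omega)) (fun l h1 h2 => ht l h1 (by omega)),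
      hs _ (by omega) (by omega), ht _ (by omega) (by omega)]

/-- The configuration `σ` on the sites `j, …, j + m - 1`. -/
def put [NeZero d] (j : ℕ) {m : ℕ} (σ : Fin m → Fin d) (l : ℕ) : Fin d :=
  if h : j ≤ l ∧ l < j + m then σ ⟨l - j, by omega⟩ else 0

end Segment

/-- Tensors together with operators `L`, `R` turning their segments into isometries, and with
operators `Φ` on the bonds that undo `R` and `L`. -/
structure IsoData (N d b : ℕ) [NeZero d] (q : ℝ) where
  T : ℕ → Fin d → Fin d → Matrix (Fin (d ^ b)) (Fin (d ^ b)) ℂ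
  L : ℕ → Matrix (Fin (d ^ b)) (Fin (d ^ b)) ℂ
  R : ℕ → Matrix (Fin (d ^ b)) (Fin (d ^ b)) ℂ
  Φ : ℕ → Matrix (Fin (d ^ b)) (Fin (d ^ b)) ℂ
  /-- a level of the bond registers that is not used -/
  spare : Fin (d ^ b)
  iso : ∀ j m, 1 ≤ m → j + m ≤ N → ∀ t t' : ℕ → Fin d,
    ∑ σ : Fin m → Fin d, ∑ a, ∑ c, star ((L j * seg T j m (put j σ) t' * (R (j + m))ᵀ) a c) *
      (L j * seg T j m (put j σ) t * (R (j + m))ᵀ) a c =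
      if ∀ l, j ≤ l → l < j + m → t' l = t l then 1 else 0
  -- The relation is required only behind a tensor: with zero padding, the product `Rᵀ Φ L` is the
  -- projection onto the true bond space, not the identity.
  undo : ∀ k, k + 1 < N → ∀ s t, T k s t * ((R (k + 1))ᵀ * Φ (k + 1) * L (k + 1)) = T k s t
  norm_le : ∀ k, 1 ≤ k → k < N → ∑ a, ∑ c, ‖Φ k a c‖ ^ 2 ≤ q ^ 2
  -- These two conditions allow the normalization of the bond state to be adjusted at the spare
  -- level: the added component is orthogonal to Φ and is annihilated by the next segment.
  Φ_spare : ∀ k, 1 ≤ k → k < N → Φ k spare spare = 0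
  L_spare : ∀ k, 1 ≤ k → k < N → ∀ c, L k spare c = 0

/-! ### Block encodings of the segment isometries -/

section BlockEncoding
variable {N b d : ℕ} [NeZero d] {q : ℝ} (A : IsoData N d b q)

/-- The isometry of a segment of tensors, between configurations. -/
def IsoData.W (j m : ℕ) (s t : ℕ → Fin d) : Matrix (Fin (d ^ b)) (Fin (d ^ b)) ℂ :=
  A.L j * seg A.T j m s t * (A.R (j + m))ᵀ

lemma IsoData.W_congr {j m : ℕ} {s s' t t' : ℕ → Fin d}
    (hs : ∀ l, j ≤ l → l < j + m → s l = s' l) (ht : ∀ l, j ≤ l → l < j + m → t l = t' l) :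
    A.W j m s t = A.W j m s' t' := by
  rw [IsoData.W, IsoData.W, seg_congr hs ht]

open Classical in
/-- The isometry of a segment of tensors, as an operator on the register. -/
def IsoData.op (j m : ℕ) : Matrix (Config (Reg N b) d) (Config (Reg N b) d) ℂ :=
  Matrix.of fun x y => if (∀ w, w ∉ block N b j m → x w = y w) ∧ ∀ i ∈ innerReg N b j m, x i = 0 then
    A.W j m (ph x) (ph y) (rd x j false) (rd x (j + m) true) else 0

/-- `V` contains the isometry of a segment with amplitude `α`. -/
def IsoData.Encodes (j m : ℕ) (V : Matrix (Config (Reg N b) d) (Config (Reg N b) d) ℂ) (α : ℝ) :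
    Prop :=
  ∀ x y, (∀ i ∈ innerReg N b j m, x i = 0) → (∀ i ∈ anc N b j m, y i = 0) →
    V x y = α * A.op j m x y

/-- The projection onto the qudits of `S` being `0`. -/
def proj0 (d : ℕ) [NeZero d] (S : Finset (Reg N b)) : Matrix (Config (Reg N b) d) (Config (Reg N b) d) ℂ :=
  Matrix.diagonal fun x => if ∀ i ∈ S, x i = 0 then (1 : ℂ) else 0

lemma proj0_mul_self (S : Finset (Reg N b)) :
    (proj0 d S : Matrix (Config (Reg N b) d) (Config (Reg N b) d) ℂ) * proj0 d S = proj0 d S := by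
  rw [proj0, Matrix.diagonal_mul_diagonal]
  congr 1
  funext x
  split_ifs <;> simp

lemma proj0_conjTranspose (S : Finset (Reg N b)) :
    (proj0 d S : Matrix (Config (Reg N b) d) (Config (Reg N b) d) ℂ)ᴴ = proj0 d S := by
  rw [proj0, Matrix.diagonal_conjTranspose]
  congr 1
  funext x
  rw [Pi.star_apply]
  split_ifs <;> simp

/-- This is the form in which amplitude amplification applies: the input projection sets all bond
qudits of the block to 0, the output projection only the inner ones, since the two outer registers
carry the open bonds of the result. -/
lemma encodes_iff {j m : ℕ} {V : Matrix (Config (Reg N b) d) (Config (Reg N b) d) ℂ} {α : ℝ} :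
    A.Encodes j m V α ↔ proj0 d (innerReg N b j m) * V * proj0 d (anc N b j m) =
      (α : ℂ) • (A.op j m * proj0 d (anc N b j m)) := by
  have hL : ∀ x y, (proj0 d (innerReg N b j m) * V * proj0 d (anc N b j m)) x y =
      (if ∀ i ∈ innerReg N b j m, x i = 0 then (1 : ℂ) else 0) * V x y *
        (if ∀ i ∈ anc N b j m, y i = 0 then (1 : ℂ) else 0) := by
    intro x y
    rw [proj0, proj0, Matrix.mul_diagonal, Matrix.diagonal_mul]
  have hR : ∀ x y, ((α : ℂ) • (A.op j m * proj0 d (anc N b j m))) x y = (α : ℂ) * (A.op j m x y *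
      (if ∀ i ∈ anc N b j m, y i = 0 then (1 : ℂ) else 0)) := by
    intro x y
    rw [proj0, Matrix.smul_apply, Matrix.mul_diagonal, smul_eq_mul]
  constructor
  · intro h
    ext x y
    rw [hL, hR]
    by_cases hx : ∀ i ∈ innerReg N b j m, x i = 0
    · by_cases hy : ∀ i ∈ anc N b j m, y i = 0
      · rw [if_pos hx, if_pos hy, h x y hx hy]; ring
      · rw [if_neg hy]; ring
    · have : A.op j m x y = 0 := if_neg fun h => hx h.2
      rw [if_neg hx, this]; ring
  · intro h x y hx hy
    have := congrFun (congrFun h x) y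
    rw [hL, hR, if_pos hx, if_pos hy] at this
    simpa using this

/-- The configuration of the register with given content of a block. -/
def build (y : Config (Reg N b) d) (j m : ℕ) (σ : Fin m → Fin d) (a c : Fin (d ^ b)) :
    Config (Reg N b) d
  | Sum.inl i => if j ≤ i ∧ (i : ℕ) < j + m then put j σ i else y (Sum.inl i)
  | Sum.inr (k, false, l) => if (k : ℕ) = j then finFunctionFinEquiv.symm a l else
      if j < k ∧ (k : ℕ) < j + m then 0 else y (Sum.inr (k, false, l))
  | Sum.inr (k, true, l) => if (k : ℕ) = j + m then finFunctionFinEquiv.symm c l else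
      if j < k ∧ (k : ℕ) < j + m then 0 else y (Sum.inr (k, true, l))

section
variable {y : Config (Reg N b) d} {j m : ℕ} {σ : Fin m → Fin d} {a c : Fin (d ^ b)}

lemma rd_build_false (h : j + m ≤ N) : rd (build y j m σ a c) j false = a :=
  rd_eq_symm (by omega) fun k' l hk => by simp [build, hk]

lemma rd_build_true (h : j + m ≤ N) : rd (build y j m σ a c) (j + m) true = c :=
  rd_eq_symm (by omega) fun k' l hk => by simp [build, hk]

lemma ph_build (h : j + m ≤ N) {l : ℕ} (h1 : j ≤ l) (h2 : l < j + m) :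
    ph (build y j m σ a c) l = put j σ l := by
  rw [ph, dif_pos (by omega)]
  simp [build, h1, h2]

lemma build_of_notMem (hm : 1 ≤ m) {w : Reg N b} (hw : w ∉ block N b j m) :
    build y j m σ a c w = y w := by
  rw [mem_block] at hw
  rcases w with i | ⟨k, s, l⟩
  · simp only [InBlock] at hw
    simp only [build]
    rw [if_neg hw]
  · cases s
    · simp only [InBlock] at hw
      simp only [build]
      rw [if_neg (by omega), if_neg (by omega)]
    · simp only [InBlock] at hw
      simp only [build]
      rw [if_neg (by omega), if_neg (by omega)]

lemma build_inner {w : Reg N b} (hw : w ∈ innerReg N b j m) : build y j m σ a c w = 0 := by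
  rw [mem_inner] at hw
  rcases w with i | ⟨k, s, l⟩
  · exact hw.elim
  · simp only [IsInner] at hw
    cases s
    · simp only [build]
      rw [if_neg (by omega), if_pos hw]
    · simp only [build]
      rw [if_neg (by omega), if_pos hw]

end

/-- The outputs contributing to a column of `op` are of the form `build`, so a sum over
configurations of the register becomes a sum over site outputs and the two outer bond values. -/
lemma eq_build {x y : Config (Reg N b) d} {j m : ℕ}
    (h1 : ∀ w, w ∉ block N b j m → x w = y w) (h2 : ∀ i ∈ innerReg N b j m, x i = 0) :
    build y j m (fun i => ph x (j + i)) (rd x j false) (rd x (j + m) true) = x := by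
  funext w
  rcases w with i | ⟨k, s, l⟩
  · simp only [build]
    split_ifs with h
    · rw [put, dif_pos h]
      have : j + ((i : ℕ) - j) = i := by omega
      simp [this, ph]
    · exact (h1 _ (by rw [mem_block]; exact h)).symm
  · have hin := h2 (Sum.inr (k, s, l))
    have hout := h1 (Sum.inr (k, s, l))
    rw [mem_inner] at hin
    rw [mem_block] at hout
    cases s
    · simp only [InBlock, IsInner] at hin hout
      simp only [build]
      split_ifs with h3 h4
      · subst h3; simp [rd, Nat.lt_succ_iff.1 k.2]
      · exact (hin h4).symm
      · exact (hout (by omega)).symm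
    · simp only [InBlock, IsInner] at hin hout
      simp only [build]
      split_ifs with h3 h4
      · have hk : j + m < N + 1 := h3 ▸ k.2
        have : k = ⟨j + m, hk⟩ := Fin.ext h3
        subst this; simp [rd, hk]
      · exact (hin h4).symm
      · exact (hout (by omega)).symm

lemma build_injective (y : Config (Reg N b) d) {j m : ℕ} (h : j + m ≤ N) :
    Function.Injective fun p : (Fin m → Fin d) × Fin (d ^ b) × Fin (d ^ b) =>
      build y j m p.1 p.2.1 p.2.2 := by
  rintro ⟨σ, a, c⟩ ⟨σ', a', c'⟩ he
  simp only at he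
  have h1 := (rd_build_false (σ := σ) (a := a) (c := c) (y := y) h).symm.trans
    ((congrArg (fun x => rd x j false) he).trans (rd_build_false h))
  have h2 := (rd_build_true (σ := σ) (a := a) (c := c) (y := y) h).symm.trans
    ((congrArg (fun x => rd x (j + m) true) he).trans (rd_build_true h))
  have h3 : σ = σ' := by
    funext i
    have := congrArg (fun x => ph x (j + i)) he
    simp only [ph_build h (Nat.le_add_right j i) (Nat.add_lt_add_left i.2 j)] at this
    simpa [put] using this
  rw [h1, h2, h3]

lemma ph_eq_of_eq {x y : Config (Reg N b) d} {j m : ℕ} (h : ∀ w ∈ block N b j m, x w = y w) {l : ℕ}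
    (h1 : j ≤ l) (h2 : l < j + m) : ph x l = ph y l := by
  rw [ph, ph]
  split_ifs with hl
  · exact h _ (mem_block.2 ⟨h1, h2⟩)
  · rfl

/-- The isometry property of a segment, on the register. -/
lemma IsoData.op_isometry {j m : ℕ} (hm : 1 ≤ m) (hN : j + m ≤ N) :
    proj0 d (anc N b j m) * (A.op j m)ᴴ * A.op j m * proj0 d (anc N b j m) = proj0 d (anc N b j m) := by
  classical
  ext y' y
  have hL : (proj0 d (anc N b j m) * (A.op j m)ᴴ * A.op j m * proj0 d (anc N b j m)) y' y =
      (if ∀ i ∈ anc N b j m, y' i = 0 then (1 : ℂ) else 0) *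
        (∑ x, star (A.op j m x y') * A.op j m x y) *
        (if ∀ i ∈ anc N b j m, y i = 0 then (1 : ℂ) else 0) := by
    rw [mul_assoc (proj0 d (anc N b j m))]
    rw [proj0, Matrix.mul_diagonal, Matrix.diagonal_mul, Matrix.mul_apply]
    rfl
  rw [hL, proj0, Matrix.diagonal_apply]
  by_cases hy : ∀ i ∈ anc N b j m, y i = 0
  swap
  · rw [if_neg hy, mul_zero]
    split_ifs with h1 h2
    · exact absurd (h1 ▸ h2) hy
    · rfl
    · rfl
  by_cases hy' : ∀ i ∈ anc N b j m, y' i = 0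
  swap
  · rw [if_neg hy', zero_mul, zero_mul]
    simp
  rw [if_pos hy, if_pos hy', one_mul, mul_one]
  by_cases hyy : ∀ w, w ∉ block N b j m → y' w = y w
  swap
  · rw [if_neg (fun h => hyy fun w _ => by rw [h])]
    refine Finset.sum_eq_zero fun x _ => ?_
    by_cases hx : ∀ w, w ∉ block N b j m → x w = y w
    · have : A.op j m x y' = 0 := if_neg fun h => hyy fun w hw => by rw [← h.1 w hw, hx w hw]
      rw [this]; simp
    · have : A.op j m x y = 0 := if_neg fun h => hx h.1
      rw [this]; simp
  rw [← Fintype.sum_of_injective _ (build_injective y hN)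
    (fun p => star (A.W j m (put j p.1) (ph y') p.2.1 p.2.2) *
      A.W j m (put j p.1) (ph y) p.2.1 p.2.2)]
  · rw [Fintype.sum_prod_type]
    simp only [Fintype.sum_prod_type]
    have := A.iso j m hm hN (ph y) (ph y')
    simp only [IsoData.W]
    rw [this]
    congr 1
    refine propext ⟨fun h => ?_, fun h => h ▸ fun _ _ _ => rfl⟩
    funext w
    by_cases hw : w ∈ block N b j m
    · rcases w with i | c
      · have h1 := mem_block.1 hw
        simp only [InBlock] at h1
        have := h i h1.1 h1.2
        simpa [ph] using this
      · have : (Sum.inr c : Reg N b) ∈ anc N b j m := mem_anc.2 ⟨mem_block.1 hw, c, rfl⟩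
        rw [hy _ this, hy' _ this]
    · exact hyy w hw
  · intro x hx
    by_cases h1 : ∀ w, w ∉ block N b j m → x w = y w
    · by_cases h2 : ∀ i ∈ innerReg N b j m, x i = 0
      · exact absurd ⟨(_, _, _), eq_build h1 h2⟩ hx
      · have : A.op j m x y = 0 := if_neg fun h => h2 h.2
        rw [this]; simp
    · have : A.op j m x y = 0 := if_neg fun h => h1 h.1
      rw [this]; simp
  · rintro ⟨σ, a, c⟩
    have e : ∀ z : Config (Reg N b) d, (∀ w, w ∉ block N b j m → z w = y w) →
        A.op j m (build y j m σ a c) z = A.W j m (put j σ) (ph z) a c := by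
      intro z hz
      rw [IsoData.op, Matrix.of_apply, if_pos, rd_build_false hN, rd_build_true hN]
      · rw [A.W_congr (fun l h1 h2 => ph_build hN h1 h2) fun _ _ _ => rfl]
      · exact ⟨fun w hw => by rw [build_of_notMem hm hw, hz w hw], fun i hi => build_inner hi⟩
    rw [e y' hyy, e y fun _ _ => rfl]

end BlockEncoding

/-! ### Completing rows and columns to unitaries -/

lemma exists_unitary_row {n : Type} [Fintype n] [DecidableEq n] (i : n) {r : n → ℂ}
    (hr : ∑ z, star (r z) * r z = 1) : ∃ M ∈ Matrix.unitaryGroup n ℂ, ∀ z, M i z = r z := by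
  obtain ⟨γ, a, hU, hv, -⟩ := exists_reflection (v := Pi.single i 1) (w := star r) (by simp) (by
    rw [star_star, dotProduct, ← hr]
    exact Finset.sum_congr rfl fun z _ => mul_comm _ _)
  refine ⟨(rankOne γ a)ᴴ, Unitary.star_mem hU, fun z => ?_⟩
  have := congrFun hv z
  rw [Matrix.mulVec_single_one, Matrix.col_apply] at this
  rw [Matrix.conjTranspose_apply, this, Pi.star_apply, star_star]

lemma exists_unitary_columns {n : Type} [Fintype n] [DecidableEq n] (s : Set n) (v : n → n → ℂ)
    (hv : ∀ y' ∈ s, ∀ y ∈ s, ∑ x, star (v y' x) * v y x = if y' = y then 1 else 0) :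
    ∃ M ∈ Matrix.unitaryGroup n ℂ, ∀ y ∈ s, ∀ x, M x y = v y x := by
  have hinner : ∀ f g : n → ℂ, inner ℂ (WithLp.toLp 2 f) (WithLp.toLp 2 g) =
      ∑ x, star (f x) * g x := by
    intro f g
    rw [PiLp.inner_apply]
    refine Finset.sum_congr rfl fun x _ => ?_
    simp [mul_comm]
  have ho : Orthonormal ℂ (s.domRestrict fun y => WithLp.toLp 2 (v y)) := by
    rw [orthonormal_iff_ite]
    rintro ⟨y', hy'⟩ ⟨y, hy⟩
    change inner ℂ (WithLp.toLp 2 (v y')) (WithLp.toLp 2 (v y)) = _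
    rw [hinner, hv y' hy' y hy]
    simp only [Subtype.mk.injEq]
  obtain ⟨b, hb⟩ := ho.exists_orthonormalBasis_extension_of_card_eq
    (finrank_euclideanSpace (𝕜 := ℂ) (ι := n))
  refine ⟨Matrix.of fun x y => b y x, ?_, fun y hy x => ?_⟩
  · rw [Matrix.mem_unitaryGroup_iff', Matrix.star_eq_conjTranspose]
    ext y' y
    rw [Matrix.mul_apply, Matrix.one_apply, ← orthonormal_iff_ite.1 b.orthonormal y' y]
    exact (hinner (b y').ofLp (b y).ofLp).symm
  · rw [Matrix.of_apply, hb y hy]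

/-! ### Merging and amplifying blocks -/

section Merge
variable {N b d : ℕ} [NeZero d] {q : ℝ} (A : IsoData N d b q)

lemma loc_mul_apply {ι : Type} [Fintype ι] [DecidableEq ι] {S T : Finset ι} (hST : Disjoint S T)
    {V V' : Op ι d} (hV : Loc S V) (hV' : Loc T V') (z y : Config ι d) :
    (V * V') z y = V z (fun w => if w ∈ T then z w else y w) *
      V' (fun w => if w ∈ T then z w else y w) y := by
  rw [Matrix.mul_apply]
  refine Fintype.sum_eq_single _ fun z' hz' => ?_
  by_cases h1 : ∀ w, w ∉ S → z w = z' w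
  · by_cases h2 : ∀ w, w ∉ T → z' w = y w
    · refine absurd ?_ hz'
      funext w
      by_cases hw : w ∈ T
      · rw [if_pos hw, h1 w (Finset.disjoint_right.1 hST hw)]
      · rw [if_neg hw, h2 w hw]
    · rw [hV' _ _ h2, mul_zero]
  · rw [hV _ _ h1, zero_mul]

/-- The content of a bond register at the cut `k`. -/
def cutCode {k : ℕ} (u : Config (cutReg N b k) d) (s : Bool) : Fin (d ^ b) :=
  rd (glue (cutReg N b k) u 0) k s

lemma cutCode_bijective {k : ℕ} (hk : k ≤ N) :
    Function.Bijective fun u : Config (cutReg N b k) d => (cutCode u true, cutCode u false) := by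
  constructor
  · intro u u' h
    have h1 := congrArg Prod.fst h
    have h2 := congrArg Prod.snd h
    funext w
    rw [← glue_mem u 0, ← glue_mem u' 0]
    obtain ⟨w, hw⟩ := w
    obtain ⟨⟨k', s, c⟩, rfl, hk'⟩ := mem_cutReg.1 hw
    cases s
    · exact eq_of_rd_eq h2 k' hk' c
    · exact eq_of_rd_eq h1 k' hk' c
  · rintro ⟨p, p'⟩
    let z : Config (Reg N b) d := fun w => Sum.elim (fun _ => 0)
      (fun w => finFunctionFinEquiv.symm (if w.2.1 then p else p') w.2.2) w
    refine ⟨fun w => z w, ?_⟩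
    have hz : ∀ s, rd (glue (cutReg N b k) (fun w => z w) 0) k s = if s then p else p' := by
      intro s
      refine rd_eq_symm (by omega) fun k' c hk' => ?_
      have hmem : (Sum.inr (k', s, c) : Reg N b) ∈ cutReg N b k := mem_cutReg.2 ⟨_, rfl, hk'⟩
      exact glue_mem _ _ ⟨_, hmem⟩
    exact Prod.ext ((hz true).trans (if_pos rfl)) ((hz false).trans (if_neg (by simp)))

/-- The bond state used to merge two segments. -/
def IsoData.bond (k : ℕ) (ν : ℝ) : Matrix (Fin (d ^ b)) (Fin (d ^ b)) ℂ :=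
  (ν : ℂ) • A.Φ k + Matrix.single A.spare A.spare
    ((Real.sqrt (1 - ν ^ 2 * ∑ a, ∑ c, ‖A.Φ k a c‖ ^ 2) : ℝ) : ℂ)

/-- Φ vanishes at the spare entry, so the two contributions to the norm add without cross terms; the
spare weight `1 - ν²‖Φ‖²` is nonnegative because `ν q ≤ 1`. -/
lemma IsoData.sum_bond {k : ℕ} (h1 : 1 ≤ k) (h2 : k < N) {ν : ℝ} (hν : 0 ≤ ν) (hq : 0 < q)
    (hνq : ν ≤ 1 / q) : ∑ a, ∑ c, star (A.bond k ν a c) * A.bond k ν a c = 1 := by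
  set Sm := ∑ a, ∑ c, ‖A.Φ k a c‖ ^ 2 with hSm
  have hS0 : 0 ≤ 1 - ν ^ 2 * Sm := by
    have h3 : Sm ≤ q ^ 2 := A.norm_le k h1 h2
    have h4 : ν * q ≤ 1 := by rwa [le_div_iff₀ hq] at hνq
    have h5 : 0 ≤ ν * q := by positivity
    have : ν ^ 2 * Sm ≤ ν ^ 2 * q ^ 2 := by gcongr
    nlinarith
  have hterm : ∀ a c, star (A.bond k ν a c) * A.bond k ν a c =
      ((ν ^ 2 * ‖A.Φ k a c‖ ^ 2 + if a = A.spare then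
        (if c = A.spare then 1 - ν ^ 2 * Sm else 0) else 0 : ℝ) : ℂ) := by
    intro a c
    have hn : ∀ z : ℂ, star z * z = ((‖z‖ ^ 2 : ℝ) : ℂ) := fun z => by
      rw [Complex.star_def, ← Complex.normSq_eq_conj_mul_self, Complex.normSq_eq_norm_sq]
    rw [hn]
    congr 1
    rw [IsoData.bond, Matrix.add_apply, Matrix.smul_apply, Matrix.single_apply]
    by_cases ha : a = A.spare
    · by_cases hc : c = A.spare
      · subst ha
        rw [hc, A.Φ_spare k h1 h2]
        simp only [smul_zero, and_self, if_true, zero_add, norm_zero]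
        rw [Complex.norm_real, Real.norm_eq_abs, sq_abs, Real.sq_sqrt hS0]
        ring
      · have hc' : ¬ (A.spare = a ∧ A.spare = c) := fun h => hc h.2.symm
        rw [if_neg hc', if_neg hc]
        simp [mul_pow]
    · have ha' : ¬ (A.spare = a ∧ A.spare = c) := fun h => ha h.1.symm
      rw [if_neg ha', if_neg ha]
      simp [mul_pow]
  simp only [hterm, ← Complex.ofReal_sum]
  rw [← Complex.ofReal_one]
  congr 1
  simp only [Finset.sum_add_distrib, ← Finset.mul_sum, Finset.sum_ite_eq', Finset.mem_univ, if_true,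
    Finset.sum_ite_irrel, Finset.sum_const_zero]
  rw [← hSm]; ring

/-- `L` annihilates the spare component, and Φ cancels the `R` of the left segment against the `L`
of the right one. Only the factor ν is left. -/
lemma IsoData.W_mul_bond_mul_W {j m m' : ℕ} (hm : 1 ≤ m) (hm' : 1 ≤ m') (hN : j + (m + m') ≤ N)
    (ν : ℝ) (s t : ℕ → Fin d) :
    A.W j m s t * A.bond (j + m) ν * A.W (j + m) m' s t = (ν : ℂ) • A.W j (m + m') s t := by
  obtain ⟨m, rfl⟩ : ∃ l, m = l + 1 := ⟨m - 1, by omega⟩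
  set k := j + (m + 1) with hk
  have hspare : ∀ r : ℂ, Matrix.single A.spare A.spare r * A.L k = 0 := by
    intro r
    ext a c
    rw [Matrix.mul_apply]
    refine Finset.sum_eq_zero fun e _ => ?_
    rw [Matrix.single_apply]
    split_ifs with h
    · rw [← h.2, A.L_spare k (by omega) (by omega), mul_zero]
    · rw [zero_mul]
  have hbond : A.bond k ν * A.L k = (ν : ℂ) • (A.Φ k * A.L k) := by
    rw [IsoData.bond, add_mul, hspare, add_zero, Matrix.smul_mul]
  have hundo : seg A.T j (m + 1) s t * ((A.R k)ᵀ * A.Φ k * A.L k) = seg A.T j (m + 1) s t := by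
    rw [seg, mul_assoc]
    congr 1
    exact A.undo (j + m) (by omega) _ _
  calc A.W j (m + 1) s t * A.bond k ν * A.W k m' s t
      = A.L j * seg A.T j (m + 1) s t * (A.R k)ᵀ * (A.bond k ν * A.L k) * seg A.T k m' s t *
          (A.R (k + m'))ᵀ := by simp only [IsoData.W, ← hk, mul_assoc]
    _ = (ν : ℂ) • (A.L j * (seg A.T j (m + 1) s t * ((A.R k)ᵀ * A.Φ k * A.L k)) *
          seg A.T k m' s t * (A.R (k + m'))ᵀ) := by
        rw [hbond]; simp only [mul_assoc, Matrix.mul_smul, Matrix.smul_mul]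
    _ = _ := by
        rw [hundo, IsoData.W, seg_add j (m + 1) m', ← hk, show j + (m + 1 + m') = k + m' by omega]
        simp only [mul_assoc]

/-- `M` is a unitary on the two registers at the cut whose row 0 is the bond state. Requiring these
registers to end in 0 selects that row, that is, contracts the open bonds of the two segments with
the bond state. The intermediate sum over the registers is then the matrix product of
`W_mul_bond_mul_W`, and the amplitudes multiply. -/
lemma IsoData.Encodes.merge {j m m' : ℕ} (hm : 1 ≤ m) (hm' : 1 ≤ m') (hN : j + (m + m') ≤ N)
    {V V' : Matrix (Config (Reg N b) d) (Config (Reg N b) d) ℂ} {α α' : ℝ}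
    (hV : A.Encodes j m V α) (hVl : Loc (block N b j m) V)
    (hV' : A.Encodes (j + m) m' V' α') (hVl' : Loc (block N b (j + m) m') V')
    {ν : ℝ} (hν : 0 ≤ ν) (hq : 0 < q) (hνq : ν ≤ 1 / q) :
    ∃ M ∈ Matrix.unitaryGroup (Config (cutReg N b (j + m)) d) ℂ,
      A.Encodes j (m + m') (emb (cutReg N b (j + m)) M * (V * V')) (α * α' * ν) := by
  set k := j + m with hk
  have hbij := cutCode_bijective (N := N) (b := b) (d := d) (k := k) (by omega)
  obtain ⟨M, hM, hMr⟩ := exists_unitary_row (n := Config (cutReg N b k) d) 0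
    (r := fun u => A.bond k ν (cutCode u true) (cutCode u false)) (by
      rw [← A.sum_bond (k := k) (by omega) (by omega) hν hq hνq]
      rw [← Fintype.sum_prod_type' (f := fun a c => star (A.bond k ν a c) * A.bond k ν a c)]
      exact Fintype.sum_bijective _ hbij _ _ fun u => rfl)
  refine ⟨M, hM, fun x y hx hy => ?_⟩
  have hcut : cutReg N b k ⊆ innerReg N b j (m + m') := cutReg_subset_inner (by omega) (by omega)
  have hcutB : cutReg N b k ⊆ block N b j (m + m') :=
    hcut.trans ((inner_subset_anc _ _).trans (anc_subset_block _ _))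
  have hun := block_union (N := N) (b := b) j m m'
  have hdisj := block_disjoint (N := N) (b := b) j m m'
  rw [← hk] at hun hdisj
  rw [Matrix.mul_apply, sum_eq_sum_glue (cutReg N b k) x _ fun z hz => by
    rw [emb_apply_of_not hz, zero_mul]]
  have hterm : ∀ u, emb (cutReg N b k) M x (glue (cutReg N b k) u x) *
      (V * V') (glue (cutReg N b k) u x) y =
      if ∀ w, w ∉ block N b j (m + m') → x w = y w then
        α * α' * (A.W j m (ph x) (ph y) (rd x j false) (cutCode u true) *
          A.bond k ν (cutCode u true) (cutCode u false) *
          A.W k m' (ph x) (ph y) (cutCode u false) (rd x (k + m') true)) else 0 := by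
    intro u
    set z := glue (cutReg N b k) u x with hz
    have hzx : ∀ w, w ∉ cutReg N b k → z w = x w := fun w hw => glue_notMem u x hw
    have hE : emb (cutReg N b k) M x z = A.bond k ν (cutCode u true) (cutCode u false) := by
      rw [emb_apply_of_agree fun w hw => (hzx w hw).symm, ← hMr]
      congr 1
      · funext w; exact hx w (hcut w.2)
      · funext w; exact glue_mem u x w
    have hrdz : ∀ s, rd z k s = cutCode u s := fun s => rd_congr fun k' c hk' => by
      have hmem : (Sum.inr (k', s, c) : Reg N b) ∈ cutReg N b k := mem_cutReg.2 ⟨_, rfl, hk'⟩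
      rw [hz, glue_mem u x ⟨_, hmem⟩, glue_mem u 0 ⟨_, hmem⟩]
    have hrdx : ∀ l s, l ≠ k → rd z l s = rd x l s := fun l s hl => rd_congr fun k' c hk' => by
      refine hzx _ fun hmem => ?_
      obtain ⟨c', he, hc'⟩ := mem_cutReg.1 hmem
      obtain rfl := Sum.inr.inj he
      exact hl (hk'.symm.trans hc')
    have hphz : ph z = ph x := by
      funext l
      rw [ph, ph]
      split_ifs
      · refine hzx _ fun hmem => ?_
        obtain ⟨c', he, hc'⟩ := mem_cutReg.1 hmem
        cases he
      · rfl
    rw [hE, loc_mul_apply hdisj hVl hVl']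
    set z' : Config (Reg N b) d := fun w => if w ∈ block N b k m' then z w else y w with hz'
    have hz'1 : ∀ w ∈ block N b j m, z' w = y w := fun w hw =>
      if_neg (Finset.disjoint_left.1 hdisj hw)
    have hz'2 : ∀ w ∈ block N b k m', z' w = z w := fun w hw => if_pos hw
    have hz'3 : ∀ w, w ∉ block N b k m' → z' w = y w := fun w hw => if_neg hw
    have hinz : ∀ w ∈ innerReg N b j m, z w = 0 := by
      intro w hw
      rw [mem_inner] at hw
      rw [hzx, hx]
      · rw [mem_inner]
        rcases w with i | ⟨k', s, c⟩
        · exact hw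
        · simp only [IsInner] at hw ⊢; omega
      · intro hmem
        obtain ⟨c', rfl, hc'⟩ := mem_cutReg.1 hmem
        simp only [IsInner] at hw; omega
    have hinz' : ∀ w ∈ innerReg N b k m', z' w = 0 := by
      intro w hw
      rw [hz'2 w (anc_subset_block _ _ (inner_subset_anc _ _ hw))]
      rw [mem_inner] at hw
      rw [hzx, hx]
      · rw [mem_inner]
        rcases w with i | ⟨k', s, c⟩
        · exact hw
        · simp only [IsInner] at hw ⊢; omega
      · intro hmem
        obtain ⟨c', rfl, hc'⟩ := mem_cutReg.1 hmem
        simp only [IsInner] at hw; omega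
    have hancz' : ∀ w ∈ anc N b j m, z' w = 0 := by
      intro w hw
      rw [hz'1 w (anc_subset_block _ _ hw)]
      apply hy
      rw [mem_anc] at hw ⊢
      refine ⟨?_, hw.2⟩
      rw [← mem_block, ← hun]
      exact Finset.mem_union_left _ (mem_block.2 hw.1)
    have hancy : ∀ w ∈ anc N b k m', y w = 0 := by
      intro w hw
      apply hy
      rw [mem_anc] at hw ⊢
      refine ⟨?_, hw.2⟩
      rw [← mem_block, ← hun]
      exact Finset.mem_union_right _ (mem_block.2 hw.1)
    rw [hV z z' hinz hancz', hV' z' y hinz' hancy]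
    have hop' : A.op k m' z' y =
        A.W k m' (ph x) (ph y) (cutCode u false) (rd x (k + m') true) := by
      rw [IsoData.op, Matrix.of_apply, if_pos ⟨hz'3, hinz'⟩]
      rw [A.W_congr (s' := ph x) (t' := ph y) (fun l h1 h2 => by
        rw [ph_eq_of_eq hz'2 h1 h2, hphz]) fun _ _ _ => rfl]
      congr 1
      · rw [← hrdz]
        refine rd_congr fun k' c hk' => hz'2 _ (mem_block.2 ?_)
        simp only [InBlock]; omega
      · rw [← hrdx (k + m') true (by omega)]
        refine rd_congr fun k' c hk' => hz'2 _ (mem_block.2 ?_)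
        simp only [InBlock]; omega
    have hop : A.op j m z z' = if ∀ w, w ∉ block N b j (m + m') → x w = y w then
        A.W j m (ph x) (ph y) (rd x j false) (cutCode u true) else 0 := by
      rw [IsoData.op, Matrix.of_apply]
      have hiff : ((∀ w, w ∉ block N b j m → z w = z' w) ∧ ∀ i ∈ innerReg N b j m, z i = 0) ↔
          ∀ w, w ∉ block N b j (m + m') → x w = y w := by
        rw [and_iff_left hinz]
        constructor
        · intro h w hw
          have hw' := hw
          rw [← hun, Finset.mem_union, not_or] at hw
          rw [← hzx w fun h2 => hw' (hcutB h2), h w hw.1, hz'3 w hw.2]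
        · intro h w hw
          by_cases hw2 : w ∈ block N b k m'
          · exact (hz'2 w hw2).symm
          · have hw3 : w ∉ block N b j (m + m') := by
              rw [← hun, Finset.mem_union, not_or]; exact ⟨hw, hw2⟩
            rw [hz'3 w hw2, hzx w fun h2 => hw3 (hcutB h2), h w hw3]
      simp only [hiff]
      split_ifs
      · rw [A.W_congr (s' := ph x) (t' := ph y) (fun l h1 h2 => by rw [hphz])
          fun l h1 h2 => ph_eq_of_eq hz'1 h1 h2]
        rw [← hk, hrdz, hrdx j false (by omega)]
      · rfl
    rw [hop, hop']
    split_ifs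
    · ring
    · simp
  rw [Finset.sum_congr rfl fun u _ => hterm u]
  rw [IsoData.op, Matrix.of_apply]
  by_cases hxy : ∀ w, w ∉ block N b j (m + m') → x w = y w
  · rw [if_pos ⟨hxy, hx⟩]
    simp only [if_pos hxy]
    rw [← Finset.mul_sum]
    have hW := congrFun (congrFun (A.W_mul_bond_mul_W hm hm' hN ν (ph x) (ph y)) (rd x j false))
      (rd x (j + (m + m')) true)
    have hsum : ∑ u : Config (cutReg N b k) d,
        A.W j m (ph x) (ph y) (rd x j false) (cutCode u true) *
          A.bond k ν (cutCode u true) (cutCode u false) *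
          A.W k m' (ph x) (ph y) (cutCode u false) (rd x (k + m') true) =
        (A.W j m (ph x) (ph y) * A.bond k ν * A.W k m' (ph x) (ph y)) (rd x j false)
          (rd x (k + m') true) := by
      rw [Matrix.mul_apply]
      simp only [Matrix.mul_apply, Finset.sum_mul]
      rw [Finset.sum_comm, ← Fintype.sum_prod_type' (f := fun a c =>
        A.W j m (ph x) (ph y) (rd x j false) a * A.bond k ν a c *
          A.W k m' (ph x) (ph y) c (rd x (k + m') true))]
      exact Fintype.sum_bijective _ hbij _ _ fun u => rfl
    have hkm : k + m' = j + (m + m') := by omega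
    rw [hsum, hkm, hW, Matrix.smul_apply, smul_eq_mul]
    push_cast
    ring
  · rw [if_neg fun h => hxy h.1]
    simp only [if_neg hxy]
    simp

lemma IsoData.Encodes.amplify {j m : ℕ} (hm : 1 ≤ m) (hN : j + m ≤ N)
    {V : Matrix (Config (Reg N b) d) (Config (Reg N b) d) ℂ}
    (hU : V ∈ Matrix.unitaryGroup (Config (Reg N b) d) ℂ) {θ : ℝ}
    (hV : A.Encodes j m V (Real.sin θ)) (t : ℕ) :
    A.Encodes j m (ampRound V (proj0 d (anc N b j m)) (proj0 d (innerReg N b j m)) ^ t * V)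
      (Real.sin ((2 * t + 1) * θ)) := by
  rw [encodes_iff] at hV ⊢
  exact amplification hU (proj0_mul_self _) (proj0_conjTranspose _) (proj0_mul_self _)
    (proj0_conjTranspose _) (A.op_isometry hm hN) hV t

/-- A circuit of depth `t` contains the isometry of a segment with amplitude `α`. -/
def IsoData.Built (j m t : ℕ) (α : ℝ) : Prop :=
  ∃ V, Reach (block N b j m) t V ∧ A.Encodes j m V α

lemma synthDepth_mono {ℓ ℓ' : ℕ} (h : ℓ ≤ ℓ') : synthDepth d ℓ ≤ synthDepth d ℓ' := by
  have h1 : d ^ ℓ ≤ d ^ ℓ' := Nat.pow_le_pow_right (Nat.pos_of_ne_zero (NeZero.ne d)) h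
  unfold synthDepth
  gcongr

variable {A}

lemma IsoData.Built.merge (hd : 1 < d) (hb : 1 ≤ b) {j m m' t : ℕ} (hm : 1 ≤ m) (hm' : 1 ≤ m')
    (hN : j + (m + m') ≤ N) {α α' : ℝ} (h : A.Built j m t α) (h' : A.Built (j + m) m' t α')
    {ν : ℝ} (hν : 0 ≤ ν) (hq : 0 < q) (hνq : ν ≤ 1 / q) :
    A.Built j (m + m') (t + synthDepth d (2 * b)) (α * α' * ν) := by
  obtain ⟨V, hV, hVe⟩ := h
  obtain ⟨V', hV', hVe'⟩ := h'
  obtain ⟨M, hM, hMe⟩ := IsoData.Encodes.merge A hm hm' hN hVe hV.loc hVe' hV'.loc hν hq hνq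
  refine ⟨_, ?_, hMe⟩
  have hcut : cutReg N b (j + m) ⊆ block N b j (m + m') :=
    (cutReg_subset_inner (by omega) (by omega)).trans
      ((inner_subset_anc _ _).trans (anc_subset_block _ _))
  have hne : (cutReg N b (j + m)).Nonempty :=
    ⟨Sum.inr (⟨j + m, by omega⟩, true, ⟨0, hb⟩), mem_cutReg.2 ⟨_, rfl, rfl⟩⟩
  rw [add_comm t]
  refine ((reach_emb hd hne hM).mono hcut (synthDepth_mono (card_cutReg_le _))).mul ?_
  rw [← block_union]
  exact hV.parallel hV' (block_disjoint _ _ _)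

/-- Each of the `r` rounds uses `V` and its adjoint once, and one more `V` is applied at the start.
The reflections act on at most `2 b m` qudits with 8 layers per qudit; the second one appears with
the opposite sign, which is corrected by one gate. Together they cost at most `32 b m + 3` layers
per round. -/
lemma IsoData.Built.amplify (hd : 1 < d) {j m t : ℕ} (hm : 1 ≤ m) (hN : j + m ≤ N) {θ : ℝ}
    (h : A.Built j m t (Real.sin θ)) (r : ℕ) :
    A.Built j m ((2 * r + 1) * (t + (32 * b * m + 3))) (Real.sin ((2 * r + 1) * θ)) := by
  obtain ⟨V, hV, hVe⟩ := h
  refine ⟨_, ?_, hVe.amplify A hm hN hV.mem_unitaryGroup r⟩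
  have hsite : (Sum.inl ⟨j, by omega⟩ : Reg N b) ∈ block N b j m :=
    mem_block.2 ⟨le_rfl, by simp only; omega⟩
  have hanc := card_anc_le (N := N) (b := b) j m
  have hin := Finset.card_le_card (inner_subset_anc (N := N) (b := b) j m)
  have hnot : ∀ S : Finset (Reg N b), S ⊆ anc N b j m → (Sum.inl ⟨j, by omega⟩ : Reg N b) ∉ S := by
    intro S hS hmem
    obtain ⟨-, c, hc⟩ := mem_anc.1 (hS hmem)
    cases hc
  have h0 := reach_reflection hd hsite (anc_subset_block (N := N) (b := b) j m)
    (hnot _ subset_rfl)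
  have h1 := reach_reflection hd hsite
    ((inner_subset_anc (N := N) (b := b) j m).trans (anc_subset_block j m))
    (hnot _ (inner_subset_anc j m))
  have h1' := (reach_neg_one (κ := Reg N b) (d := d) hsite).mul h1
  have hround : Reach (block N b j m) (2 * (t + (32 * b * m + 3)))
      (ampRound V (proj0 d (anc N b j m)) (proj0 d (innerReg N b j m))) := by
    have := ((hV.mul h0).mul hV.conjTranspose).mul h1'
    have hE : ampRound V (proj0 d (anc N b j m)) (proj0 d (innerReg N b j m)) =
        V * (1 - 2 * proj0 d (anc N b j m)) * Vᴴ *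
          (-1 * (1 - 2 * proj0 d (innerReg N b j m))) := by
      rw [ampRound, neg_one_mul, neg_sub]
    rw [hE]
    refine this.mono subset_rfl ?_
    have : 32 * b * m = 16 * (2 * b * m) := by ring
    omega
  have hpow : ∀ r : ℕ, Reach (block N b j m) (r * (2 * (t + (32 * b * m + 3))))
      (ampRound V (proj0 d (anc N b j m)) (proj0 d (innerReg N b j m)) ^ r) := by
    intro r
    induction r with
    | zero => simpa using reach_one (block N b j m)
    | succ r ih =>
      rw [pow_succ, Nat.succ_mul]
      exact ih.mul hround
  refine ((hpow r).mul hV).mono subset_rfl ?_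
  have : (2 * r + 1) * (t + (32 * b * m + 3)) =
    r * (2 * (t + (32 * b * m + 3))) + (t + (32 * b * m + 3)) := by ring
  omega

/-- On inputs with all bond qudits 0, the columns of `op` are orthonormal and supported in the
block. They are completed to a unitary on the block, which is compiled directly; the cost is
acceptable as this serves only blocks of bounded length. -/
lemma IsoData.built_leaf (hd : 1 < d) {j m : ℕ} (hm : 1 ≤ m) (hN : j + m ≤ N) :
    A.Built j m (synthDepth d ((2 * b + 1) * m)) 1 := by
  classical
  set B := block N b j m with hB
  let up : Config B d → Config (Reg N b) d := fun u => glue B u 0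
  have hopup : ∀ x y : Config (Reg N b) d, (∀ w, w ∉ B → x w = y w) →
      A.op j m (up fun w => x w) (up fun w => y w) = A.op j m x y := by
    intro x y hxy
    have hup : ∀ x : Config (Reg N b) d, ∀ w ∈ B, up (fun w => x w) w = x w :=
      fun x w hw => glue_mem _ _ ⟨w, hw⟩
    have hinB : innerReg N b j m ⊆ B := (inner_subset_anc _ _).trans (anc_subset_block _ _)
    rw [IsoData.op, Matrix.of_apply, Matrix.of_apply]
    have h1 : (∀ w, w ∉ B → up (fun w => x w) w = up (fun w => y w) w) := fun w hw => by
      simp only [up]; rw [glue_notMem _ _ hw, glue_notMem _ _ hw]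
    have h2 : (∀ i ∈ innerReg N b j m, up (fun w => x w) i = 0) ↔ ∀ i ∈ innerReg N b j m, x i = 0 :=
      forall₂_congr fun i hi => by rw [hup x i (hinB hi)]
    have hc : ((∀ w, w ∉ B → up (fun w => x w) w = up (fun w => y w) w) ∧
        ∀ i ∈ innerReg N b j m, up (fun w => x w) i = 0) ↔
        ((∀ w, w ∉ B → x w = y w) ∧ ∀ i ∈ innerReg N b j m, x i = 0) := by
      rw [h2]; exact and_congr_left fun _ => iff_of_true h1 hxy
    rw [if_congr hc rfl rfl]
    refine if_congr Iff.rfl ?_ rfl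
    rw [A.W_congr (fun l h1 h2 => ph_eq_of_eq (hup x) h1 h2)
      fun l h1 h2 => ph_eq_of_eq (hup y) h1 h2]
    congr 1
    · refine rd_congr fun k' c hk' => hup x _ (mem_block.2 ?_)
      simp only [InBlock]; omega
    · refine rd_congr fun k' c hk' => hup x _ (mem_block.2 ?_)
      simp only [InBlock]; omega
  obtain ⟨M, hM, hMc⟩ := exists_unitary_columns (n := Config B d)
    {y | ∀ i ∈ anc N b j m, up y i = 0} (fun y x => A.op j m (up x) (up y)) (by
      intro y' hy' y hy
      have h := congrFun (congrFun (A.op_isometry hm hN) (up y')) (up y)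
      rw [mul_assoc (proj0 d (anc N b j m))] at h
      rw [proj0, Matrix.mul_diagonal, Matrix.diagonal_mul, Matrix.mul_apply,
        Matrix.diagonal_apply] at h
      have hy2 : ∀ i ∈ anc N b j m, up y i = 0 := hy
      have hy2' : ∀ i ∈ anc N b j m, up y' i = 0 := hy'
      rw [if_pos hy2, if_pos hy2', one_mul, mul_one] at h
      rw [sum_eq_sum_glue B 0] at h
      · simp only [Matrix.conjTranspose_apply] at h
        refine h.trans (if_congr (glue_injective B 0).eq_iff rfl rfl)
      · intro x hx
        have : A.op j m x (up y) = 0 := if_neg fun h => hx fun w hw => by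
          rw [h.1 w hw]; exact (glue_notMem _ _ hw).symm
        rw [this, mul_zero])
  have hne : B.Nonempty := ⟨Sum.inl ⟨j, by omega⟩, mem_block.2 ⟨le_rfl, by simp only; omega⟩⟩
  refine ⟨emb B M, (reach_emb hd hne hM).mono subset_rfl (synthDepth_mono (card_block_le j m)), ?_⟩
  intro x y hx hy
  rw [Complex.ofReal_one, one_mul]
  by_cases hxy : ∀ w, w ∉ B → x w = y w
  · rw [emb_apply_of_agree hxy, hMc]
    · exact hopup x y hxy
    · intro i hi
      have hiB : i ∈ B := anc_subset_block _ _ hi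
      exact (glue_mem (fun w : B => y w) 0 ⟨i, hiB⟩).trans (hy i hi)
  · rw [emb_apply_of_not hxy]
    exact (if_neg fun h => hxy h.1).symm

/-- The overhead of merging blocks. -/
def overhead (d b : ℕ) : ℕ := 2 * synthDepth d (2 * b) + 1024 * b + 6

/-- The block is halved twice, and its quarters have lengths in the range of the hypothesis. The
lower merge gives amplitude sin θ1, amplified to `s = sin((2 t1 + 1) θ1)`; the upper one gives `s² ν
= sin θ2`, amplified to 1. The two halves run in parallel, so only the uses of amplification
multiply the depth. -/
lemma IsoData.built_four (hd : 1 < d) (hb : 1 ≤ b) (hq : 2 ≤ q) {t1 t2 : ℕ} {θ1 θ2 ν : ℝ}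
    (h1 : 0 ≤ Real.sin θ1) (h2 : Real.sin θ1 ≤ 1 / q) (h3 : 0 ≤ ν) (h4 : ν ≤ 1 / q)
    (h5 : Real.sin ((2 * t1 + 1) * θ1) ^ 2 * ν = Real.sin θ2)
    (h6 : Real.sin ((2 * t2 + 1) * θ2) = 1) {K j m t : ℕ}
    (hm1 : 4 ^ (K + 1) ≤ m) (hm2 : m ≤ 4 ^ (K + 2)) (hN : j + m ≤ N)
    (ih : ∀ j m, 4 ^ K ≤ m → m ≤ 4 ^ (K + 1) → j + m ≤ N → A.Built j m t 1) :
    A.Built j m ((2 * t1 + 1) * (2 * t2 + 1) * (t + overhead d b * 4 ^ K)) 1 := by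
  have hq0 : 0 < q := by linarith
  have hp : 0 < 4 ^ K := by positivity
  have e1 : 4 ^ (K + 1) = 4 * 4 ^ K := by ring
  have e2 : 4 ^ (K + 2) = 16 * 4 ^ K := by ring
  set s := synthDepth d (2 * b) with hs
  set o := 32 * b * m + 3 with ho
  have two : ∀ j l, 2 * 4 ^ K ≤ l → l ≤ 8 * 4 ^ K → l ≤ m → j + l ≤ N →
      A.Built j l ((2 * t1 + 1) * (t + s + o)) (Real.sin ((2 * t1 + 1) * θ1)) := by
    intro j l hl1 hl2 hlm hlN
    obtain ⟨l1, l2, rfl, ha, hb', hc, he⟩ : ∃ l1 l2, l = l1 + l2 ∧ 4 ^ K ≤ l1 ∧ 4 ^ K ≤ l2 ∧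
        l1 ≤ 4 * 4 ^ K ∧ l2 ≤ 4 * 4 ^ K :=
      ⟨l / 2, l - l / 2, by omega, by omega, by omega, by omega, by omega⟩
    have hmerge := (ih j l1 ha (by omega) (by omega)).merge hd hb (by omega) (by omega) (by omega)
      (ih (j + l1) l2 hb' (by omega) (by omega)) h1 hq0 h2
    rw [one_mul, one_mul] at hmerge
    obtain ⟨V, hV, hVe⟩ := hmerge.amplify hd (by omega) (by omega) t1
    refine ⟨V, hV.mono subset_rfl ?_, hVe⟩
    have : 32 * b * (l1 + l2) ≤ 32 * b * m := Nat.mul_le_mul_left _ hlm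
    gcongr
    omega
  obtain ⟨l1, l2, hl, ha, hb', hc, he⟩ : ∃ l1 l2, m = l1 + l2 ∧ 2 * 4 ^ K ≤ l1 ∧ 2 * 4 ^ K ≤ l2 ∧
      l1 ≤ 8 * 4 ^ K ∧ l2 ≤ 8 * 4 ^ K :=
    ⟨m / 2, m - m / 2, by omega, by omega, by omega, by omega, by omega⟩
  have hmerge := (two j l1 ha hc (by omega) (by omega)).merge hd hb (by omega) (by omega) (by omega)
    (two (j + l1) l2 hb' he (by omega) (by omega)) h3 hq0 h4
  rw [← sq, h5, ← hl] at hmerge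
  obtain ⟨V, hV, hVe⟩ := hmerge.amplify hd (by omega) (by omega) t2
  rw [h6] at hVe
  refine ⟨V, hV.mono subset_rfl ?_, hVe⟩
  rw [← hs, ← ho]
  have ho' : 2 * s + 2 * o ≤ overhead d b * 4 ^ K := by
    have hbm : b * m ≤ b * (16 * 4 ^ K) := Nat.mul_le_mul_left _ (by omega)
    have hs' : s ≤ s * 4 ^ K := Nat.le_mul_of_pos_right _ hp
    have e3 : overhead d b * 4 ^ K = 2 * (s * 4 ^ K) + 64 * (b * (16 * 4 ^ K)) + 6 * 4 ^ K := by
      rw [overhead]; ring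
    have e4 : o = 32 * (b * m) + 3 := by rw [ho]; ring
    omega
  calc (2 * t2 + 1) * ((2 * t1 + 1) * (t + s + o) + s + o)
      ≤ (2 * t2 + 1) * ((2 * t1 + 1) * (t + s + o) + (2 * t1 + 1) * (s + o)) := by
        have : s + o ≤ (2 * t1 + 1) * (s + o) := Nat.le_mul_of_pos_left _ (by omega)
        exact Nat.mul_le_mul_left _ (by linarith)
    _ = (2 * t1 + 1) * (2 * t2 + 1) * (t + (2 * s + 2 * o)) := by ring
    _ ≤ _ := by gcongr

/-- The circuit obtained by merging blocks recursively. -/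
theorem IsoData.exists_built (hd : 1 < d) (hb : 1 ≤ b) (hq : 2 ≤ q) :
    ∃ r : ℕ, (r : ℝ) ≤ 4 * q ^ 2 ∧ ∀ K j m, 4 ^ K ≤ m → m ≤ 4 ^ (K + 1) → j + m ≤ N →
      A.Built j m (r ^ K * (synthDepth d ((2 * b + 1) * 4) + 2 * overhead d b)) 1 := by
  obtain ⟨t1, t2, θ1, θ2, ν, h1, h2, h3, h4, h5, h6, h7, h8⟩ := exists_rounds hq
  refine ⟨(2 * t1 + 1) * (2 * t2 + 1), h8, ?_⟩
  set r := (2 * t1 + 1) * (2 * t2 + 1) with hr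
  set T0 := synthDepth d ((2 * b + 1) * 4)
  set e := overhead d b
  -- The slack `2 e 4^K` strengthens the induction. Passing to `K + 1` it becomes `8 e 4^K`, which
  -- is at most `r e 4^K`; this is where `8 ≤ r` is needed.
  have key : ∀ K, ∃ t, t + 2 * e * 4 ^ K ≤ r ^ K * (T0 + 2 * e) ∧ ∀ j m, 4 ^ K ≤ m →
      m ≤ 4 ^ (K + 1) → j + m ≤ N → A.Built j m t 1 := by
    intro K
    induction K with
    | zero =>
      refine ⟨T0, by simp, fun j m hm1 hm2 hN => ?_⟩
      obtain ⟨V, hV, hVe⟩ := A.built_leaf hd (by simpa using hm1) hN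
      refine ⟨V, hV.mono subset_rfl (synthDepth_mono ?_), hVe⟩
      exact Nat.mul_le_mul_left _ (by simpa using hm2)
    | succ K ih =>
      obtain ⟨t, ht, hB⟩ := ih
      refine ⟨r * (t + e * 4 ^ K), ?_, fun j m hm1 hm2 hN =>
        IsoData.built_four hd hb hq h1 h2 h3 h4 h5 h6 hm1 hm2 hN hB⟩
      have h8 : 8 * (e * 4 ^ K) ≤ r * (e * 4 ^ K) := Nat.mul_le_mul_right _ h7
      calc r * (t + e * 4 ^ K) + 2 * e * 4 ^ (K + 1)
          = r * (t + e * 4 ^ K) + 8 * (e * 4 ^ K) := by ring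
        _ ≤ r * (t + e * 4 ^ K) + r * (e * 4 ^ K) := by omega
        _ = r * (t + 2 * e * 4 ^ K) := by ring
        _ ≤ r * (r ^ K * (T0 + 2 * e)) := Nat.mul_le_mul_left _ ht
        _ = _ := by ring
  intro K j m hm1 hm2 hN
  obtain ⟨t, ht, hB⟩ := key K
  obtain ⟨V, hV, hVe⟩ := hB j m hm1 hm2 hN
  exact ⟨V, hV.mono subset_rfl (le_trans (Nat.le_add_right _ _) ht), hVe⟩

end Merge

/-! ### Segments of a matrix-product unitary -/

section Abstract
variable {α β γ D D' : Type} [Fintype α] [Fintype β] [Fintype γ] [Fintype D] [Fintype D']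
  [DecidableEq α] [DecidableEq β] [DecidableEq γ]

lemma sum_star_mul_eq_trace {m n : Type} [Fintype m] [Fintype n] (M M' : Matrix m n ℂ) :
    ∑ a, ∑ c, star (M' a c) * M a c = (M'ᴴ * M).trace := by
  rw [Finset.sum_comm]
  simp [Matrix.trace, Matrix.mul_apply]

lemma trace_sandwich (S S' : Matrix D D' ℂ) (x x' : D → ℂ) (y y' : D' → ℂ) :
    (S'ᴴ * Matrix.vecMulVec (star x') x * S * Matrix.vecMulVec y (star y')).trace =
      star (x' ⬝ᵥ S' *ᵥ y') * (x ⬝ᵥ S *ᵥ y) := by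
  rw [Matrix.mul_vecMulVec, Matrix.trace_vecMulVec, ← Matrix.mulVec_mulVec, ← Matrix.mulVec_mulVec,
    Matrix.vecMulVec_mulVec, op_smul_eq_smul, Matrix.mulVec_smul, smul_dotProduct, smul_eq_mul,
    mul_comm, dotProduct_comm (S'ᴴ *ᵥ star x'), Matrix.dotProduct_mulVec, ← Matrix.star_mulVec,
    ← Matrix.star_dotProduct_star, dotProduct_comm]

/-- A piece of a unitary, with densities attached to both sides, is an isometry. -/
lemma isometry_of_unitary (x : α → α → D → ℂ) (S : β → β → Matrix D D' ℂ) (y : γ → γ → D' → ℂ)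
    (hU : ∀ t1' t1 t2' t2 t3' t3, ∑ s1, ∑ s2, ∑ s3,
      star (x s1 t1' ⬝ᵥ S s2 t2' *ᵥ y s3 t3') * (x s1 t1 ⬝ᵥ S s2 t2 *ᵥ y s3 t3) =
        if t1' = t1 ∧ t2' = t2 ∧ t3' = t3 then 1 else 0)
    (L : Matrix D D ℂ) (R : Matrix D' D' ℂ) (σ : Matrix α α ℂ) (τ : Matrix γ γ ℂ)
    (hσ : σ.trace = 1) (hτ : τ.trace = 1)
    (hL : Lᴴ * L = ∑ t1, ∑ t1', ∑ s1, σ t1 t1' • Matrix.vecMulVec (star (x s1 t1')) (x s1 t1))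
    (hR : Rᴴ * R = ∑ t3, ∑ t3', ∑ s3, τ t3 t3' • Matrix.vecMulVec (star (y s3 t3')) (y s3 t3))
    (t2' t2 : β) :
    ∑ s2, ∑ a, ∑ c, star ((L * S s2 t2' * Rᵀ) a c) * (L * S s2 t2 * Rᵀ) a c =
      if t2' = t2 then 1 else 0 := by
  have hRT : Rᵀ * Rᵀᴴ = ∑ t3, ∑ t3', ∑ s3,
      τ t3 t3' • Matrix.vecMulVec (y s3 t3) (star (y s3 t3')) := by
    have : Rᵀ * Rᵀᴴ = (Rᴴ * R)ᵀ := by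
      rw [Matrix.transpose_mul]; rfl
    rw [this, hR]
    simp only [Matrix.transpose_sum, Matrix.transpose_smul, Matrix.transpose_vecMulVec]
  have h1 : ∀ s2, ∑ a, ∑ c, star ((L * S s2 t2' * Rᵀ) a c) * (L * S s2 t2 * Rᵀ) a c =
      ∑ t3, ∑ t3', ∑ t1, ∑ t1', ∑ s1, ∑ s3, σ t1 t1' * τ t3 t3' *
        (star (x s1 t1' ⬝ᵥ S s2 t2' *ᵥ y s3 t3') * (x s1 t1 ⬝ᵥ S s2 t2 *ᵥ y s3 t3)) := by
    intro s2
    rw [sum_star_mul_eq_trace]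
    have : ((L * S s2 t2' * Rᵀ)ᴴ * (L * S s2 t2 * Rᵀ)).trace =
        ((S s2 t2')ᴴ * (Lᴴ * L) * S s2 t2 * (Rᵀ * Rᵀᴴ)).trace := by
      rw [Matrix.conjTranspose_mul, Matrix.conjTranspose_mul, Matrix.mul_assoc, Matrix.trace_mul_comm]
      simp only [Matrix.mul_assoc]
    rw [this, hRT, Matrix.mul_sum, Matrix.trace_sum]
    refine Finset.sum_congr rfl fun t3 _ => ?_
    rw [Matrix.mul_sum, Matrix.trace_sum]
    refine Finset.sum_congr rfl fun t3' _ => ?_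
    rw [hL]
    simp only [Matrix.mul_sum, Matrix.sum_mul, Matrix.trace_sum, Matrix.smul_mul, Matrix.mul_smul,
      Matrix.trace_smul, trace_sandwich, smul_eq_mul]
    have h (f : γ → α → α → α → ℂ) : ∑ s3, ∑ t1, ∑ t1', ∑ s1, f s3 t1 t1' s1 =
        ∑ t1, ∑ t1', ∑ s1, ∑ s3, f s3 t1 t1' s1 := by
      rw [Finset.sum_comm]
      refine Finset.sum_congr rfl fun _ _ => ?_
      rw [Finset.sum_comm]
      refine Finset.sum_congr rfl fun _ _ => ?_
      rw [Finset.sum_comm]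
    simp only [Finset.mul_sum]
    rw [h]
    refine Finset.sum_congr rfl fun _ _ => Finset.sum_congr rfl fun _ _ =>
      Finset.sum_congr rfl fun _ _ => Finset.sum_congr rfl fun _ _ => by ring
  -- With the sums over all outputs taken innermost, they form an inner product of two columns of
  -- the unitary. Orthonormality identifies the inputs on both sides, and the outer inputs are left
  -- with tr σ · tr τ = 1.
  calc _ = ∑ t3, ∑ t3', ∑ t1, ∑ t1', σ t1 t1' * τ t3 t3' * ∑ s1, ∑ s2, ∑ s3,
        (star (x s1 t1' ⬝ᵥ S s2 t2' *ᵥ y s3 t3') * (x s1 t1 ⬝ᵥ S s2 t2 *ᵥ y s3 t3)) := by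
        simp only [h1]
        rw [Finset.sum_comm]
        refine Finset.sum_congr rfl fun _ _ => ?_
        rw [Finset.sum_comm]
        refine Finset.sum_congr rfl fun _ _ => ?_
        rw [Finset.sum_comm]
        refine Finset.sum_congr rfl fun _ _ => ?_
        rw [Finset.sum_comm]
        refine Finset.sum_congr rfl fun _ _ => ?_
        rw [Finset.sum_comm, Finset.mul_sum]
        refine Finset.sum_congr rfl fun _ _ => ?_
        rw [Finset.mul_sum]
        refine Finset.sum_congr rfl fun _ _ => ?_
        rw [Finset.mul_sum]
    _ = ∑ t3, ∑ t3', ∑ t1, ∑ t1', if t1' = t1 then (if t3' = t3 then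
          (σ t1 t1' * τ t3 t3' * if t2' = t2 then 1 else 0) else 0) else 0 := by
        simp only [hU]
        refine Finset.sum_congr rfl fun t3 _ => Finset.sum_congr rfl fun t3' _ =>
          Finset.sum_congr rfl fun t1 _ => Finset.sum_congr rfl fun t1' _ => ?_
        by_cases h1 : t1' = t1 <;> by_cases h3 : t3' = t3 <;> simp [h1, h3]
    _ = ∑ t3, ∑ t1, (σ t1 t1 * τ t3 t3 * if t2' = t2 then 1 else 0) := by
        refine Finset.sum_congr rfl fun t3 _ => ?_
        rw [Finset.sum_comm]
        refine Finset.sum_congr rfl fun t1 _ => ?_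
        rw [Finset.sum_comm]
        simp
    _ = σ.trace * τ.trace * if t2' = t2 then 1 else 0 := by
        rw [Matrix.trace, Matrix.trace, Finset.sum_mul_sum, Finset.sum_mul, Finset.sum_comm]
        refine Finset.sum_congr rfl fun _ _ => ?_
        rw [Finset.sum_mul]
        rfl
    _ = _ := by rw [hσ, hτ]; simp

end Abstract

/-! ### Zero padding -/

section Pad
variable {n p q r : ℕ}

/-- A matrix, padded by zeros. -/
def pad (n : ℕ) (M : Matrix (Fin p) (Fin q) ℂ) : Matrix (Fin n) (Fin n) ℂ :=
  Matrix.of fun a c => if h : (a : ℕ) < p ∧ (c : ℕ) < q then M ⟨a, h.1⟩ ⟨c, h.2⟩ else 0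

lemma pad_apply (M : Matrix (Fin p) (Fin q) ℂ) (a c : Fin n) :
    pad n M a c = if h : (a : ℕ) < p ∧ (c : ℕ) < q then M ⟨a, h.1⟩ ⟨c, h.2⟩ else 0 := rfl

lemma sum_dite_lt (hq : q ≤ n) (f : Fin q → ℂ) :
    ∑ c : Fin n, (if h : (c : ℕ) < q then f ⟨c, h⟩ else 0) = ∑ c, f c := by
  symm
  refine Fintype.sum_of_injective (Fin.castLE hq) (Fin.castLE_injective hq) _ _ ?_ ?_
  · intro c hc
    rw [dif_neg]
    exact fun h => hc ⟨⟨c, h⟩, rfl⟩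
  · intro c
    rw [dif_pos (by simp)]
    rfl

lemma pad_mul (hq : q ≤ n) (M : Matrix (Fin p) (Fin q) ℂ) (M' : Matrix (Fin q) (Fin r) ℂ) :
    pad n (M * M') = pad n M * pad n M' := by
  ext a c
  rw [Matrix.mul_apply, pad_apply]
  split_ifs with h
  · rw [Matrix.mul_apply, ← sum_dite_lt hq]
    refine Finset.sum_congr rfl fun i _ => ?_
    rw [pad_apply, pad_apply]
    by_cases hi : (i : ℕ) < q
    · rw [dif_pos hi, dif_pos ⟨h.1, hi⟩, dif_pos ⟨hi, h.2⟩]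
    · rw [dif_neg hi, dif_neg (fun h => hi h.2), zero_mul]
  · symm
    refine Finset.sum_eq_zero fun i _ => ?_
    rw [pad_apply, pad_apply]
    by_cases ha : (a : ℕ) < p
    · rw [dif_neg (c := (i : ℕ) < q ∧ (c : ℕ) < r) (fun h' => h ⟨ha, h'.2⟩), mul_zero]
    · rw [dif_neg (fun h' => ha h'.1), zero_mul]

lemma pad_transpose (M : Matrix (Fin p) (Fin q) ℂ) : pad n Mᵀ = (pad n M)ᵀ := by
  ext a c
  rw [Matrix.transpose_apply, pad_apply, pad_apply]
  by_cases h : (a : ℕ) < q ∧ (c : ℕ) < p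
  · rw [dif_pos h, dif_pos h.symm]; rfl
  · rw [dif_neg h, dif_neg fun h' => h h'.symm]

lemma pad_conjTranspose (M : Matrix (Fin p) (Fin q) ℂ) : pad n Mᴴ = (pad n M)ᴴ := by
  ext a c
  rw [Matrix.conjTranspose_apply, pad_apply, pad_apply]
  by_cases h : (a : ℕ) < q ∧ (c : ℕ) < p
  · rw [dif_pos h, dif_pos h.symm]; rfl
  · rw [dif_neg h, dif_neg (fun h' => h h'.symm), star_zero]

lemma sum_sum_pad (hp : p ≤ n) (hq : q ≤ n) (M : Matrix (Fin p) (Fin q) ℂ) :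
    ∑ a, ∑ c, ‖pad n M a c‖ ^ 2 = ∑ a, ∑ c, ‖M a c‖ ^ 2 := by
  symm
  refine Fintype.sum_of_injective (Fin.castLE hp) (Fin.castLE_injective hp) _ _ ?_ ?_
  · intro a ha
    refine Finset.sum_eq_zero fun c _ => ?_
    rw [pad_apply, dif_neg, norm_zero, zero_pow two_ne_zero]
    exact fun h => ha ⟨⟨a, h.1⟩, rfl⟩
  · intro a
    refine Fintype.sum_of_injective (Fin.castLE hq) (Fin.castLE_injective hq) _ _ ?_ ?_
    · intro c hc
      rw [pad_apply, dif_neg, norm_zero, zero_pow two_ne_zero]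
      exact fun h => hc ⟨⟨c, h.2⟩, rfl⟩
    · intro c
      rw [pad_apply, dif_pos ⟨by simp, by simp⟩]
      rfl

end Pad

/-! ### Three consecutive segments -/

section Split
variable {d n : ℕ} [NeZero d] {T : ℕ → Fin d → Fin d → Matrix (Fin n) (Fin n) ℂ}

lemma put_apply {j m : ℕ} (s : Fin m → Fin d) {l : ℕ} (h1 : j ≤ l) (h2 : l < j + m) :
    put j s l = s ⟨l - j, by omega⟩ := dif_pos ⟨h1, h2⟩

lemma put_append_left {j m r : ℕ} (s : Fin m → Fin d) (s' : Fin r → Fin d) {l : ℕ} (h1 : j ≤ l)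
    (h2 : l < j + m) : put j (Fin.append s s') l = put j s l := by
  rw [put_apply _ h1 (by omega), put_apply _ h1 h2]
  exact Fin.append_left s s' ⟨l - j, by omega⟩

lemma put_append_right {j m r : ℕ} (s : Fin m → Fin d) (s' : Fin r → Fin d) {l : ℕ}
    (h1 : j + m ≤ l) (h2 : l < j + m + r) : put j (Fin.append s s') l = put (j + m) s' l := by
  rw [put_apply _ (by omega) (by omega), put_apply _ h1 h2, ← Fin.append_right s s']
  congr 1
  exact Fin.ext (by simp; omega)

lemma put_castSucc {j m : ℕ} (s : Fin (m + 1) → Fin d) {l : ℕ} (h1 : j ≤ l) (h2 : l < j + m) :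
    put j (fun i : Fin m => s i.castSucc) l = put j s l := by
  rw [put_apply _ h1 (by omega), put_apply _ h1 (by omega)]
  rfl

lemma put_last {j m : ℕ} (s : Fin (m + 1) → Fin d) : put j s (j + m) = s (Fin.last m) := by
  rw [put_apply _ (by omega) (by omega)]
  congr 1
  exact Fin.ext (by simp)

lemma seg_append (j m r : ℕ) (s1 t1 : Fin j → Fin d) (s2 t2 : Fin m → Fin d)
    (s3 t3 : Fin r → Fin d) (o : Fin n) :
    seg T 0 (j + m + r) (put 0 (Fin.append (Fin.append s1 s2) s3))
        (put 0 (Fin.append (Fin.append t1 t2) t3)) o o =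
      (fun a => seg T 0 j (put 0 s1) (put 0 t1) o a) ⬝ᵥ seg T j m (put j s2) (put j t2) *ᵥ
        (fun a => seg T (j + m) r (put (j + m) s3) (put (j + m) t3) a o) := by
  have h1 : ∀ (s1 : Fin j → Fin d) (s2 : Fin m → Fin d) (s3 : Fin r → Fin d) (l : ℕ), l < j →
      put 0 (Fin.append (Fin.append s1 s2) s3) l = put 0 s1 l := fun s1 s2 s3 l hl => by
    rw [put_append_left _ _ (by omega) (by omega), put_append_left _ _ (by omega) (by omega)]
  have h2 : ∀ (s1 : Fin j → Fin d) (s2 : Fin m → Fin d) (s3 : Fin r → Fin d) (l : ℕ), j ≤ l →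
      l < j + m → put 0 (Fin.append (Fin.append s1 s2) s3) l = put j s2 l :=
    fun s1 s2 s3 l hl hl' => by
      rw [put_append_left _ _ (by omega) (by omega), put_append_right _ _ (by omega) (by omega),
        zero_add]
  have h3 : ∀ (s1 : Fin j → Fin d) (s2 : Fin m → Fin d) (s3 : Fin r → Fin d) (l : ℕ), j + m ≤ l →
      l < j + m + r → put 0 (Fin.append (Fin.append s1 s2) s3) l = put (j + m) s3 l :=
    fun s1 s2 s3 l hl hl' => by
      rw [put_append_right _ _ (by omega) (by omega), zero_add]
  rw [seg_add, seg_add, zero_add, zero_add,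
    seg_congr (j := 0) (m := j) (fun l _ hl => h1 s1 s2 s3 l (by omega))
      (fun l _ hl => h1 t1 t2 t3 l (by omega)),
    seg_congr (j := j) (m := m) (fun l hl hl' => h2 s1 s2 s3 l hl hl')
      (fun l hl hl' => h2 t1 t2 t3 l hl hl'),
    seg_congr (j := j + m) (m := r) (fun l hl hl' => h3 s1 s2 s3 l hl hl')
      (fun l hl hl' => h3 t1 t2 t3 l hl hl'), Matrix.mul_assoc, Matrix.mul_apply]
  rfl

/-- Orthonormality of the columns, with inputs and outputs split into the left part, the segment and
the right part, as `isometry_of_unitary` takes it. -/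
lemma orthonormal_split {o : Fin n} (j m r : ℕ)
    (hU : ∀ t' t : Fin (j + m + r) → Fin d, ∑ s : Fin (j + m + r) → Fin d,
      star (seg T 0 (j + m + r) (put 0 s) (put 0 t') o o) *
        seg T 0 (j + m + r) (put 0 s) (put 0 t) o o = if t' = t then 1 else 0)
    (t1' t1 : Fin j → Fin d) (t2' t2 : Fin m → Fin d) (t3' t3 : Fin r → Fin d) :
    ∑ s1 : Fin j → Fin d, ∑ s2 : Fin m → Fin d, ∑ s3 : Fin r → Fin d,
      star ((fun a => seg T 0 j (put 0 s1) (put 0 t1') o a) ⬝ᵥ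
        seg T j m (put j s2) (put j t2') *ᵥ
          (fun a => seg T (j + m) r (put (j + m) s3) (put (j + m) t3') a o)) *
      ((fun a => seg T 0 j (put 0 s1) (put 0 t1) o a) ⬝ᵥ
        seg T j m (put j s2) (put j t2) *ᵥ
          (fun a => seg T (j + m) r (put (j + m) s3) (put (j + m) t3) a o)) =
      if t1' = t1 ∧ t2' = t2 ∧ t3' = t3 then 1 else 0 := by
  have h := hU (Fin.append (Fin.append t1' t2') t3') (Fin.append (Fin.append t1 t2) t3)
  have e : (Fin.append (Fin.append t1' t2') t3' = Fin.append (Fin.append t1 t2) t3) ↔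
      (t1' = t1 ∧ t2' = t2 ∧ t3' = t3) := by
    constructor
    · intro h
      have h' := (Fin.appendEquiv (α := Fin d) (j + m) r).injective
        (a₁ := (Fin.append t1' t2', t3')) (a₂ := (Fin.append t1 t2, t3)) h
      have h'' := (Fin.appendEquiv (α := Fin d) j m).injective
        (a₁ := (t1', t2')) (a₂ := (t1, t2)) (Prod.ext_iff.1 h').1
      exact ⟨(Prod.ext_iff.1 h'').1, (Prod.ext_iff.1 h'').2, (Prod.ext_iff.1 h').2⟩
    · rintro ⟨rfl, rfl, rfl⟩
      rfl
  rw [if_congr e rfl rfl] at h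
  rw [← h, ← Equiv.sum_comp (Fin.appendEquiv (α := Fin d) (j + m) r), Fintype.sum_prod_type,
    ← Equiv.sum_comp (Fin.appendEquiv (α := Fin d) j m), Fintype.sum_prod_type]
  refine Finset.sum_congr rfl fun s1 _ => Finset.sum_congr rfl fun s2 _ =>
    Finset.sum_congr rfl fun s3 _ => ?_
  simp only [← seg_append]
  rfl

end Split

/-! ### Padded tensors -/

namespace Tensors
variable {d N n : ℕ} [NeZero d] (B : Tensors d N)

/-- The tensors, padded by zeros to a common bond dimension. -/
def padded (n : ℕ) (k : ℕ) (s t : Fin d) : Matrix (Fin n) (Fin n) ℂ := pad n (B.tensor k s t)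

lemma seg_padded_left {o : Fin n} (ho : (o : ℕ) = 0) {k : ℕ} (hn : ∀ l ≤ k, B.bond l ≤ n)
    (s t : Fin k → Fin d) (c : Fin n) :
    seg (B.padded n) 0 k (put 0 s) (put 0 t) o c =
      if h : (c : ℕ) < B.bond k then B.leftOp k ⟨c, h⟩ s t else 0 := by
  induction k generalizing c with
  | zero =>
    have h0 := B.bond_zero
    rw [seg, Matrix.one_apply]
    by_cases hc : o = c
    · subst hc
      have h : (o : ℕ) < B.bond 0 := by omega
      rw [if_pos rfl, dif_pos h, leftOp, Matrix.of_apply, leftProd,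
        Finset.sum_eq_single_of_mem ⟨o, h⟩ (Finset.mem_univ _)]
      · simp
      · intro a _ ha
        exact absurd (Fin.ext (by have := a.2; simp only; omega)) ha
    · rw [if_neg hc, dif_neg]
      intro h
      exact hc (Fin.ext (by omega))
  | succ k ih =>
    rw [seg, Matrix.mul_apply]
    have e : ∀ s : Fin (k + 1) → Fin d, ∀ l, 0 ≤ l → l < 0 + k →
        put 0 s l = put 0 (fun i : Fin k => s i.castSucc) l :=
      fun s l h1 h2 => (put_castSucc s h1 h2).symm
    rw [seg_congr (e s) (e t)]
    simp only [put_last]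
    simp only [ih (fun l hl => hn l (by omega)), padded]
    have : ∀ c' : Fin n, (if h : (c' : ℕ) < B.bond k then B.leftOp k ⟨c', h⟩
        (fun i => s i.castSucc) (fun i => t i.castSucc) else 0) *
        pad n (B.tensor (0 + k) (s (Fin.last k)) (t (Fin.last k))) c' c =
        if h : (c' : ℕ) < B.bond k then (if hc : (c : ℕ) < B.bond (k + 1) then
          B.leftOp k ⟨c', h⟩ (fun i => s i.castSucc) (fun i => t i.castSucc) *
          B.tensor k (s (Fin.last k)) (t (Fin.last k)) ⟨c', h⟩ ⟨c, hc⟩ else 0) else 0 := by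
      intro c'
      rw [zero_add, pad_apply]
      by_cases h : (c' : ℕ) < B.bond k
      · by_cases hc : (c : ℕ) < B.bond (k + 1)
        · rw [dif_pos h, dif_pos h, dif_pos hc, dif_pos ⟨h, hc⟩]
        · rw [dif_pos h, dif_pos h, dif_neg hc, dif_neg fun h => hc h.2, mul_zero]
      · rw [dif_neg h, dif_neg h, zero_mul]
    rw [Finset.sum_congr rfl fun c' _ => this c']
    rw [sum_dite_lt (hn k (by omega)) fun c' => if hc : (c : ℕ) < B.bond (k + 1) then
          B.leftOp k c' (fun i => s i.castSucc) (fun i => t i.castSucc) *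
          B.tensor k (s (Fin.last k)) (t (Fin.last k)) c' ⟨c, hc⟩ else 0]
    split_ifs with hc
    · simp only [leftOp, Matrix.of_apply, leftProd, Matrix.mul_apply, Finset.sum_mul]
      rw [Finset.sum_comm]
    · simp

lemma seg_padded {k r : ℕ} (hn : ∀ l, k ≤ l → l ≤ k + r → B.bond l ≤ n)
    (s t : Fin r → Fin d) (a : Fin (B.bond k)) (c : Fin n) (ha : (a : ℕ) < n) :
    seg (B.padded n) k r (put k s) (put k t) ⟨a, ha⟩ c =
      if h : (c : ℕ) < B.bond (k + r) then B.segProd k r s t a ⟨c, h⟩ else 0 := by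
  induction r generalizing c with
  | zero =>
    rw [seg, Matrix.one_apply]
    by_cases h : (c : ℕ) < B.bond (k + 0)
    · rw [dif_pos h, segProd, Matrix.one_apply]
      refine if_congr ?_ rfl rfl
      rw [Fin.ext_iff, Fin.ext_iff]
    · rw [dif_neg h, if_neg]
      rintro rfl
      exact h a.2
  | succ r ih =>
    rw [seg, Matrix.mul_apply]
    have e : ∀ s : Fin (r + 1) → Fin d, ∀ l, k ≤ l → l < k + r →
        put k s l = put k (fun i : Fin r => s i.castSucc) l :=
      fun s l h1 h2 => (put_castSucc s h1 h2).symm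
    rw [seg_congr (e s) (e t)]
    simp only [put_last]
    simp only [ih (fun l hl hl' => hn l hl (by omega)), padded]
    have : ∀ c' : Fin n, (if h : (c' : ℕ) < B.bond (k + r) then B.segProd k r
        (fun i => s i.castSucc) (fun i => t i.castSucc) a ⟨c', h⟩ else 0) *
        pad n (B.tensor (k + r) (s (Fin.last r)) (t (Fin.last r))) c' c =
        if h : (c' : ℕ) < B.bond (k + r) then (if hc : (c : ℕ) < B.bond (k + r + 1) then
          B.segProd k r (fun i => s i.castSucc) (fun i => t i.castSucc) a ⟨c', h⟩ *
          B.tensor (k + r) (s (Fin.last r)) (t (Fin.last r)) ⟨c', h⟩ ⟨c, hc⟩ else 0) else 0 := by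
      intro c'
      rw [pad_apply]
      by_cases h : (c' : ℕ) < B.bond (k + r)
      · by_cases hc : (c : ℕ) < B.bond (k + r + 1)
        · rw [dif_pos h, dif_pos h, dif_pos hc, dif_pos ⟨h, hc⟩]
        · rw [dif_pos h, dif_pos h, dif_neg hc, dif_neg fun h => hc h.2, mul_zero]
      · rw [dif_neg h, dif_neg h, zero_mul]
    rw [Finset.sum_congr rfl fun c' _ => this c']
    rw [sum_dite_lt (hn (k + r) (by omega) (by omega)) fun c' =>
      if hc : (c : ℕ) < B.bond (k + r + 1) then
          B.segProd k r (fun i => s i.castSucc) (fun i => t i.castSucc) a c' *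
          B.tensor (k + r) (s (Fin.last r)) (t (Fin.last r)) c' ⟨c, hc⟩ else 0]
    by_cases hc : (c : ℕ) < B.bond (k + r + 1)
    · simp only [dif_pos hc]
      rw [dif_pos (show (c : ℕ) < B.bond (k + (r + 1)) from hc)]
      rfl
    · simp only [dif_neg hc]
      rw [dif_neg (show ¬(c : ℕ) < B.bond (k + (r + 1)) from hc), Finset.sum_const_zero]

lemma seg_padded_right {o : Fin n} (ho : (o : ℕ) = 0) {k : ℕ} (hk : k ≤ N)
    (hn : ∀ l, k ≤ l → l ≤ N → B.bond l ≤ n) (s t : Fin (N - k) → Fin d) (c : Fin n) :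
    seg (B.padded n) k (N - k) (put k s) (put k t) c o =
      if h : (c : ℕ) < B.bond k then B.rightOp k ⟨c, h⟩ s t else 0 := by
  have hb : B.bond (k + (N - k)) = 1 := by
    rw [Nat.add_sub_cancel' hk]; exact B.bond_last
  split_ifs with h
  · have ho' : (o : ℕ) < B.bond (k + (N - k)) := by omega
    have := B.seg_padded (n := n) (k := k) (r := N - k) (fun l h1 h2 => hn l h1 (by omega)) s t ⟨c, h⟩ o c.2
    rw [dif_pos ho'] at this
    rw [rightOp, Matrix.of_apply, Finset.sum_eq_single_of_mem ⟨o, ho'⟩ (Finset.mem_univ _)]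
    · exact this
    · intro b _ hb'
      exact absurd (Fin.ext (by have := b.2; simp only; omega)) hb'
  · generalize put k s = s'
    generalize put k t = t'
    rcases Nat.eq_zero_or_pos (N - k) with h0 | h0
    · have : B.bond k = 1 := by
        rw [show k = N by omega]; exact B.bond_last
      rw [h0, seg, Matrix.one_apply, if_neg]
      rintro rfl
      omega
    · obtain ⟨r, hr⟩ : ∃ r, N - k = 1 + r := ⟨N - k - 1, by omega⟩
      rw [hr, seg_add, seg, seg, one_mul,
        add_zero, Matrix.mul_apply]
      refine Finset.sum_eq_zero fun i _ => ?_
      rw [padded, pad_apply, dif_neg (fun h' => h h'.1), zero_mul]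

lemma toOp_eq_seg {o : Fin n} (ho : (o : ℕ) = 0) (hn : ∀ l ≤ N, B.bond l ≤ n)
    (s t : Fin N → Fin d) :
    B.toOp s t = seg (B.padded n) 0 N (put 0 s) (put 0 t) o o := by
  have hb := B.bond_last
  have ho' : (o : ℕ) < B.bond N := by omega
  rw [B.seg_padded_left ho hn, dif_pos ho', toOp, Matrix.of_apply, leftOp, Matrix.of_apply]
  refine Finset.sum_congr rfl fun a _ => ?_
  rw [Finset.sum_eq_single_of_mem ⟨o, ho'⟩ (Finset.mem_univ _)]
  intro b _ hb'
  exact absurd (Fin.ext (by have := b.2; simp only; omega)) hb'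

lemma leftGram_apply (k : ℕ) (σ : Op (Fin k) d) (m' m : Fin (B.bond k)) :
    B.leftGram k σ m' m =
      ∑ t, ∑ t', ∑ s, σ t t' * (star (B.leftOp k m' s t') * B.leftOp k m s t) := by
  simp only [leftGram, Matrix.of_apply, Matrix.trace, Matrix.diag_apply, Matrix.mul_apply,
    Matrix.conjTranspose_apply, Finset.mul_sum]

lemma rightGram_apply (k : ℕ) (τ : Op (Fin (N - k)) d) (m' m : Fin (B.bond k)) :
    B.rightGram k τ m' m =
      ∑ t, ∑ t', ∑ s, τ t t' * (star (B.rightOp k m' s t') * B.rightOp k m s t) := by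
  simp only [rightGram, Matrix.of_apply, Matrix.trace, Matrix.diag_apply, Matrix.mul_apply,
    Matrix.conjTranspose_apply, Finset.mul_sum]

lemma pad_gram {κ : Type} [Fintype κ] {D : ℕ} (x : κ → κ → Fin n → ℂ) (X : Fin D → κ → κ → ℂ)
    (hx : ∀ s t c, x s t c = if h : (c : ℕ) < D then X ⟨c, h⟩ s t else 0) (σ : Matrix κ κ ℂ)
    (Q : Matrix (Fin D) (Fin D) ℂ)
    (hQ : ∀ m' m, Q m' m = ∑ t, ∑ t', ∑ s, σ t t' * (star (X m' s t') * X m s t)) :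
    pad n Q = ∑ t, ∑ t', ∑ s, σ t t' • Matrix.vecMulVec (star (x s t')) (x s t) := by
  ext a c
  simp only [Matrix.sum_apply, Matrix.smul_apply, Matrix.vecMulVec_apply, Pi.star_apply,
    smul_eq_mul, hx]
  by_cases ha : (a : ℕ) < D
  · by_cases hc : (c : ℕ) < D
    · simp only [pad_apply, dif_pos ha, dif_pos hc]
      rw [dif_pos ⟨ha, hc⟩, hQ]
    · simp [pad_apply, hc]
  · simp [pad_apply, ha]

end Tensors

/-! ### From tensors to isometries -/

/-- Any factor can replace the positive square root: the isometry property and the norm of Φ depend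
on `Lᴴ * L` only. -/
lemma exists_factor {p : ℕ} {Q : Matrix (Fin p) (Fin p) ℂ} (hQ : Q.PosDef) :
    ∃ L : Matrix (Fin p) (Fin p) ℂ, Lᴴ * L = Q ∧ IsUnit L := by
  open scoped MatrixOrder Matrix.Norms.L2Operator in
  obtain ⟨L, hL⟩ := CStarAlgebra.nonneg_iff_eq_star_mul_self.mp hQ.posSemidef.nonneg
  refine ⟨L, hL.symm, ?_⟩
  have h := hQ.isUnit
  rw [hL, Matrix.isUnit_iff_isUnit_det, Matrix.det_mul] at h
  rw [Matrix.isUnit_iff_isUnit_det]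
  exact isUnit_of_mul_isUnit_right h

lemma sum_norm_sq_eq_trace {m n : Type} [Fintype m] [Fintype n] (M : Matrix m n ℂ) :
    ∑ a, ∑ c, ‖M a c‖ ^ 2 = (Mᴴ * M).trace.re := by
  rw [← sum_star_mul_eq_trace, Complex.re_sum]
  refine Finset.sum_congr rfl fun a _ => ?_
  rw [Complex.re_sum]
  refine Finset.sum_congr rfl fun c _ => ?_
  rw [← Complex.normSq_eq_norm_sq, Complex.star_def, mul_comm, Complex.mul_conj, Complex.ofReal_re]

/-- Here the conditioning number enters: the squared Hilbert–Schmidt norm of the operator undoing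
`Rᵀ` and `L` is the trace in the definition of q_k. -/
lemma sum_norm_sq_inv {p : ℕ} {L R : Matrix (Fin p) (Fin p) ℂ} :
    ∑ a, ∑ c, ‖((Rᵀ)⁻¹ * L⁻¹) a c‖ ^ 2 = ((Rᴴ * R)⁻¹ * ((Lᴴ * L)⁻¹)ᵀ).trace.re := by
  have hRR : (Rᵀ * Rᵀᴴ) = (Rᴴ * R)ᵀ := by
    rw [Matrix.transpose_mul]; rfl
  rw [sum_norm_sq_eq_trace, ← Matrix.trace_transpose ((Rᴴ * R)⁻¹ * _), Matrix.transpose_mul,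
    Matrix.transpose_transpose, Matrix.transpose_nonsing_inv, ← hRR, Matrix.mul_inv_rev,
    Matrix.mul_inv_rev, Matrix.conjTranspose_mul, Matrix.conjTranspose_nonsing_inv,
    Matrix.conjTranspose_nonsing_inv, Matrix.trace_mul_comm (L⁻¹ * _)]
  rw [Matrix.mul_assoc (Lᴴ)⁻¹, Matrix.trace_mul_comm (Lᴴ)⁻¹]
  simp only [Matrix.mul_assoc]

namespace Tensors
variable {d N : ℕ} [NeZero d] (B : Tensors d N)

lemma leftGram_zero : B.leftGram 0 1 = 1 := by
  have hb := B.bond_zero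
  have : Subsingleton (Fin (B.bond 0)) := by rw [hb]; infer_instance
  ext m' m
  have h : ∀ m s t, B.leftOp 0 m s t = 1 := by
    intro m s t
    rw [leftOp, Matrix.of_apply, Finset.sum_eq_single_of_mem m (Finset.mem_univ _)
      (fun a _ ha => absurd (Subsingleton.elim a m) ha), leftProd, Matrix.one_apply_eq]
  rw [leftGram_apply]
  rw [Subsingleton.elim m' m, Matrix.one_apply_eq]
  simp [h]

lemma rightGram_last : B.rightGram N 1 = 1 := by
  have hb := B.bond_last
  have : Subsingleton (Fin (B.bond N)) := by rw [hb]; infer_instance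
  have h0 : ∀ r, r = 0 → ∀ (s t : Fin r → Fin d) (m : Fin (B.bond N)),
      ∑ b, B.segProd N r s t m b = 1 := by
    rintro r rfl s t m
    exact (Finset.sum_eq_single_of_mem (M := ℂ) (s := (Finset.univ : Finset (Fin (B.bond N))))
      (f := fun b => (1 : Matrix (Fin (B.bond N)) (Fin (B.bond N)) ℂ) m b) m (Finset.mem_univ _)
      (fun a _ ha => absurd (Subsingleton.elim a m) ha)).trans (Matrix.one_apply_eq m)
  have : IsEmpty (Fin (N - N)) := by rw [Nat.sub_self]; infer_instance
  ext m' m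
  have h : ∀ m s t, B.rightOp N m s t = 1 := fun m s t => h0 _ (Nat.sub_self N) s t m
  rw [rightGram_apply]
  rw [Subsingleton.elim m' m, Matrix.one_apply_eq]
  simp [h]

lemma pad_one_apply {n D : ℕ} (hD : D = 1) (a c : Fin n) :
    pad n (1 : Matrix (Fin D) (Fin D) ℂ) a c = if (a : ℕ) = 0 ∧ (c : ℕ) = 0 then 1 else 0 := by
  subst hD
  rw [pad_apply]
  by_cases h : (a : ℕ) = 0 ∧ (c : ℕ) = 0
  · rw [if_pos h, dif_pos (by omega), Matrix.one_apply, if_pos (Fin.ext (by simp [h]))]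
  · rw [if_neg h, dif_neg (by omega)]

variable {B}

/-- The empty segment `m = 0` is included; it says that `L * Rᵀ` has Hilbert–Schmidt norm 1. -/
lemma iso_of_grams {n : ℕ} (hU : B.IsMPU) (hn : ∀ l ≤ N, B.bond l < n) {j m : ℕ} (hjm : j + m ≤ N)
    {L R : Matrix (Fin n) (Fin n) ℂ} {σ : Op (Fin j) d} {τ : Op (Fin (N - (j + m))) d}
    (hσ : σ.trace = 1) (hτ : τ.trace = 1) (hL : Lᴴ * L = pad n (B.leftGram j σ))
    (hR : Rᴴ * R = pad n (B.rightGram (j + m) τ)) (t t' : ℕ → Fin d) :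
    ∑ s : Fin m → Fin d, ∑ a, ∑ c, star ((L * seg (B.padded n) j m (put j s) t' * Rᵀ) a c) *
      (L * seg (B.padded n) j m (put j s) t * Rᵀ) a c =
      if ∀ l, j ≤ l → l < j + m → t' l = t l then 1 else 0 := by
  have hn0 : 0 < n := lt_of_le_of_lt (Nat.zero_le _) (hn 0 (Nat.zero_le _))
  have hle : ∀ l ≤ N, B.bond l ≤ n := fun l hl => (hn l hl).le
  have hU' : ∀ M, M = N → ∀ t' t : Fin M → Fin d, ∑ s : Fin M → Fin d,
      star (seg (B.padded n) 0 M (put 0 s) (put 0 t') ⟨0, hn0⟩ ⟨0, hn0⟩) *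
        seg (B.padded n) 0 M (put 0 s) (put 0 t) ⟨0, hn0⟩ ⟨0, hn0⟩ = if t' = t then 1 else 0 := by
    rintro M rfl t' t
    simp only [← B.toOp_eq_seg (o := ⟨0, hn0⟩) rfl hle]
    have := congrFun (congrFun (Matrix.mem_unitaryGroup_iff'.1 hU) t') t
    rw [Matrix.mul_apply, Matrix.one_apply] at this
    exact this
  have key := isometry_of_unitary
    (fun s t a => seg (B.padded n) 0 j (put 0 s) (put 0 t) ⟨0, hn0⟩ a)
    (fun s t => seg (B.padded n) j m (put j s) (put j t))
    (fun s t a => seg (B.padded n) (j + m) (N - (j + m)) (put (j + m) s) (put (j + m) t) a ⟨0, hn0⟩)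
    (orthonormal_split j m (N - (j + m)) (hU' _ (by omega))) L R σ τ hσ hτ
    (hL.trans (pad_gram _ (fun c s t => B.leftOp j c s t)
      (fun s t c => B.seg_padded_left rfl (fun l hl => hle l (by omega)) s t c) σ _
      (B.leftGram_apply j σ)))
    (hR.trans (pad_gram _ (fun c s t => B.rightOp (j + m) c s t)
      (fun s t c => B.seg_padded_right rfl hjm (fun l _ hl => hle l hl) s t c) τ _
      (B.rightGram_apply (j + m) τ)))
    (fun i => t' (j + i)) (fun i => t (j + i))
  have e : ∀ (s t : ℕ → Fin d), seg (B.padded n) j m s t =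
      seg (B.padded n) j m s (put j fun i : Fin m => t (j + i)) := fun s t =>
    seg_congr (fun _ _ _ => rfl) fun l h1 h2 => by
      rw [put_apply _ h1 h2]
      simp only [Nat.add_sub_cancel' h1]
  simp only [e _ t, e _ t']
  refine key.trans (if_congr ?_ rfl rfl)
  constructor
  · intro h l h1 h2
    have := congrFun h ⟨l - j, by omega⟩
    simpa only [Nat.add_sub_cancel' h1] using this
  · intro h
    funext i
    exact h _ (by omega) (by omega)

/-- Padding all bonds to dimension `d ^ b` lets them be stored in `b` qudits, and the strict
inequality leaves the last level free as the spare one. At the two ends of the chain the attached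
operators are the padded identity of the trivial bond, so the isometry of the whole chain is the
operator itself. -/
lemma exists_isoData {b : ℕ} {q : ℝ} (hN : 1 ≤ N) (hU : B.IsMPU) (hn : ∀ l ≤ N, B.bond l < d ^ b)
    (hq : ∀ k, 1 ≤ k → k < N → ∃ P ∈ B.rightSet k, ∃ Q ∈ B.leftSet k,
      (P⁻¹ * (Q⁻¹)ᵀ).trace.re ≤ q ^ 2) :
    ∃ A : IsoData N d b q, ∀ (x y : Config (Fin N) d) (a c : Fin (d ^ b)),
      A.W 0 N (put 0 x) (put 0 y) a c =
        if (a : ℕ) = 0 ∧ (c : ℕ) = 0 then B.toOp x y else 0 := by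
  have hle : ∀ l ≤ N, B.bond l ≤ d ^ b := fun l hl => (hn l hl).le
  have hn0 : 0 < d ^ b := lt_of_le_of_lt (Nat.zero_le _) (hn 0 (Nat.zero_le _))
  have hpadone : ∀ D, D ≤ d ^ b → (pad (d ^ b) (1 : Matrix (Fin D) (Fin D) ℂ))ᴴ *
      pad (d ^ b) (1 : Matrix (Fin D) (Fin D) ℂ) = pad (d ^ b) 1 := fun D hD => by
    rw [← pad_conjTranspose, ← pad_mul hD, Matrix.conjTranspose_one, Matrix.mul_one]
  -- Each cut is treated separately: `L` is needed for `k < N`, `R` for `1 ≤ k ≤ N`, and Φ only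
  -- strictly inside the chain. All other values are filled with 1.
  have hex : ∀ k, ∃ L R Φ : Matrix (Fin (d ^ b)) (Fin (d ^ b)) ℂ,
      (k < N → ∃ σ : Op (Fin k) d, σ.trace = 1 ∧ Lᴴ * L = pad (d ^ b) (B.leftGram k σ)) ∧
      (1 ≤ k → k ≤ N → ∃ τ : Op (Fin (N - k)) d, τ.trace = 1 ∧
        Rᴴ * R = pad (d ^ b) (B.rightGram k τ)) ∧
      (1 ≤ k → k < N → Rᵀ * Φ * L = pad (d ^ b) (1 : Matrix (Fin (B.bond k)) (Fin (B.bond k)) ℂ) ∧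
        ∑ a, ∑ c, ‖Φ a c‖ ^ 2 ≤ q ^ 2 ∧ (∀ i : Fin (d ^ b), B.bond k ≤ i → Φ i i = 0 ∧
          ∀ c, L i c = 0)) ∧
      (k = 0 → L = pad (d ^ b) (1 : Matrix (Fin (B.bond 0)) (Fin (B.bond 0)) ℂ)) ∧
      (k = N → R = pad (d ^ b) (1 : Matrix (Fin (B.bond N)) (Fin (B.bond N)) ℂ)) := by
    intro k
    rcases Nat.eq_zero_or_pos k with rfl | hk
    · refine ⟨pad (d ^ b) (1 : Matrix (Fin (B.bond 0)) (Fin (B.bond 0)) ℂ), 1, 1, fun _ => ⟨1, ?_, ?_⟩,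
        fun h => absurd h (by omega), fun h => absurd h (by omega), fun _ => rfl,
        fun h => absurd h (by omega)⟩
      · simp
      · rw [hpadone _ (hle 0 (by omega)), leftGram_zero]
    rcases lt_trichotomy k N with hkN | rfl | hkN
    · obtain ⟨P, ⟨hP, τ, hτ, hPτ⟩, Q, ⟨hQ, σ, hσ, hQσ⟩, hPQ⟩ := hq k hk hkN
      obtain ⟨L, hL, hLu⟩ := exists_factor hQ
      obtain ⟨R, hR, hRu⟩ := exists_factor hP
      have hb := hle k hkN.le
      refine ⟨pad _ L, pad _ R, pad _ ((Rᵀ)⁻¹ * L⁻¹), fun _ => ⟨σ, hσ.2, ?_⟩,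
        fun _ _ => ⟨τ, hτ.2, ?_⟩, fun _ _ => ⟨?_, ?_, ?_⟩, fun h => absurd h (by omega),
        fun h => absurd h (by omega)⟩
      · rw [← pad_conjTranspose, ← pad_mul hb, hL, hQσ]
      · rw [← pad_conjTranspose, ← pad_mul hb, hR, hPτ]
      · have hRu' : IsUnit (Rᵀ).det := by
          rw [Matrix.det_transpose]
          exact (Matrix.isUnit_iff_isUnit_det _).1 hRu
        have hLu' : IsUnit L.det := (Matrix.isUnit_iff_isUnit_det _).1 hLu
        rw [← pad_transpose, ← pad_mul hb, ← pad_mul hb, ← Matrix.mul_assoc,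
          Matrix.mul_nonsing_inv _ hRu', Matrix.one_mul, Matrix.nonsing_inv_mul _ hLu']
      · rw [sum_sum_pad hb hb, sum_norm_sq_inv, hL, hR]
        exact hPQ
      · intro i hi
        refine ⟨?_, fun c => ?_⟩
        · rw [pad_apply, dif_neg (by omega)]
        · rw [pad_apply, dif_neg (by omega)]
    · refine ⟨1, pad _ (1 : Matrix (Fin (B.bond k)) (Fin (B.bond k)) ℂ), 1,
        fun h => absurd h (by omega), fun _ _ => ⟨1, ?_, ?_⟩, fun _ h => absurd h (by omega),
        fun h => absurd h (by omega), fun _ => rfl⟩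
      · have : IsEmpty (Fin (k - k)) := by rw [Nat.sub_self]; infer_instance
        simp
      · rw [hpadone _ (hle k le_rfl), rightGram_last]
    · exact ⟨1, 1, 1, fun h => absurd h (by omega), fun _ h => absurd h (by omega),
        fun _ h => absurd h (by omega), fun h => absurd h (by omega), fun h => absurd h (by omega)⟩
  choose L R Φ h1 h2 h3 h4 h5 using hex
  have hsp : d ^ b - 1 < d ^ b := by omega
  let A : IsoData N d b q :=
    { T := B.padded (d ^ b)
      L := L
      R := R
      Φ := Φ
      spare := ⟨d ^ b - 1, hsp⟩
      iso := by
        intro j m hm hjm t t'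
        obtain ⟨σ, hσ, hL⟩ := h1 j (by omega)
        obtain ⟨τ, hτ, hR⟩ := h2 (j + m) (by omega) hjm
        exact iso_of_grams hU hn hjm hσ hτ hL hR t t'
      undo := by
        intro k hk s t
        rw [(h3 (k + 1) (by omega) hk).1, padded, ← pad_mul (hle _ hk.le), Matrix.mul_one]
      norm_le := fun k hk hkN => (h3 k hk hkN).2.1
      Φ_spare := fun k hk hkN =>
        ((h3 k hk hkN).2.2 _ (by have := hn k hkN.le; simp only; omega)).1
      L_spare := fun k hk hkN =>
        ((h3 k hk hkN).2.2 _ (by have := hn k hkN.le; simp only; omega)).2 }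
  refine ⟨A, fun x y a c => ?_⟩
  have hA : A.W 0 N (put 0 x) (put 0 y) =
      L 0 * seg (B.padded (d ^ b)) 0 N (put 0 x) (put 0 y) * (R (0 + N))ᵀ := rfl
  rw [hA, zero_add, h4 0 rfl, h5 N rfl, Matrix.mul_apply]
  simp only [Matrix.mul_apply, Matrix.transpose_apply, pad_one_apply B.bond_zero,
    pad_one_apply B.bond_last]
  rw [B.toOp_eq_seg (o := ⟨0, hn0⟩) rfl hle,
    Finset.sum_eq_single_of_mem (⟨0, hn0⟩ : Fin (d ^ b)) (Finset.mem_univ _),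
    Finset.sum_eq_single_of_mem (⟨0, hn0⟩ : Fin (d ^ b)) (Finset.mem_univ _)]
  · by_cases ha : (a : ℕ) = 0 <;> by_cases hc : (c : ℕ) = 0 <;> simp [ha, hc]
  · intro i _ hi
    rw [if_neg (fun h => hi (Fin.ext h.2)), zero_mul]
  · intro i _ hi
    rw [if_neg (fun h => hi (Fin.ext h.2)), mul_zero]

end Tensors

/-! ### Bond dimensions -/

namespace Tensors
variable {d N : ℕ} [NeZero d] (B : Tensors d N)

/-- The operators to the left of the cut `k`, as the columns of a matrix. -/
def leftMat (k : ℕ) : Matrix (Config (Fin k) d × Config (Fin k) d) (Fin (B.bond k)) ℂ :=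
  Matrix.of fun st m => B.leftOp k m st.1 st.2

/-- The operators to the right of the cut `k`, as the columns of a matrix. -/
def rightMat (k : ℕ) :
    Matrix (Config (Fin (N - k)) d × Config (Fin (N - k)) d) (Fin (B.bond k)) ℂ :=
  Matrix.of fun st m => B.rightOp k m st.1 st.2

/-- A configuration of a chain, from the configurations of its two parts. -/
def join (k : ℕ) (s : Config (Fin k) d) (s' : Config (Fin (N - k)) d) : Config (Fin N) d :=
  fun i => if h : (i : ℕ) < k then s ⟨i, h⟩ else s' ⟨i - k, by omega⟩

lemma exists_join (k : ℕ) (s : Config (Fin N) d) :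
    ∃ (s1 : Config (Fin k) d) (s2 : Config (Fin (N - k)) d), s = join k s1 s2 := by
  refine ⟨fun i => if h : (i : ℕ) < N then s ⟨i, h⟩ else 0, fun i => s ⟨k + i, by omega⟩, ?_⟩
  funext i
  by_cases h : (i : ℕ) < k
  · simp [join, h]
  · rw [join, dif_neg h]
    exact congrArg s (Fin.ext (show (i : ℕ) = k + (i - k) by omega))

lemma put_join_left {k : ℕ} (hk : k ≤ N) (s : Config (Fin k) d) (s' : Config (Fin (N - k)) d)
    {l : ℕ} (hl : l < k) : put 0 (join k s s') l = put 0 s l := by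
  rw [put_apply _ (by omega) (by omega), put_apply _ (by omega) (by omega), join,
    dif_pos (by simpa using hl)]

lemma put_join_right {k : ℕ} (s : Config (Fin k) d) (s' : Config (Fin (N - k)) d)
    {l : ℕ} (hl : k ≤ l) (hl' : l < N) : put 0 (join k s s') l = put k s' l := by
  rw [put_apply _ (by omega) (by omega), put_apply _ (by omega) (by omega), join,
    dif_neg (by simpa using hl)]
  rfl

lemma exists_le_bond (k : ℕ) : ∃ n, 0 < n ∧ ∀ l ≤ k, B.bond l < n :=
  ⟨(Finset.range (k + 1)).sup B.bond + 1, by omega, fun l hl =>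
    Nat.lt_succ_of_le (Finset.le_sup (f := B.bond) (Finset.mem_range.2 (by omega)))⟩

/-- Regrouped across the cut, the operator is a matrix that factors through the bond; the bond
dimension thus bounds its rank. -/
lemma leftMat_mul_rightMat {k : ℕ} (hk : k ≤ N) (st st') :
    (B.leftMat k * (B.rightMat k)ᵀ) st st' = B.toOp (join k st.1 st'.1) (join k st.2 st'.2) := by
  obtain ⟨n, hn0, hn⟩ := B.exists_le_bond N
  have hle : ∀ l ≤ N, B.bond l ≤ n := fun l hl => (hn l hl).le
  have e : ∀ (s : Config (Fin k) d) s', ∀ l, 0 ≤ l → l < 0 + k →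
      put 0 (join k s s' : Config (Fin N) d) l = put 0 s l :=
    fun s s' l _ h => put_join_left hk s s' (by omega)
  have e' : ∀ (s : Config (Fin k) d) s', ∀ l, k ≤ l → l < k + (N - k) →
      put 0 (join k s s' : Config (Fin N) d) l = put k s' l :=
    fun s s' l h h' => put_join_right s s' h (by omega)
  have hadd := seg_add (T := B.padded n) 0 k (N - k) (put 0 (join k st.1 st'.1 : Config (Fin N) d))
    (put 0 (join k st.2 st'.2 : Config (Fin N) d))
  rw [Nat.add_sub_cancel' hk, zero_add, seg_congr (e _ _) (e _ _), seg_congr (e' _ _) (e' _ _)] at hadd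
  rw [B.toOp_eq_seg (n := n) (o := ⟨0, hn0⟩) rfl hle, hadd, Matrix.mul_apply, Matrix.mul_apply,
    ← sum_dite_lt (hle k hk)]
  refine Finset.sum_congr rfl fun c _ => ?_
  rw [B.seg_padded_left rfl (fun l hl => hle l (by omega)),
    B.seg_padded_right rfl hk (fun l _ hl => hle l hl)]
  by_cases h : (c : ℕ) < B.bond k
  · simp only [dif_pos h]
    rfl
  · simp only [dif_neg h, zero_mul]

/-- A linear relation between the operators on one side of the cut is in the kernel of every Gram
matrix on that side. Positive definiteness of one of them therefore forces independence. -/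
lemma mulVec_gram_eq_zero {κ : Type} [Fintype κ] {D : ℕ} {X : Matrix (κ × κ) (Fin D) ℂ}
    {σ : Matrix κ κ ℂ} {Q : Matrix (Fin D) (Fin D) ℂ}
    (hQ : ∀ m' m, Q m' m = ∑ t, ∑ t', ∑ s, σ t t' * (star (X (s, t') m') * X (s, t) m))
    {v : Fin D → ℂ} (hv : X *ᵥ v = 0) : Q *ᵥ v = 0 := by
  funext m'
  have h : ∀ s t, ∑ m, X (s, t) m * v m = 0 := fun s t => congrFun hv (s, t)
  rw [Matrix.mulVec, dotProduct]
  simp only [hQ, Finset.sum_mul]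
  rw [Finset.sum_comm]
  refine Finset.sum_eq_zero fun t _ => ?_
  rw [Finset.sum_comm]
  refine Finset.sum_eq_zero fun t' _ => ?_
  rw [Finset.sum_comm]
  refine Finset.sum_eq_zero fun s _ => ?_
  rw [← mul_zero (σ t t' * star (X (s, t') m')), ← h s t, Finset.mul_sum]
  exact Finset.sum_congr rfl fun m _ => by ring

lemma mulVec_injective_of_posDef {κ : Type} [Fintype κ] {D : ℕ} {X : Matrix (κ × κ) (Fin D) ℂ}
    {σ : Matrix κ κ ℂ} {Q : Matrix (Fin D) (Fin D) ℂ} (hpos : Q.PosDef)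
    (hQ : ∀ m' m, Q m' m = ∑ t, ∑ t', ∑ s, σ t t' * (star (X (s, t') m') * X (s, t) m)) :
    Function.Injective X.mulVec := by
  intro v w hvw
  have h : X *ᵥ (v - w) = 0 := by rw [Matrix.mulVec_sub]; exact sub_eq_zero.2 hvw
  have h2 := mulVec_gram_eq_zero hQ h
  rw [← sub_eq_zero, ← Matrix.one_mulVec (v - w),
    ← Matrix.nonsing_inv_mul Q ((Matrix.isUnit_iff_isUnit_det _).1 hpos.isUnit),
    ← Matrix.mulVec_mulVec, h2, Matrix.mulVec_zero]

lemma exists_leftInverse {m n : Type} [Fintype m] [Fintype n] [DecidableEq n] {X : Matrix m n ℂ}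
    (hX : Function.Injective X.mulVec) : ∃ Z : Matrix n m ℂ, Z * X = 1 := by
  have h := (Matrix.isUnit_iff_isUnit_det _).1 (Matrix.PosDef.conjTranspose_mul_self X hX).isUnit
  exact ⟨(Xᴴ * X)⁻¹ * Xᴴ, by rw [Matrix.mul_assoc, Matrix.nonsing_inv_mul _ h]⟩

variable {B}

lemma leftMat_injective {k : ℕ} {Q} (hQ : Q ∈ B.leftSet k) :
    Function.Injective (B.leftMat k).mulVec := by
  obtain ⟨hpos, σ, -, rfl⟩ := hQ
  exact mulVec_injective_of_posDef hpos (B.leftGram_apply k σ)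

lemma rightMat_injective {k : ℕ} {P} (hP : P ∈ B.rightSet k) :
    Function.Injective (B.rightMat k).mulVec := by
  obtain ⟨hpos, τ, -, rfl⟩ := hP
  exact mulVec_injective_of_posDef hpos (B.rightGram_apply k τ)

/-- Representations with invertible environments have minimal bond dimensions. -/
lemma bond_le_of_toOp_eq {A : Tensors d N} (hAB : B.toOp = A.toOp) {k : ℕ} (hk : k ≤ N) {P Q}
    (hP : P ∈ B.rightSet k) (hQ : Q ∈ B.leftSet k) : B.bond k ≤ A.bond k := by
  obtain ⟨Z, hZ⟩ := exists_leftInverse (leftMat_injective hQ)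
  obtain ⟨Z', hZ'⟩ := exists_leftInverse (rightMat_injective hP)
  have hM : B.leftMat k * (B.rightMat k)ᵀ = A.leftMat k * (A.rightMat k)ᵀ := by
    ext st st'
    rw [leftMat_mul_rightMat _ hk, leftMat_mul_rightMat _ hk, hAB]
  -- The identity on the bond of `B` is factored through the bond of `A`.
  have h1 : (Z * A.leftMat k) * ((A.rightMat k)ᵀ * Z'ᵀ) = 1 := by
    rw [Matrix.mul_assoc, ← Matrix.mul_assoc (A.leftMat k), ← hM, Matrix.mul_assoc, ← Matrix.transpose_mul,
      hZ', Matrix.transpose_one, Matrix.mul_one, hZ]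
  have h2 := Matrix.rank_mul_le_left (Z * A.leftMat k) ((A.rightMat k)ᵀ * Z'ᵀ)
  rw [h1, Matrix.rank_one, Fintype.card_fin] at h2
  refine h2.trans ((Matrix.rank_le_card_width _).trans ?_)
  rw [Fintype.card_fin]

lemma bond_pos (hU : B.IsMPU) {k : ℕ} (hk : k ≤ N) : 1 ≤ B.bond k := by
  by_contra h
  have hb : B.bond k = 0 := by omega
  have : IsEmpty (Fin (B.bond k)) := by rw [hb]; infer_instance
  have h0 : ∀ s t : Config (Fin N) d, B.toOp s t = 0 := by
    intro s t
    obtain ⟨s1, s2, rfl⟩ := exists_join k s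
    obtain ⟨t1, t2, rfl⟩ := exists_join k t
    rw [← leftMat_mul_rightMat B hk (s1, t1) (s2, t2), Matrix.mul_apply, Finset.univ_eq_empty,
      Finset.sum_empty]
  have h1 := congrFun (congrFun (Matrix.mem_unitaryGroup_iff'.1 hU) 0) 0
  rw [Matrix.mul_apply, Matrix.one_apply_eq] at h1
  simp [h0] at h1

/-- The bond dimension is a lower bound for the conditioning. -/
lemma sq_bond_le (hU : B.IsMPU) {k : ℕ} (hk : k ≤ N) {P Q}
    (hP : P ∈ B.rightSet k) (hQ : Q ∈ B.leftSet k) :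
    (B.bond k : ℝ) ^ 2 ≤ (P⁻¹ * (Q⁻¹)ᵀ).trace.re := by
  obtain ⟨hP, τ, hτ, hPτ⟩ := hP
  obtain ⟨hQ, σ, hσ, hQσ⟩ := hQ
  obtain ⟨L, hL, hLu⟩ := exists_factor hQ
  obtain ⟨R, hR, hRu⟩ := exists_factor hP
  obtain ⟨n, hn0, hn⟩ := B.exists_le_bond N
  have hb := (hn k hk).le
  have h1 := iso_of_grams (m := 0) (j := k) hU hn hk (L := pad n L) (R := pad n R) hσ.2 hτ.2
    (by rw [← pad_conjTranspose, ← pad_mul hb, hL, hQσ])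
    (by rw [← pad_conjTranspose, ← pad_mul hb, hR, hPτ]; rfl) 0 0
  -- The isometry property of the empty segment at the cut.
  have h2 : ∑ a, ∑ c, ‖(L * Rᵀ) a c‖ ^ 2 = 1 := by
    rw [← sum_sum_pad hb hb, pad_mul hb, pad_transpose, sum_norm_sq_eq_trace, ← sum_star_mul_eq_trace]
    simp only [seg, Matrix.mul_one, Finset.univ_unique, Finset.sum_singleton] at h1
    rw [h1]
    simp
  have hRu' : IsUnit (Rᵀ).det := by
    rw [Matrix.det_transpose]
    exact (Matrix.isUnit_iff_isUnit_det _).1 hRu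
  have hLu' : IsUnit L.det := (Matrix.isUnit_iff_isUnit_det _).1 hLu
  rw [← hL, ← hR, ← sum_norm_sq_inv]
  set X := L * Rᵀ with hX
  set Y := (Rᵀ)⁻¹ * L⁻¹ with hY
  have hXY : X * Y = 1 := by
    rw [hX, hY, Matrix.mul_assoc, ← Matrix.mul_assoc Rᵀ, Matrix.mul_nonsing_inv _ hRu', Matrix.one_mul,
      Matrix.mul_nonsing_inv _ hLu']
  -- The bond dimension is tr(XY) for mutually inverse `X`, `Y`, and Cauchy–Schwarz with `‖X‖ = 1`
  -- bounds it by the Hilbert–Schmidt norm of `Y`.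
  have h3 : (B.bond k : ℝ) ≤ ∑ p : Fin (B.bond k) × Fin (B.bond k), ‖X p.1 p.2‖ * ‖Y p.2 p.1‖ := by
    have : ((B.bond k : ℕ) : ℂ) = ∑ p : Fin (B.bond k) × Fin (B.bond k), X p.1 p.2 * Y p.2 p.1 := by
      rw [Fintype.sum_prod_type]
      have := congrArg Matrix.trace hXY
      rw [Matrix.trace_one, Fintype.card_fin] at this
      rw [← this]
      rfl
    rw [← Complex.norm_natCast, this]
    refine (norm_sum_le _ _).trans_eq ?_
    exact Finset.sum_congr rfl fun p _ => norm_mul _ _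
  have h4 := Finset.sum_mul_sq_le_sq_mul_sq (Finset.univ : Finset (Fin (B.bond k) × Fin (B.bond k)))
    (fun p => ‖X p.1 p.2‖) (fun p => ‖Y p.2 p.1‖)
  have h5 : ∑ p : Fin (B.bond k) × Fin (B.bond k), ‖X p.1 p.2‖ ^ 2 = 1 := by
    rw [Fintype.sum_prod_type]; exact h2
  have h6 : ∑ p : Fin (B.bond k) × Fin (B.bond k), ‖Y p.2 p.1‖ ^ 2 = ∑ a, ∑ c, ‖Y a c‖ ^ 2 := by
    rw [Fintype.sum_prod_type, Finset.sum_comm]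
  rw [h5, h6, one_mul] at h4
  exact (pow_le_pow_left₀ (Nat.cast_nonneg _) h3 2).trans h4

lemma bond_le_cutConditioning (hU : B.IsMPU) {k : ℕ} (hk : k ≤ N) :
    (B.bond k : ℝ≥0∞) ≤ B.cutConditioning k := by
  refine le_iInf₂ fun P hP => le_iInf₂ fun Q hQ => ?_
  rw [← ENNReal.ofReal_natCast]
  exact ENNReal.ofReal_le_ofReal (Real.le_sqrt_of_sq_le (sq_bond_le hU hk hP hQ))

lemma bond_le_conditioning (hU : B.IsMPU) {k : ℕ} (hk1 : 1 ≤ k) (hk : k < N) :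
    (B.bond k : ℝ≥0∞) ≤ B.conditioning :=
  (bond_le_cutConditioning hU hk.le).trans
    (le_iSup₂ (f := fun k (_ : k ∈ Finset.Ico 1 N) => B.cutConditioning k) k
      (Finset.mem_Ico.2 ⟨hk1, hk⟩))

lemma exists_of_conditioning_lt {q : ℝ} (h : B.conditioning < ENNReal.ofReal q) {k : ℕ}
    (hk1 : 1 ≤ k) (hk : k < N) :
    ∃ P ∈ B.rightSet k, ∃ Q ∈ B.leftSet k, (P⁻¹ * (Q⁻¹)ᵀ).trace.re ≤ q ^ 2 := by
  have h1 : B.cutConditioning k < ENNReal.ofReal q :=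
    lt_of_le_of_lt (le_iSup₂ (f := fun k (_ : k ∈ Finset.Ico 1 N) => B.cutConditioning k) k
      (Finset.mem_Ico.2 ⟨hk1, hk⟩)) h
  simp only [cutConditioning, iInf_lt_iff] at h1
  obtain ⟨P, hP, Q, hQ, h2⟩ := h1
  refine ⟨P, hP, Q, hQ, ?_⟩
  have hq : 0 < q := by
    by_contra hq
    rw [ENNReal.ofReal_of_nonpos (not_lt.1 hq)] at h
    exact absurd h not_lt_zero
  rw [ENNReal.ofReal_lt_ofReal_iff hq, Real.sqrt_lt' hq] at h2
  exact h2.le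

end Tensors

/-! ### Representations with minimal bond dimensions -/

namespace Tensors
variable {d N : ℕ} [NeZero d]

/-- A matrix with dependent columns factors through a smaller space. -/
lemma exists_smaller_factor {m : Type} [Fintype m] {D : ℕ} {X : Matrix m (Fin D) ℂ}
    (hX : ¬Function.Injective X.mulVec) : ∃ D' < D, ∃ (E : Matrix (Fin D) (Fin D') ℂ)
      (F : Matrix (Fin D') (Fin D) ℂ), X * (E * F) = X := by
  obtain ⟨c, hc0, hc⟩ : ∃ c, c ≠ 0 ∧ X *ᵥ c = 0 := by
    simp only [Function.Injective, not_forall] at hX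
    obtain ⟨v, w, h1, h2⟩ := hX
    exact ⟨v - w, sub_ne_zero.2 h2, by rw [Matrix.mulVec_sub]; exact sub_eq_zero.2 h1⟩
  obtain ⟨i, hi⟩ := Function.ne_iff.1 hc0
  rcases D with _ | D
  · exact i.elim0
  -- The relation `c` is subtracted so that column `i` is expressed through the others: `X * G = X`
  -- as `X` annihilates `c`, and row `i` of `G` vanishes, which frees the index `i`.
  set G : Matrix (Fin (D + 1)) (Fin (D + 1)) ℂ :=
    1 - (c i)⁻¹ • Matrix.vecMulVec c (Pi.single i 1) with hG
  have hrow : ∀ a, G i a = 0 := by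
    intro a
    rw [hG, Matrix.sub_apply, Matrix.smul_apply, Matrix.vecMulVec_apply, smul_eq_mul,
      ← mul_assoc, inv_mul_cancel₀ hi, one_mul, Matrix.one_apply, Pi.single_apply]
    by_cases h : i = a
    · rw [if_pos h, if_pos h.symm, sub_self]
    · rw [if_neg h, if_neg (Ne.symm h), sub_zero]
  refine ⟨D, Nat.lt_succ_self D, (1 : Matrix (Fin (D + 1)) (Fin (D + 1)) ℂ).submatrix id i.succAbove,
    G.submatrix i.succAbove id, ?_⟩
  have hEF : (1 : Matrix (Fin (D + 1)) (Fin (D + 1)) ℂ).submatrix id i.succAbove *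
      G.submatrix i.succAbove id = G := by
    ext a b
    have h := congrFun (congrFun (Matrix.one_mul G) a) b
    rw [Matrix.mul_apply, Fin.sum_univ_succAbove _ i, hrow, mul_zero, zero_add] at h
    exact h
  rw [hEF, hG, Matrix.mul_sub, Matrix.mul_one, Matrix.mul_smul, Matrix.mul_vecMulVec, hc]
  ext a b
  simp

/-- The tensors with given zero padding. -/
def ofPadded {n : ℕ} (T : ℕ → Fin d → Fin d → Matrix (Fin n) (Fin n) ℂ) (bond : ℕ → ℕ)
    (h0 : bond 0 = 1) (hN : bond N = 1) : Tensors d N where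
  bond := bond
  tensor k s t := Matrix.of fun a c =>
    if h : (a : ℕ) < n ∧ (c : ℕ) < n then T k s t ⟨a, h.1⟩ ⟨c, h.2⟩ else 0
  bond_zero := h0
  bond_last := hN

lemma padded_ofPadded {n : ℕ} {T : ℕ → Fin d → Fin d → Matrix (Fin n) (Fin n) ℂ} {bond : ℕ → ℕ}
    (h0 : bond 0 = 1) (hN : bond N = 1) {k : ℕ} {s t : Fin d}
    (hT : ∀ a c : Fin n, ¬((a : ℕ) < bond k ∧ (c : ℕ) < bond (k + 1)) → T k s t a c = 0) :
    (ofPadded T bond h0 hN : Tensors d N).padded n k s t = T k s t := by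
  ext a c
  rw [padded, pad_apply]
  split_ifs with h
  · simp [ofPadded]
  · exact (hT a c h).symm

lemma seg_one {n : ℕ} (T : ℕ → Fin d → Fin d → Matrix (Fin n) (Fin n) ℂ) (j : ℕ) (s t : ℕ → Fin d) :
    seg T j 1 s t = T j (s j) (t j) := by
  simp [seg]

lemma seg_congr_tensor {n : ℕ} {T T' : ℕ → Fin d → Fin d → Matrix (Fin n) (Fin n) ℂ} {j m : ℕ}
    (h : ∀ k, j ≤ k → k < j + m → ∀ s t, T k s t = T' k s t) (s t : ℕ → Fin d) :
    seg T j m s t = seg T' j m s t := by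
  induction m with
  | zero => rfl
  | succ m ih =>
    rw [seg, seg, ih (fun k h1 h2 => h k h1 (by omega)), h _ (by omega) (by omega)]

/-- Inserting a factorization at a cut. -/
lemma exists_insert (B : Tensors d N) {k D' : ℕ} (hk1 : 1 ≤ k) (hk : k < N)
    (E : Matrix (Fin (B.bond k)) (Fin D') ℂ) (F : Matrix (Fin D') (Fin (B.bond k)) ℂ)
    (h : B.leftMat k * (E * F) * (B.rightMat k)ᵀ = B.leftMat k * (B.rightMat k)ᵀ) :
    ∃ B' : Tensors d N, B'.toOp = B.toOp ∧ B'.bond = Function.update B.bond k D' := by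
  obtain ⟨n, hn0, hn, hnD⟩ : ∃ n, 0 < n ∧ (∀ l ≤ N, B.bond l ≤ n) ∧ D' ≤ n := by
    obtain ⟨n, hn0, hn⟩ := B.exists_le_bond N
    exact ⟨n + D', by omega, fun l hl => by have := hn l hl; omega, by omega⟩
  set T := B.padded n with hT
  -- `E` is absorbed into the tensor to the left of the cut and `F` into the one to its right; all
  -- other tensors are unchanged.
  set Ep : ℕ → Matrix (Fin n) (Fin n) ℂ := fun i => if i = k then pad n E else 1 with hEp
  set Fp : ℕ → Matrix (Fin n) (Fin n) ℂ := fun i => if i = k then pad n F else 1 with hFp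
  set T' : ℕ → Fin d → Fin d → Matrix (Fin n) (Fin n) ℂ :=
    fun i s t => Fp i * T i s t * Ep (i + 1) with hT'
  set bond' := Function.update B.bond k D' with hbond
  have h0 : bond' 0 = 1 := by
    rw [hbond, Function.update_of_ne (by omega)]; exact B.bond_zero
  have hN : bond' N = 1 := by
    rw [hbond, Function.update_of_ne (by omega)]; exact B.bond_last
  have hle : ∀ l ≤ N, bond' l ≤ n := by
    intro l hl
    rw [hbond, Function.update_apply]
    split_ifs
    · exact hnD
    · exact hn l hl
  have hsupp : ∀ i s t, ∀ a c : Fin n, ¬((a : ℕ) < bond' i ∧ (c : ℕ) < bond' (i + 1)) →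
      T' i s t a c = 0 := by
    intro i s t a c hac
    have hrow : ∀ a : Fin n, ¬(a : ℕ) < bond' i → ∀ c, (Fp i * T i s t) a c = 0 := by
      intro a ha c
      rw [hbond, Function.update_apply] at ha
      by_cases hi : i = k
      · rw [if_pos hi] at ha
        rw [Matrix.mul_apply]
        refine Finset.sum_eq_zero fun x _ => ?_
        simp only [hFp]
        rw [if_pos hi, pad_apply, dif_neg (fun h => ha h.1), zero_mul]
      · rw [if_neg hi] at ha
        simp only [hFp]
        rw [if_neg hi, Matrix.one_mul, hT, padded, pad_apply, dif_neg (fun h => ha h.1)]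
    by_cases ha : (a : ℕ) < bond' i
    · have hc : ¬(c : ℕ) < bond' (i + 1) := fun hc => hac ⟨ha, hc⟩
      rw [hbond, Function.update_apply] at hc
      simp only [hT', hEp]
      by_cases hi : i + 1 = k
      · rw [if_pos hi] at hc
        rw [if_pos hi, Matrix.mul_apply]
        refine Finset.sum_eq_zero fun x _ => ?_
        rw [pad_apply, dif_neg (fun h => hc h.2), mul_zero]
      · rw [if_neg hi] at hc
        rw [if_neg hi, Matrix.mul_one, Matrix.mul_apply]
        refine Finset.sum_eq_zero fun x _ => ?_
        rw [hT, padded, pad_apply, dif_neg (fun h => hc h.2), mul_zero]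
    · simp only [hT']
      rw [Matrix.mul_apply]
      exact Finset.sum_eq_zero fun x _ => by rw [hrow a ha, zero_mul]
  have hfar : ∀ i, i ≠ k → i + 1 ≠ k → ∀ s t, T' i s t = T i s t := by
    intro i h1 h2 s t
    simp only [hT', hFp, hEp]
    rw [if_neg h1, if_neg h2, Matrix.one_mul, Matrix.mul_one]
  have hleft : ∀ s t, seg T' 0 k s t = seg T 0 k s t * pad n E := by
    intro s t
    obtain ⟨k', rfl⟩ : ∃ k', k = k' + 1 := ⟨k - 1, by omega⟩
    rw [seg, seg, seg_congr_tensor (T := T') (T' := T)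
      (fun i _ hi => hfar i (by omega) (by omega)) s t, zero_add, Matrix.mul_assoc]
    congr 1
    simp only [hT', hFp, hEp]
    rw [if_neg (by omega), if_pos trivial, Matrix.one_mul]
  have hright : ∀ s t, seg T' k (N - k) s t = pad n F * seg T k (N - k) s t := by
    intro s t
    obtain ⟨r, hr⟩ : ∃ r, N - k = 1 + r := ⟨N - k - 1, by omega⟩
    rw [hr, seg_add, seg_add, seg_congr_tensor (T := T') (T' := T) (j := k + 1) (m := r)
      (fun i hi _ => hfar i (by omega) (by omega)) s t, ← Matrix.mul_assoc]
    congr 1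
    rw [seg_one, seg_one]
    simp only [hT', hFp, hEp]
    rw [if_pos trivial, if_neg (by omega), Matrix.mul_one]
  refine ⟨ofPadded T' bond' h0 hN, ?_, rfl⟩
  ext x y
  obtain ⟨x1, x2, rfl⟩ := exists_join k x
  obtain ⟨y1, y2, rfl⟩ := exists_join k y
  have e : ∀ (s : Config (Fin k) d) s', ∀ l, 0 ≤ l → l < 0 + k →
      put 0 (join k s s' : Config (Fin N) d) l = put 0 s l :=
    fun s s' l _ h => put_join_left hk.le s s' (by omega)
  have e' : ∀ (s : Config (Fin k) d) s', ∀ l, k ≤ l → l < k + (N - k) →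
      put 0 (join k s s' : Config (Fin N) d) l = put k s' l :=
    fun s s' l h h' => put_join_right s s' h (by omega)
  have hadd := seg_add (T := T') 0 k (N - k) (put 0 (join k x1 x2 : Config (Fin N) d))
    (put 0 (join k y1 y2 : Config (Fin N) d))
  rw [Nat.add_sub_cancel' hk.le, zero_add, hleft, hright, seg_congr (e _ _) (e _ _),
    seg_congr (e' _ _) (e' _ _)] at hadd
  rw [toOp_eq_seg _ (n := n) (o := ⟨0, hn0⟩) rfl hle, seg_congr_tensor (T' := T')
    (fun i _ _ s t => padded_ofPadded h0 hN (hsupp i s t)), hadd,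
    ← leftMat_mul_rightMat B hk.le (x1, y1) (x2, y2), ← h, Matrix.mul_assoc, ← Matrix.mul_assoc (pad n E),
    ← pad_mul hnD, Matrix.mul_assoc (B.leftMat k), Matrix.mul_apply, Matrix.mul_apply,
    ← sum_dite_lt (hn k hk.le)]
  refine Finset.sum_congr rfl fun a _ => ?_
  rw [B.seg_padded_left rfl (fun l hl => hn l (by omega))]
  by_cases ha : (a : ℕ) < B.bond k
  · rw [dif_pos ha, dif_pos ha]
    congr 1
    rw [Matrix.mul_apply, Matrix.mul_apply, ← sum_dite_lt (hn k hk.le)]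
    refine Finset.sum_congr rfl fun c _ => ?_
    rw [B.seg_padded_right rfl hk.le (fun l _ hl => hn l hl), pad_apply]
    by_cases hc : (c : ℕ) < B.bond k
    · rw [dif_pos hc, dif_pos hc, dif_pos ⟨ha, hc⟩]
      rfl
    · rw [dif_neg hc, dif_neg hc, mul_zero]
  · rw [dif_neg ha, dif_neg ha, zero_mul]

/-- The total bond dimension is minimized. A linear dependence on either side of a cut would allow a
smaller factorization to be inserted there. -/
lemma exists_minimal (A : Tensors d N) : ∃ B : Tensors d N, B.toOp = A.toOp ∧
    ∀ k, 1 ≤ k → k < N → Function.Injective (B.leftMat k).mulVec ∧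
      Function.Injective (B.rightMat k).mulVec := by
  classical
  have hex : ∃ n, ∃ B : Tensors d N, B.toOp = A.toOp ∧ ∑ i ∈ Finset.range N, B.bond i = n :=
    ⟨_, A, rfl, rfl⟩
  obtain ⟨B, hB, hsum⟩ := Nat.find_spec hex
  refine ⟨B, hB, fun k hk1 hk => ?_⟩
  have key : ∀ D' < B.bond k, ∀ (E : Matrix (Fin (B.bond k)) (Fin D') ℂ)
      (F : Matrix (Fin D') (Fin (B.bond k)) ℂ),
      B.leftMat k * (E * F) * (B.rightMat k)ᵀ ≠ B.leftMat k * (B.rightMat k)ᵀ := by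
    intro D' hD' E F h
    obtain ⟨B', hB', hbond⟩ := exists_insert B hk1 hk E F h
    refine Nat.find_min hex ?_ ⟨B', hB'.trans hB, rfl⟩
    rw [← hsum, hbond]
    refine Finset.sum_lt_sum (fun i _ => ?_) ⟨k, Finset.mem_range.2 hk, by simpa using hD'⟩
    rw [Function.update_apply]
    split_ifs with hi
    · rw [hi]; exact hD'.le
    · exact le_rfl
  constructor
  · by_contra hX
    obtain ⟨D', hD', E, F, h⟩ := exists_smaller_factor hX
    exact key D' hD' E F (by rw [h])
  · by_contra hX
    obtain ⟨D', hD', E, F, h⟩ := exists_smaller_factor hX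
    refine key D' hD' Fᵀ Eᵀ ?_
    have h' := congrArg Matrix.transpose h
    rw [Matrix.transpose_mul, Matrix.transpose_mul] at h'
    rw [Matrix.mul_assoc, h']

/-- The maximally mixed state. -/
def mixed (κ : Type) [Fintype κ] [DecidableEq κ] : Matrix κ κ ℂ := ((Fintype.card κ : ℂ)⁻¹) • 1

lemma isDensity_mixed (κ : Type) [Fintype κ] [DecidableEq κ] [Nonempty κ] : IsDensity (mixed κ) := by
  constructor
  · exact Matrix.PosSemidef.one.smul (by positivity)
  · rw [mixed, Matrix.trace_smul, Matrix.trace_one, smul_eq_mul, inv_mul_cancel₀]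
    exact_mod_cast Fintype.card_ne_zero

lemma posDef_of_injective {κ : Type} [Fintype κ] [DecidableEq κ] [Nonempty κ] {D : ℕ}
    {X : Matrix (κ × κ) (Fin D) ℂ} (hX : Function.Injective X.mulVec) {Q : Matrix (Fin D) (Fin D) ℂ}
    (hQ : ∀ m' m, Q m' m = ∑ t, ∑ t', ∑ s, mixed κ t t' * (star (X (s, t') m') * X (s, t) m)) :
    Q.PosDef := by
  have h : Q = ((Fintype.card κ : ℂ)⁻¹) • (Xᴴ * X) := by
    ext m' m
    rw [hQ, Matrix.smul_apply, Matrix.mul_apply, Fintype.sum_prod_type_right, smul_eq_mul,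
      Finset.mul_sum]
    refine Finset.sum_congr rfl fun t _ => ?_
    rw [Finset.sum_eq_single t, Finset.mul_sum]
    · simp [mixed]
    · intro t' _ ht'
      simp [mixed, Ne.symm ht']
    · simp
  rw [h]
  refine (Matrix.PosDef.conjTranspose_mul_self X hX).smul ?_
  positivity

/-- For a minimal representation the maximally mixed states give positive definite Gram matrices on
both sides of every cut, and there are finitely many cuts. -/
lemma conditioningNumber_ne_top (A : Tensors d N) : conditioningNumber A.toOp ≠ ⊤ := by
  obtain ⟨B, hB, h⟩ := exists_minimal A
  refine ne_top_of_le_ne_top ?_ (iInf₂_le B hB)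
  refine ne_of_lt ?_
  rw [conditioning]
  have : ∀ s : Finset ℕ, (∀ k ∈ s, B.cutConditioning k < ⊤) → ⨆ k ∈ s, B.cutConditioning k < ⊤ := by
    intro s hs
    rw [← Finset.sup_eq_iSup, Finset.sup_lt_iff bot_lt_top]
    exact hs
  refine this _ fun k hk => ?_
  obtain ⟨hk1, hk2⟩ := Finset.mem_Ico.1 hk
  obtain ⟨hX, hY⟩ := h k hk1 hk2
  have hQ : B.leftGram k (mixed _) ∈ B.leftSet k :=
    ⟨posDef_of_injective hX (B.leftGram_apply k _), _, isDensity_mixed _, rfl⟩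
  have hP : B.rightGram k (mixed _) ∈ B.rightSet k :=
    ⟨posDef_of_injective hY (B.rightGram_apply k _), _, isDensity_mixed _, rfl⟩
  exact lt_of_le_of_lt (iInf₂_le_of_le _ hP (iInf₂_le _ hQ)) ENNReal.ofReal_lt_top

end Tensors

/-! ### Relabelling the qudits of a circuit -/

section Relabel
variable {ι ι' : Type} [Fintype ι] [DecidableEq ι] [Fintype ι'] [DecidableEq ι'] {d : ℕ}

/-- The qudits of the image of a set. -/
def supportEquiv (e : ι ≃ ι') (S : Finset ι) : S ≃ S.map e.toEmbedding where
  toFun w := ⟨e w, Finset.mem_map_of_mem e.toEmbedding w.2⟩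
  invFun w := ⟨e.symm w, by
    obtain ⟨v, hv, hw⟩ := Finset.mem_map.1 w.2
    rw [← hw]
    simpa using hv⟩
  left_inv w := Subtype.ext (e.symm_apply_apply _)
  right_inv w := Subtype.ext (e.apply_symm_apply _)

/-- A gate acting on relabelled qudits. -/
def Gate.relabel (e : ι ≃ ι') (g : Gate ι d) : Gate ι' d where
  support := g.support.map e.toEmbedding
  support_nonempty := g.support_nonempty.map
  card_support_le := by rw [Finset.card_map]; exact g.card_support_le
  matrix := g.matrix.submatrix ((supportEquiv e g.support).arrowCongr (Equiv.refl _)).symm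
    ((supportEquiv e g.support).arrowCongr (Equiv.refl _)).symm
  unitary := by
    rw [Matrix.mem_unitaryGroup_iff, Matrix.star_eq_conjTranspose, Matrix.conjTranspose_submatrix,
      Matrix.submatrix_mul_equiv, ← Matrix.star_eq_conjTranspose, Matrix.mem_unitaryGroup_iff.1 g.unitary,
      Matrix.submatrix_one_equiv]

lemma Gate.relabel_toOp (e : ι ≃ ι') (g : Gate ι d) :
    (g.relabel e).toOp = g.toOp.submatrix (e.arrowCongr (Equiv.refl _)).symm
      (e.arrowCongr (Equiv.refl _)).symm := by
  ext x y
  have key : (∀ w, w ∉ (g.relabel e).support → x w = y w) ↔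
      ∀ w, w ∉ g.support → x (e w) = y (e w) := by
    constructor
    · intro h w hw
      refine h (e w) fun hw' => hw ?_
      obtain ⟨v, hv, hvw⟩ := Finset.mem_map.1 hw'
      rwa [← e.injective hvw]
    · intro h w hw
      have := h (e.symm w) fun hw' => hw (Finset.mem_map.2 ⟨_, hw', e.apply_symm_apply w⟩)
      simpa using this
  by_cases h : ∀ w, w ∉ g.support → x (e w) = y (e w)
  · exact (if_pos (key.2 h)).trans (if_pos h).symm
  · exact (if_neg fun h' => h (key.1 h')).trans (if_neg h).symm

/-- A layer acting on relabelled qudits. -/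
def Layer.relabel (e : ι ≃ ι') (l : Layer ι d) : Layer ι' d where
  gates := l.gates.map (Gate.relabel e)
  disjoint := List.pairwise_map.2 (l.disjoint.imp fun h => (Finset.disjoint_map _).2 h)

lemma list_prod_submatrix {n m : Type} [Fintype n] [DecidableEq n] [Fintype m] [DecidableEq m]
    (e : m ≃ n) (l : List (Matrix n n ℂ)) :
    l.prod.submatrix e e = (l.map fun M => M.submatrix e e).prod := by
  induction l with
  | nil => simp
  | cons M l ih => rw [List.prod_cons, List.map_cons, List.prod_cons, ← ih, Matrix.submatrix_mul_equiv]

lemma Layer.relabel_toOp (e : ι ≃ ι') (l : Layer ι d) :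
    (l.relabel e).toOp = l.toOp.submatrix (e.arrowCongr (Equiv.refl _)).symm
      (e.arrowCongr (Equiv.refl _)).symm := by
  rw [Layer.toOp, Layer.toOp, list_prod_submatrix, Layer.relabel, List.map_map, List.map_map]
  congr 1
  exact List.map_congr_left fun g _ => Gate.relabel_toOp e g

lemma Circuit.exists_relabel (e : ι ≃ ι') (c : Circuit ι d) :
    ∃ c' : Circuit ι' d, c'.depth = c.depth ∧
      ∀ x y, c'.toOp x y = c.toOp (fun w => x (e w)) fun w => y (e w) := by
  refine ⟨List.map (Layer.relabel e) c, List.length_map _, fun x y => ?_⟩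
  have h : Circuit.toOp (List.map (Layer.relabel e) c) = c.toOp.submatrix
      (e.arrowCongr (Equiv.refl _)).symm (e.arrowCongr (Equiv.refl _)).symm := by
    rw [Circuit.toOp, Circuit.toOp, list_prod_submatrix, List.map_map, List.map_map]
    congr 1
    exact List.map_congr_left fun l _ => Layer.relabel_toOp e l
  rw [h]
  rfl

end Relabel

/-! ### Circuits on sites and auxiliary qudits -/

section Implement
variable {N b d : ℕ} [NeZero d] {q : ℝ}

lemma rd_zero {x : Config (Reg N b) d} {k : ℕ} {s : Bool}
    (h : ∀ (k' : Fin (N + 1)) c, (k' : ℕ) = k → x (Sum.inr (k', s, c)) = 0) :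
    (rd x k s : ℕ) = 0 := by
  rw [rd]
  have : (fun c => if h : k < N + 1 then x (Sum.inr (⟨k, h⟩, s, c)) else 0) = fun _ : Fin b => (0 : Fin d) := by
    funext c
    split_ifs with hk
    · exact h _ _ rfl
    · rfl
  rw [this, finFunctionFinEquiv_apply]
  simp

lemma eq_zero_of_rd {x : Config (Reg N b) d} {k : ℕ} {s : Bool} (h : (rd x k s : ℕ) = 0)
    (k' : Fin (N + 1)) (hk : (k' : ℕ) = k) (c : Fin b) : x (Sum.inr (k', s, c)) = 0 := by
  have h0 : (rd (fun _ => 0 : Config (Reg N b) d) k s : ℕ) = 0 := rd_zero fun _ _ _ => rfl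
  exact eq_of_rd_eq (y := fun _ => 0) (Fin.ext (h.trans h0.symm)) k' hk c

lemma eq_zero_of_colSum {n m : Type} [Fintype n] [Fintype m] [DecidableEq n] {f : n → ℂ} {g : m → n}
    (hg : Function.Injective g) (h1 : ∑ i, ‖f i‖ ^ 2 = 1) (h2 : ∑ j, ‖f (g j)‖ ^ 2 = 1) {i : n}
    (hi : i ∉ Set.range g) : f i = 0 := by
  have h3 : ∑ i, ‖f i‖ ^ 2 = ∑ i ∈ Finset.univ.image g, ‖f i‖ ^ 2 +
      ∑ i ∈ Finset.univ \ Finset.univ.image g, ‖f i‖ ^ 2 := by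
    rw [add_comm, Finset.sum_sdiff (Finset.subset_univ _)]
  rw [Finset.sum_image (fun a _ b _ h => hg h), h1, h2] at h3
  have h4 : ∑ i ∈ Finset.univ \ Finset.univ.image g, ‖f i‖ ^ 2 = 0 := by linarith
  have h5 := (Finset.sum_eq_zero_iff_of_nonneg fun i _ => by positivity).1 h4 i (by
    rw [Finset.mem_sdiff, Finset.mem_image]
    exact ⟨Finset.mem_univ _, fun ⟨j, _, hj⟩ => hi ⟨j, hj⟩⟩)
  simpa using h5

lemma sum_norm_sq_col {n : Type} [Fintype n] [DecidableEq n] {V : Matrix n n ℂ}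
    (hV : V ∈ Matrix.unitaryGroup n ℂ) (y : n) : ∑ x, ‖V x y‖ ^ 2 = 1 := by
  have h := congrFun (congrFun (Matrix.mem_unitaryGroup_iff'.1 hV) y) y
  rw [Matrix.mul_apply, Matrix.one_apply_eq] at h
  have h' := congrArg Complex.re h
  rw [Complex.re_sum, Complex.one_re] at h'
  rw [← h']
  refine Finset.sum_congr rfl fun x _ => ?_
  rw [Matrix.star_apply, ← Complex.normSq_eq_norm_sq, Complex.star_def, mul_comm, Complex.mul_conj,
    Complex.ofReal_re]

/-- The encoding only controls outputs with clean inner registers. Among these, the entries of a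
column of `U` already exhaust the norm 1 of the corresponding column of `V`, so every output with a
dirty register has amplitude 0. -/
lemma IsoData.apply_of_encodes (A : IsoData N d b q) {U : Op (Fin N) d}
    (hU : U ∈ Matrix.unitaryGroup (Config (Fin N) d) ℂ)
    (hW : ∀ (x y : Config (Fin N) d) (a c : Fin (d ^ b)),
      A.W 0 N (put 0 x) (put 0 y) a c = if (a : ℕ) = 0 ∧ (c : ℕ) = 0 then U x y else 0)
    {V : Matrix (Config (Reg N b) d) (Config (Reg N b) d) ℂ}
    (hV : V ∈ Matrix.unitaryGroup (Config (Reg N b) d) ℂ) (hVA : A.Encodes 0 N V 1)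
    (x y : Config (Fin N) d) (a : Config (Fin (N + 1) × Bool × Fin b) d) :
    V (Sum.elim x a) (Sum.elim y fun _ => 0) = if a = (fun _ => 0) then U x y else 0 := by
  classical
  have hph : ∀ (x : Config (Fin N) d) (a : Config (Fin (N + 1) × Bool × Fin b) d) (l : ℕ), 0 ≤ l →
      l < 0 + N → ph (Sum.elim x a : Config (Reg N b) d) l = put 0 x l := by
    intro x a l _ hl
    rw [ph, dif_pos (by omega), put_apply _ (by omega) (by omega)]
    rfl
  have hinner : ∀ (x : Config (Fin N) d) (a : Config (Fin (N + 1) × Bool × Fin b) d),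
      (∀ i ∈ innerReg N b 0 N, (Sum.elim x a : Config (Reg N b) d) i = 0) →
      V (Sum.elim x a) (Sum.elim y fun _ => 0) = if a = (fun _ => 0) then U x y else 0 := by
    intro x a hin
    rw [hVA _ _ hin (fun i hi => by
      obtain ⟨-, c, rfl⟩ := mem_anc.1 hi
      rfl), Complex.ofReal_one, one_mul, IsoData.op, Matrix.of_apply, zero_add,
      A.W_congr (hph x a) (hph y _), hW]
    by_cases ha : a = fun _ => 0
    · subst ha
      rw [if_pos rfl, if_pos, if_pos]
      · exact ⟨rd_zero fun _ _ _ => rfl, rd_zero fun _ _ _ => rfl⟩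
      · refine ⟨fun w hw => ?_, hin⟩
        rcases w with i | c
        · exact absurd (mem_block.2 (by simp [InBlock])) hw
        · rfl
    · rw [if_neg ha]
      by_cases hblk : (∀ w, w ∉ block N b 0 N → (Sum.elim x a : Config (Reg N b) d) w =
          (Sum.elim y fun _ => 0 : Config (Reg N b) d) w) ∧
          ∀ i ∈ innerReg N b 0 N, (Sum.elim x a : Config (Reg N b) d) i = 0
      · rw [if_pos hblk, if_neg]
        rintro ⟨h1, h2⟩
        refine ha ?_
        funext ⟨k, s, c⟩
        by_cases hb : (Sum.inr (k, s, c) : Reg N b) ∈ block N b 0 N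
        · by_cases hi : (Sum.inr (k, s, c) : Reg N b) ∈ innerReg N b 0 N
          · exact hin _ hi
          · rw [mem_block] at hb
            rw [mem_inner] at hi
            cases s
            · refine eq_zero_of_rd h1 k ?_ c
              simp only [InBlock, IsInner] at hb hi
              omega
            · refine eq_zero_of_rd h2 k ?_ c
              simp only [InBlock, IsInner] at hb hi
              omega
        · exact hblk.1 _ hb
      · rw [if_neg hblk]
  by_cases hin : ∀ i ∈ innerReg N b 0 N, (Sum.elim x a : Config (Reg N b) d) i = 0
  · exact hinner x a hin
  · rw [if_neg]
    · refine eq_zero_of_colSum (g := fun x : Config (Fin N) d =>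
        (Sum.elim x fun _ => 0 : Config (Reg N b) d)) (f := fun z => V z (Sum.elim y fun _ => 0))
        ?_ (sum_norm_sq_col hV _) ?_ ?_
      · intro x x' h
        funext i
        exact congrFun h (Sum.inl i)
      · rw [← sum_norm_sq_col hU y]
        refine Finset.sum_congr rfl fun x _ => ?_
        rw [hinner x _ (fun i hi => by
          obtain ⟨-, c, rfl⟩ := mem_anc.1 (inner_subset_anc _ _ hi)
          rfl), if_pos rfl]
      · rintro ⟨x', hx'⟩
        refine hin fun i hi => ?_
        rw [← hx']
        obtain ⟨-, c, rfl⟩ := mem_anc.1 (inner_subset_anc _ _ hi)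
        rfl
    · rintro rfl
      refine hin fun i hi => ?_
      obtain ⟨-, c, rfl⟩ := mem_anc.1 (inner_subset_anc _ _ hi)
      rfl

/-- There are `(N + 1) * (2 * b)` bond qudits, and the workspace duplicates sites and bond qudits
alike. -/
lemma IsoData.exists_circuit (A : IsoData N d b q) {U : Op (Fin N) d}
    (hU : U ∈ Matrix.unitaryGroup (Config (Fin N) d) ℂ)
    (hW : ∀ (x y : Config (Fin N) d) (a c : Fin (d ^ b)),
      A.W 0 N (put 0 x) (put 0 y) a c = if (a : ℕ) = 0 ∧ (c : ℕ) = 0 then U x y else 0)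
    {t : ℕ} (hA : A.Built 0 N t 1) :
    ∃ c : Circuit (Fin N ⊕ Fin (N + 2 * ((N + 1) * (2 * b)))) d, c.Implements U ∧ c.depth ≤ t := by
  obtain ⟨V, hV, hVA⟩ := hA
  have hVu := hV.mem_unitaryGroup
  obtain ⟨M, ⟨c, hct, -, rfl⟩, hM⟩ := hV
  let f : (Fin (N + 1) × Bool × Fin b) ⊕ (Fin N ⊕ (Fin (N + 1) × Bool × Fin b)) ≃
      Fin (N + 2 * ((N + 1) * (2 * b))) := Fintype.equivFinOfCardEq (by simp; ring)
  obtain ⟨c', hc', happ⟩ := c.exists_relabel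
    ((Equiv.sumAssoc (Fin N) (Fin (N + 1) × Bool × Fin b) (Reg N b)).trans
      (Equiv.sumCongr (Equiv.refl _) f))
  refine ⟨c', fun y x a => ?_, hc'.trans_le hct⟩
  have e : ∀ (x : Config (Fin N) d) (a : Config (Fin (N + 2 * ((N + 1) * (2 * b)))) d),
      (fun w => (Sum.elim x a : Config (Fin N ⊕ Fin (N + 2 * ((N + 1) * (2 * b)))) d)
        (((Equiv.sumAssoc (Fin N) (Fin (N + 1) × Bool × Fin b) (Reg N b)).trans
          (Equiv.sumCongr (Equiv.refl _) f)) w)) =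
      Sum.elim (Sum.elim x fun i => a (f (Sum.inl i)) : Config (Reg N b) d)
        (fun i => a (f (Sum.inr i)) : Config (Reg N b) d) := by
    intro x a
    funext w
    rcases w with (i | i) | i <;> rfl
  rw [happ, e, e]
  refine ((mul_clean_apply c.toOp _ (Sum.elim y fun _ => 0 : Config (Reg N b) d)).symm.trans
    (congrFun (congrFun hM _) _)).trans ?_
  rw [clean_mul_apply, A.apply_of_encodes hU hW hVu hVA]
  by_cases h1 : (fun i => a (f (Sum.inr i)) : Config (Reg N b) d) = fun _ => 0
  · by_cases h2 : (fun i => a (f (Sum.inl i))) = fun _ => (0 : Fin d)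
    · rw [if_pos h1, if_pos h2, if_pos]
      funext i
      obtain ⟨w, rfl⟩ := f.surjective i
      rcases w with w | w
      · exact congrFun h2 w
      · exact congrFun h1 w
    · rw [if_pos h1, if_neg h2, if_neg]
      rintro rfl
      exact h2 rfl
  · rw [if_neg h1, if_neg]
    rintro rfl
    exact h1 rfl

end Implement

/-! ### Products of one-qudit unitaries -/

section Product
variable {ι : Type} [Fintype ι] [DecidableEq ι] {d : ℕ}

lemma circOp_prod {u : ι → Matrix (Fin d) (Fin d) ℂ} (hu : ∀ i, u i ∈ Matrix.unitaryGroup (Fin d) ℂ)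
    (S : Finset ι) : CircOp S 1 (Matrix.of fun x y : Config ι d =>
      if ∀ w, w ∉ S → x w = y w then ∏ i ∈ S, u i (x i) (y i) else 0) := by
  induction S using Finset.induction_on with
  | empty =>
    convert (circOp_one (d := d) (∅ : Finset ι)).mono subset_rfl zero_le_one using 1
    ext x y
    rw [Matrix.one_apply, Matrix.of_apply, Finset.prod_empty]
    exact if_congr ⟨fun h => funext fun w => h w (Finset.notMem_empty w), fun h w _ => congrFun h w⟩
      rfl rfl
  | insert t S htS ih =>
    have h1 : CircOp {t} 1 (blk t fun _ : Config ι d => u t) :=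
      (circOp_ctrl (i := t) (t := t) (f := fun _ => u t) (fun _ => hu t) fun _ _ _ => rfl).mono
        (by simp) le_rfl
    have h2 := h1.parallel ih (Finset.disjoint_singleton_left.2 htS)
    rw [← Finset.insert_eq] at h2
    convert h2 using 1
    ext x y
    symm
    rw [Matrix.mul_apply, Finset.sum_eq_single (Function.update x t (y t))]
    · rw [blk_apply_of_agree (by intro w hw; simp [hw]), Function.update_self, Matrix.of_apply,
        Matrix.of_apply, Finset.prod_insert htS]
      have h3 : ∏ i ∈ S, u i (Function.update x t (y t) i) (y i) = ∏ i ∈ S, u i (x i) (y i) := by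
        refine Finset.prod_congr rfl fun i hi => ?_
        rw [Function.update_of_ne]
        rintro rfl
        exact htS hi
      have h4 : (∀ w, w ∉ S → Function.update x t (y t) w = y w) ↔
          ∀ w, w ∉ insert t S → x w = y w := by
        constructor
        · intro h w hw
          rw [Finset.mem_insert, not_or] at hw
          rw [← h w hw.2, Function.update_of_ne hw.1]
        · intro h w hw
          by_cases hwt : w = t
          · subst hwt; simp
          · rw [Function.update_of_ne hwt, h w (by simp [hwt, hw])]
      rw [h3, if_congr h4 rfl rfl, mul_ite, mul_zero]
    · intro z _ hz
      by_cases hxz : ∀ w, w ≠ t → x w = z w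
      · rw [Matrix.of_apply, if_neg, mul_zero]
        intro h
        refine hz ?_
        rw [← h t htS]
        exact eq_update_of_agree hxz
      · rw [blk_apply_of_not hxz, zero_mul]
    · simp

variable [NeZero d]

/-- The factors of a unitary of product form can be chosen unitary. -/
lemma exists_unitary_factors {τ : ι → Matrix (Fin d) (Fin d) ℂ} {U : Op ι d}
    (hU : U ∈ Matrix.unitaryGroup (Config ι d) ℂ) (h : ∀ x y, U x y = ∏ i, τ i (x i) (y i)) :
    ∃ u : ι → Matrix (Fin d) (Fin d) ℂ, (∀ i, u i ∈ Matrix.unitaryGroup (Fin d) ℂ) ∧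
      ∀ x y, U x y = ∏ i, u i (x i) (y i) := by
  have hG : ∀ y' y : Config ι d, ∏ i, ((τ i)ᴴ * τ i) (y' i) (y i) = if y' = y then 1 else 0 := by
    intro y' y
    have h1 := congrFun (congrFun (Matrix.mem_unitaryGroup_iff'.1 hU) y') y
    rw [Matrix.mul_apply, Matrix.one_apply] at h1
    rw [← h1]
    simp only [Matrix.mul_apply]
    rw [Finset.prod_univ_sum, Fintype.piFinset_univ]
    refine Finset.sum_congr rfl fun x _ => ?_
    rw [Matrix.star_apply, h, h, star_prod, ← Finset.prod_mul_distrib]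
    rfl
  set g : ι → ℝ := fun i => ∑ s, ‖τ i s 0‖ ^ 2 with hg
  have hgG : ∀ i, ((τ i)ᴴ * τ i) 0 0 = g i := by
    intro i
    rw [Matrix.mul_apply, hg]
    push_cast
    refine Finset.sum_congr rfl fun s _ => ?_
    rw [Matrix.conjTranspose_apply, Complex.star_def, mul_comm, Complex.mul_conj, Complex.normSq_eq_norm_sq]
    push_cast
    rfl
  have hg1 : ∏ i, g i = 1 := by
    have := hG (fun _ => 0) (fun _ => 0)
    rw [if_pos rfl] at this
    simp only [hgG] at this
    exact_mod_cast this
  have hg0 : ∀ i, 0 < g i := by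
    intro i
    refine lt_of_le_of_ne (Finset.sum_nonneg fun s _ => by positivity) fun h0 => ?_
    rw [Finset.prod_eq_zero (Finset.mem_univ i) h0.symm] at hg1
    exact zero_ne_one hg1
  -- Only the site `i` varies: since the product of all Gram matrices is the identity, each of them
  -- is a multiple `g i` of the identity, and the `g i` have product 1. Dividing by `√(g i)`
  -- therefore does not change the product.
  have hGi : ∀ i, (τ i)ᴴ * τ i = (g i : ℂ) • (1 : Matrix (Fin d) (Fin d) ℂ) := by
    intro i
    ext a' a
    have h1 := hG (Function.update (fun _ => 0) i a') (Function.update (fun _ => 0) i a)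
    rw [← Finset.mul_prod_erase _ _ (Finset.mem_univ i), Function.update_self, Function.update_self,
      Finset.prod_congr rfl (g := fun j => (g j : ℂ)) (fun j hj => by
        rw [Function.update_of_ne (Finset.ne_of_mem_erase hj),
          Function.update_of_ne (Finset.ne_of_mem_erase hj), hgG])] at h1
    have h2 : (g i : ℂ) * ∏ j ∈ Finset.univ.erase i, (g j : ℂ) = 1 := by
      rw [Finset.mul_prod_erase _ (fun j => (g j : ℂ)) (Finset.mem_univ i)]
      exact_mod_cast hg1
    have h3 : (Function.update (fun _ => 0) i a' : Config ι d) = Function.update (fun _ => 0) i a ↔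
        a' = a := ⟨fun h => by simpa using congrFun h i, fun h => by rw [h]⟩
    rw [if_congr h3 rfl rfl] at h1
    rw [Matrix.smul_apply, Matrix.one_apply, smul_eq_mul, ← h1, mul_left_comm, h2, mul_one]
  refine ⟨fun i => ((Real.sqrt (g i) : ℝ) : ℂ)⁻¹ • τ i, fun i => ?_, fun x y => ?_⟩
  · rw [Matrix.mem_unitaryGroup_iff', Matrix.star_eq_conjTranspose, Matrix.conjTranspose_smul,
      Matrix.smul_mul, Matrix.mul_smul, hGi, smul_smul, smul_smul]
    have h1 : star (((Real.sqrt (g i) : ℝ) : ℂ)⁻¹) = ((Real.sqrt (g i) : ℝ) : ℂ)⁻¹ := by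
      rw [star_inv₀, Complex.star_def, Complex.conj_ofReal]
    have h2 : ((Real.sqrt (g i) : ℝ) : ℂ) * ((Real.sqrt (g i) : ℝ) : ℂ) = (g i : ℂ) := by
      rw [← Complex.ofReal_mul, Real.mul_self_sqrt (hg0 i).le]
    have h3 : ((Real.sqrt (g i) : ℝ) : ℂ) ≠ 0 :=
      Complex.ofReal_ne_zero.2 (Real.sqrt_pos.2 (hg0 i)).ne'
    rw [h1, ← h2, show ((Real.sqrt (g i) : ℝ) : ℂ)⁻¹ * ((Real.sqrt (g i) : ℝ) : ℂ)⁻¹ *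
      (((Real.sqrt (g i) : ℝ) : ℂ) * ((Real.sqrt (g i) : ℝ) : ℂ)) = 1 by field_simp, one_smul]
  · rw [h]
    simp only [Matrix.smul_apply, smul_eq_mul, Finset.prod_mul_distrib]
    have : ∏ i, ((Real.sqrt (g i) : ℝ) : ℂ)⁻¹ = 1 := by
      rw [Finset.prod_inv_distrib, ← Complex.ofReal_prod, ← Real.sqrt_prod _ (fun i _ => (hg0 i).le),
        hg1]
      simp
    rw [this, one_mul]

end Product

namespace Tensors
variable {d N : ℕ} [NeZero d]

lemma seg_scalar (T : ℕ → Fin d → Fin d → Matrix (Fin 1) (Fin 1) ℂ) (m : ℕ) (s t : ℕ → Fin d) :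
    seg T 0 m s t 0 0 = ∏ l ∈ Finset.range m, T l (s l) (t l) 0 0 := by
  induction m with
  | zero => simp [seg]
  | succ m ih => rw [seg, Matrix.mul_apply, Fin.sum_univ_one, ih, Finset.prod_range_succ, zero_add]

/-- A matrix-product unitary with trivial bonds is implemented in depth one. -/
lemma exists_circuit_of_bond_le_one {B : Tensors d N} (hU : B.IsMPU) (h : ∀ l ≤ N, B.bond l ≤ 1) :
    ∃ c : Circuit (Fin N ⊕ Fin 0) d, c.Implements B.toOp ∧ c.depth ≤ 1 := by
  obtain ⟨u, hu, hprod⟩ := exists_unitary_factors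
    (τ := fun i : Fin N => Matrix.of fun s t => B.padded 1 i s t 0 0) hU (fun x y => by
      rw [B.toOp_eq_seg (n := 1) (o := 0) rfl h, seg_scalar, Finset.prod_range]
      refine Finset.prod_congr rfl fun i _ => ?_
      rw [put_apply _ (by omega) (by omega), put_apply _ (by omega) (by omega)]
      rfl)
  obtain ⟨c, hc, -, hcU⟩ := circOp_prod hu Finset.univ
  obtain ⟨c', hc', happ⟩ := c.exists_relabel (Equiv.sumEmpty (Fin N) (Fin 0)).symm
  refine ⟨c', fun y x a => ?_, hc'.trans_le hc⟩
  rw [happ, hcU, if_pos (Subsingleton.elim _ _), Matrix.of_apply, if_pos (by simp), hprod]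
  rfl

end Tensors

/-! ### Size and depth of the circuit -/

lemma synthDepth_le {d : ℕ} (hd : 2 ≤ d) (ℓ : ℕ) : synthDepth d ℓ ≤ 16 * (d ^ ℓ) ^ 4 := by
  have h := Nat.lt_pow_self (n := ℓ) (a := d) (by omega)
  have h1 : 2 * ℓ + 1 ≤ 2 * d ^ ℓ := by omega
  have h2 : 8 * ℓ + 1 ≤ 8 * d ^ ℓ := by omega
  calc synthDepth d ℓ = d ^ ℓ * (2 * ℓ + 1) * (d ^ ℓ * (8 * ℓ + 1)) := rfl
    _ ≤ d ^ ℓ * (2 * d ^ ℓ) * (d ^ ℓ * (8 * d ^ ℓ)) := by gcongr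
    _ = _ := by ring

/-- With `M = d^(8b+4) ≤ d^12 D^8`, all terms are bounded by multiples of `M^4`, which gives the
exponents 48 and 32. The constant is 16 + 2·(2·16 + 1024 + 6). -/
lemma block_depth_le {d b D : ℕ} (hd : 2 ≤ d) (hb : d ^ b ≤ d * D) :
    synthDepth d ((2 * b + 1) * 4) + 2 * overhead d b ≤ 2140 * d ^ 48 * D ^ 32 := by
  set M := d ^ ((2 * b + 1) * 4) with hM
  have hM1 : 1 ≤ M := Nat.one_le_pow _ _ (by omega)
  have h1 : synthDepth d ((2 * b + 1) * 4) ≤ 16 * M ^ 4 := synthDepth_le hd _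
  have h2 : synthDepth d (2 * b) ≤ 16 * M ^ 4 := by
    refine (synthDepth_le hd _).trans ?_
    have : d ^ (2 * b) ≤ M := Nat.pow_le_pow_right (by omega) (by omega)
    gcongr
  have h3 : b ≤ M := by
    have h := Nat.lt_pow_self (n := (2 * b + 1) * 4) (a := d) (by omega)
    omega
  have h4 : M ≤ M ^ 4 := Nat.le_self_pow (by omega) M
  have h5 : M ≤ d ^ 12 * D ^ 8 := by
    calc M = (d ^ b) ^ 8 * d ^ 4 := by rw [hM]; ring
      _ ≤ (d * D) ^ 8 * d ^ 4 := by gcongr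
      _ = _ := by ring
  have h6 : M ^ 4 ≤ d ^ 48 * D ^ 32 := by
    calc M ^ 4 ≤ (d ^ 12 * D ^ 8) ^ 4 := by gcongr
      _ = _ := by ring
  rw [overhead, mul_assoc]
  omega

/-- For `D ≥ 2` one has `b ≤ 1 + log₂ D ≤ 3 log D` and `1 ≤ 2 log D`. The number of auxiliary qudits
is at most `N + 8 N b`, hence the constant 2 + 24. -/
lemma ancilla_le {d b D N : ℕ} (hN : 1 ≤ N) (hD : 2 ≤ D) (hd : 2 ≤ d) (hb : d ^ b ≤ d * D) :
    ((N + 2 * ((N + 1) * (2 * b)) : ℕ) : ℝ) ≤ 26 * N * Real.log D := by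
  have hN' : (1 : ℝ) ≤ N := by exact_mod_cast hN
  have hlog : 0.6931471803 < Real.log 2 := Real.log_two_gt_d9
  have hlogD : Real.log 2 ≤ Real.log D := Real.log_le_log (by norm_num) (by exact_mod_cast hD)
  have h1 : ((b : ℝ) - 1) * Real.log 2 ≤ Real.log D := by
    rcases Nat.eq_zero_or_pos b with rfl | hb0
    · simp only [Nat.cast_zero]
      linarith
    · obtain ⟨b', rfl⟩ : ∃ b', b = b' + 1 := ⟨b - 1, by omega⟩
      have h2 : 2 ^ b' ≤ D := by
        have h3 : d * d ^ b' ≤ d * D := by rw [← pow_succ']; exact hb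
        exact (Nat.pow_le_pow_left hd b').trans (Nat.le_of_mul_le_mul_left h3 (by omega))
      have h4 : ((2 : ℝ) ^ b') ≤ D := by exact_mod_cast h2
      have h5 := Real.log_le_log (by positivity) h4
      rw [Real.log_pow] at h5
      push_cast
      linarith
  have h2 : (b : ℝ) ≤ 3 * Real.log D := by
    nlinarith
  push_cast
  have h3 : 2 * (((N : ℝ) + 1) * (2 * b)) ≤ 2 * ((2 * N) * (2 * b)) := by gcongr; linarith
  have h4 : (N : ℝ) * b ≤ N * (3 * Real.log D) := by gcongr
  have h5 : (N : ℝ) * 1 ≤ N * (2 * Real.log D) := by gcongr; linarith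
  linarith

/-- `q^(2K) = (4^K)^(log₂ q)`, so the left side is `(4^K)^(1 + log₂ q)`. -/
lemma pow_rounds_le {q : ℝ} (hq : 1 ≤ q) {K N : ℕ} (hK : 4 ^ K ≤ N) :
    (4 * q ^ 2) ^ K ≤ (N : ℝ) ^ (1 + Real.logb 2 q) := by
  have hx : 0 ≤ Real.logb 2 q := Real.logb_nonneg (by norm_num) hq
  have hK' : ((4 : ℝ) ^ K) ≤ N := by exact_mod_cast hK
  have h4 : (0 : ℝ) < 4 ^ K := by positivity
  have hqx : (2 : ℝ) ^ Real.logb 2 q = q := Real.rpow_logb (by norm_num) (by norm_num) (by linarith)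
  calc (4 * q ^ 2) ^ K = (4 : ℝ) ^ K * ((2 : ℝ) ^ Real.logb 2 q) ^ (2 * K) := by
        rw [hqx, mul_pow, pow_mul]
    _ = (4 : ℝ) ^ K * ((4 : ℝ) ^ K) ^ Real.logb 2 q := by
        congr 1
        rw [← Real.rpow_natCast, ← Real.rpow_mul (by norm_num), mul_comm, Real.rpow_mul (by norm_num),
          Real.rpow_natCast, pow_mul]
        norm_num
    _ = ((4 : ℝ) ^ K) ^ (1 + Real.logb 2 q) := by
        rw [Real.rpow_add h4, Real.rpow_one]
    _ ≤ _ := Real.rpow_le_rpow h4.le hK' (by linarith)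

/-- The perturbation of `q` multiplies the bound by `N^(1/N) ≤ 2`. It provides the strict inequality
by which a representation is selected from the infimum. -/
lemma rpow_perturb_le {q : ℝ} (hq : 1 ≤ q) {N : ℕ} (hN : 1 ≤ N) :
    (N : ℝ) ^ (1 + Real.logb 2 (q * 2 ^ (1 / N : ℝ))) ≤ 2 * (N : ℝ) ^ (1 + Real.logb 2 q) := by
  have hN0 : (0 : ℝ) < N := by exact_mod_cast hN
  rw [Real.logb_mul (by linarith) (by positivity), Real.logb_rpow (by norm_num) (by norm_num),
    ← add_assoc, Real.rpow_add hN0, mul_comm]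
  gcongr
  have h : (N : ℝ) ≤ 2 ^ N := by exact_mod_cast (Nat.lt_two_pow_self (n := N)).le
  calc (N : ℝ) ^ (1 / N : ℝ) ≤ ((2 : ℝ) ^ N) ^ (1 / N : ℝ) :=
        Real.rpow_le_rpow hN0.le h (by positivity)
    _ = 2 := by
        rw [← Real.rpow_natCast, ← Real.rpow_mul (by norm_num), mul_one_div_cancel hN0.ne', Real.rpow_one]

/-! ### The circuit for a representation with nearly optimal conditioning -/

namespace Tensors
variable {d N : ℕ} [NeZero d]

lemma bond_le_maxBond (A : Tensors d N) {l : ℕ} (hl : l ≤ N) : A.bond l ≤ A.maxBond :=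
  Finset.le_sup (f := A.bond) (Finset.mem_range.2 (by omega))

lemma one_le_maxBond (A : Tensors d N) : 1 ≤ A.maxBond := by
  have := A.bond_le_maxBond (Nat.zero_le N)
  rwa [A.bond_zero] at this

lemma bond_le_one_of_dim_one {B : Tensors d N} (hd : d = 1) {k : ℕ} {Q} (hQ : Q ∈ B.leftSet k) :
    B.bond k ≤ 1 := by
  subst hd
  obtain ⟨Z, hZ⟩ := exists_leftInverse (leftMat_injective hQ)
  have h := Matrix.rank_mul_le_right Z (B.leftMat k)
  rw [hZ, Matrix.rank_one, Fintype.card_fin] at h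
  refine h.trans ((Matrix.rank_le_card_height _).trans ?_)
  simp

/-- The circuit for the representation `B`, with `q` a bound on its conditioning. -/
lemma exists_circuit_of_lt {B : Tensors d N} (hN : 1 ≤ N) (hU : B.IsMPU) {q : ℝ} (hq : 1 ≤ q)
    (hB : B.conditioning < ENNReal.ofReal q) {D : ℕ} (hD : ∀ l ≤ N, B.bond l ≤ D) :
    ∃ (m : ℕ) (c : Circuit (Fin N ⊕ Fin m) d), c.Implements B.toOp ∧
      (c.depth : ℝ) ≤ 2140 * d ^ 48 * (N : ℝ) ^ (1 + Real.logb 2 q) * (D : ℝ) ^ 32 ∧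
      (m : ℝ) ≤ 26 * N * Real.log D := by
  have hN' : (1 : ℝ) ≤ N := by exact_mod_cast hN
  have hd1 : (1 : ℝ) ≤ d := by exact_mod_cast Nat.one_le_iff_ne_zero.2 (NeZero.ne d)
  have hD1 : 1 ≤ D := by
    have := hD 0 (Nat.zero_le _)
    rwa [B.bond_zero] at this
  have hD1' : (1 : ℝ) ≤ D := by exact_mod_cast hD1
  have hpow : (1 : ℝ) ≤ (N : ℝ) ^ (1 + Real.logb 2 q) :=
    Real.one_le_rpow hN' (by have := Real.logb_nonneg (b := 2) (by norm_num) hq; linarith)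
  -- Trivial bonds are a separate case: `log D` may be 0, so no auxiliary qudit is allowed, and `q`
  -- may be below 2.
  by_cases h1 : ∀ l ≤ N, B.bond l ≤ 1
  · obtain ⟨c, hc, hdepth⟩ := exists_circuit_of_bond_le_one hU h1
    refine ⟨0, c, hc, ?_, ?_⟩
    · have h2 : (c.depth : ℝ) ≤ 1 := by exact_mod_cast hdepth
      refine h2.trans ?_
      have h3 : (1 : ℝ) ≤ (d : ℝ) ^ 48 := one_le_pow₀ hd1
      have h4 : (1 : ℝ) ≤ (D : ℝ) ^ 32 := one_le_pow₀ hD1'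
      calc (1 : ℝ) ≤ 2140 * 1 * 1 * 1 := by norm_num
        _ ≤ _ := by gcongr
    · have := Real.log_nonneg hD1'
      simp only [Nat.cast_zero]
      positivity
  · obtain ⟨l, hl, hl2⟩ : ∃ l ≤ N, 2 ≤ B.bond l := by
      by_contra h
      exact h1 fun l hl => by by_contra h2; exact h ⟨l, hl, by omega⟩
    have hl0 : 1 ≤ l := by
      rcases Nat.eq_zero_or_pos l with rfl | h
      · rw [B.bond_zero] at hl2; omega
      · exact h
    have hlN : l < N := by
      refine lt_of_le_of_ne hl ?_
      rintro rfl
      rw [B.bond_last] at hl2; omega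
    have hex := fun k h h' => exists_of_conditioning_lt hB (k := k) h h'
    have hd2 : 2 ≤ d := by
      obtain ⟨P, hP, Q, hQ, -⟩ := hex l hl0 hlN
      by_contra hd
      have := bond_le_one_of_dim_one (by have := NeZero.ne d; omega) hQ
      omega
    have hq2 : 2 ≤ q := by
      have h2 := (bond_le_conditioning hU hl0 hlN).trans hB.le
      rw [← ENNReal.ofReal_natCast, ENNReal.ofReal_le_ofReal_iff (by linarith)] at h2
      have h3 : (2 : ℝ) ≤ B.bond l := by exact_mod_cast hl2
      linarith
    have hD2 : 2 ≤ D := hl2.trans (hD l hl)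
    -- This `b` gives the least power of `d` exceeding `D`: one level is left spare, and the loss is
    -- at most a factor `d`.
    set b := Nat.log d D + 1 with hb
    have hbD : D < d ^ b := Nat.lt_pow_succ_log_self (by omega) D
    have hbD' : d ^ b ≤ d * D := by
      rw [hb, pow_succ']
      exact Nat.mul_le_mul_left d (Nat.pow_log_le_self d (by omega))
    obtain ⟨A, hA⟩ := exists_isoData (b := b) hN hU (fun l hl => (hD l hl).trans_lt hbD) hex
    obtain ⟨r, hr, hbuilt⟩ := A.exists_built (by omega) (by omega) hq2
    obtain ⟨c, hc, hdepth⟩ := A.exists_circuit hU hA (hbuilt (Nat.log 4 N) 0 N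
      (Nat.pow_log_le_self 4 (by omega)) (Nat.lt_pow_succ_log_self (by omega) N).le (by omega))
    refine ⟨_, c, hc, ?_, ancilla_le hN hD2 hd2 hbD'⟩
    have h2 := block_depth_le hd2 hbD'
    have h3 : (c.depth : ℝ) ≤ (r : ℝ) ^ Nat.log 4 N * ((2140 * d ^ 48 * D ^ 32 : ℕ) : ℝ) := by
      exact_mod_cast hdepth.trans (Nat.mul_le_mul_left _ h2)
    refine h3.trans ?_
    have h4 : (r : ℝ) ^ Nat.log 4 N ≤ (N : ℝ) ^ (1 + Real.logb 2 q) :=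
      (pow_le_pow_left₀ (Nat.cast_nonneg r) hr _).trans
        (pow_rounds_le hq (Nat.pow_log_le_self 4 (by omega)))
    calc (r : ℝ) ^ Nat.log 4 N * ((2140 * d ^ 48 * D ^ 32 : ℕ) : ℝ)
        ≤ (N : ℝ) ^ (1 + Real.logb 2 q) * ((2140 * d ^ 48 * D ^ 32 : ℕ) : ℝ) := by gcongr
      _ = _ := by push_cast; ring

lemma one_le_conditioningNumber {A : Tensors d N} (hU : A.IsMPU) (hN : 2 ≤ N) :
    1 ≤ conditioningNumber A.toOp := by
  refine le_iInf₂ fun B hB => ?_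
  have hBU : B.IsMPU := by rw [IsMPU, hB]; exact hU
  refine le_trans ?_ (bond_le_conditioning hBU (k := 1) le_rfl (by omega))
  exact_mod_cast bond_pos hBU (by omega)

end Tensors

end MPU

end

theorem theorem2 (d : ℕ) [NeZero d] :
    ∃ (C : ℝ) (p : ℕ), ∀ (N : ℕ), 1 ≤ N → ∀ A : MPU.Tensors d N, A.IsMPU →
      MPU.conditioningNumber A.toOp ≠ ⊤ ∧
      ∃ (m : ℕ) (c : MPU.Circuit (Fin N ⊕ Fin m) d),
        c.Implements A.toOp ∧
        (c.depth : ℝ) ≤ C * (N : ℝ) ^ (1 + Real.logb 2 (MPU.conditioningNumber A.toOp).toReal)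
          * (A.maxBond : ℝ) ^ p ∧
        (m : ℝ) ≤ C * N * Real.log A.maxBond := by
  have hd1 : (1 : ℝ) ≤ d := by exact_mod_cast Nat.one_le_iff_ne_zero.2 (NeZero.ne d)
  -- 4280 is twice 2140, the factor 2 coming from the perturbation of `q`.
  refine ⟨4280 * d ^ 48, 32, fun N hN A hA => ⟨A.conditioningNumber_ne_top, ?_⟩⟩
  have hfin := A.conditioningNumber_ne_top
  have hN' : (1 : ℝ) ≤ N := by exact_mod_cast hN
  have hD1 : (1 : ℝ) ≤ A.maxBond := by exact_mod_cast A.one_le_maxBond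
  have hlog : 0 ≤ Real.log A.maxBond := Real.log_nonneg hD1
  have h48 : (1 : ℝ) ≤ (d : ℝ) ^ 48 := one_le_pow₀ hd1
  have h32 : (1 : ℝ) ≤ (A.maxBond : ℝ) ^ 32 := one_le_pow₀ hD1
  rcases Nat.lt_or_ge 1 N with hN2 | hN1
  · set q := (MPU.conditioningNumber A.toOp).toReal with hq
    have hq1 : 1 ≤ q := by
      have h := ENNReal.toReal_mono hfin (MPU.Tensors.one_le_conditioningNumber hA hN2)
      rwa [ENNReal.toReal_one] at h
    have hδ : (1 : ℝ) < 2 ^ (1 / N : ℝ) := Real.one_lt_rpow (by norm_num) (by positivity)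
    have hlt : MPU.conditioningNumber A.toOp < ENNReal.ofReal (q * 2 ^ (1 / N : ℝ)) := by
      rw [← ENNReal.ofReal_toReal hfin, ENNReal.ofReal_lt_ofReal_iff (by positivity)]
      exact lt_mul_of_one_lt_right (by linarith) hδ
    obtain ⟨B, hB⟩ := iInf_lt_iff.1 hlt
    obtain ⟨hBA, hB⟩ := iInf_lt_iff.1 hB
    have hBU : B.IsMPU := by rw [MPU.Tensors.IsMPU, hBA]; exact hA
    -- At inner cuts `B` has finite conditioning and hence minimal bonds, so the bound in terms of
    -- `B` is one in terms of `A`.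
    have hD : ∀ l ≤ N, B.bond l ≤ A.maxBond := by
      intro l hl
      rcases Nat.eq_zero_or_pos l with rfl | hl0
      · rw [B.bond_zero]; exact A.one_le_maxBond
      rcases Nat.eq_or_lt_of_le hl with rfl | hlN
      · rw [B.bond_last]; exact A.one_le_maxBond
      obtain ⟨P, hP, Q, hQ, -⟩ := MPU.Tensors.exists_of_conditioning_lt hB hl0 hlN
      exact (MPU.Tensors.bond_le_of_toOp_eq hBA hl hP hQ).trans (A.bond_le_maxBond hl)
    obtain ⟨m, c, hc, hdepth, hm⟩ := MPU.Tensors.exists_circuit_of_lt hN hBU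
      (one_le_mul_of_one_le_of_one_le hq1 hδ.le) hB hD
    refine ⟨m, c, hBA ▸ hc, hdepth.trans ?_, hm.trans ?_⟩
    · calc _ ≤ 2140 * (d : ℝ) ^ 48 * (2 * (N : ℝ) ^ (1 + Real.logb 2 q)) * (A.maxBond : ℝ) ^ 32 := by
            gcongr
            exact MPU.rpow_perturb_le hq1 hN
        _ = _ := by ring
    · gcongr
      linarith
  · obtain rfl : N = 1 := by omega
    obtain ⟨c, hc, hdepth⟩ := MPU.Tensors.exists_circuit_of_bond_le_one hA (fun l hl => by
      rcases Nat.le_one_iff_eq_zero_or_eq_one.1 hl with rfl | rfl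
      · exact A.bond_zero.le
      · exact A.bond_last.le)
    refine ⟨0, c, hc, ?_, ?_⟩
    · have h2 : (c.depth : ℝ) ≤ 1 := by exact_mod_cast hdepth
      refine h2.trans ?_
      rw [Nat.cast_one, Real.one_rpow]
      calc (1 : ℝ) ≤ 4280 * 1 * 1 * 1 := by norm_num
        _ ≤ _ := by gcongr
    · simp only [Nat.cast_zero]
      positivity
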